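/- **Setting.** Let $G$ be a finite graph with vertex set $V$ (with a fixed total order). A particle system with site space $X$ and jump rates $r$ has the generator $$Lf(\mathbf x)=\sum_{i<l,\ i\sim l} \Big( r(x_i,x_l)\big[f(\mathbf x-\delta_i+\delta_l)-f(\mathbf x)\big]+r(x_l,x_i)\big[f(\mathbf x-\delta_l+\delta_i)-f(\mathbf x)\big]\Big),\qquad \mathbf x\in X^V .$$ Conventions: $f(-1)=0$, and for $X=\{0,\dots,2j\}$ also $f(2j+1)=0$. All functions are complex valued, $L^2(w)=\{f:\sum_x|f(x)|^2w(x)<\infty\}$, and $(a)_m=a(a+1)\cdots(a+m-1)$. * **SIP$(2k)$**, $k>0$, $0<p<1$: $X=\mathbb N=\{0,1,\dots\}$, $r(a,b)=a(2k+b)$, $w(x)=\frac{\Gamma(2k+x)}{x!\,\Gamma(2k)}p^x(1-p)^{2k}$, $D^{\rm ch}(x,y)=\delta_{x,y}\frac{y!\,\Gamma(2k)}{\Gamma(2k+y)}p^{-y}$, $K^+f(x)=(2k+x)f(x+1)$, $K^-f(x)=xf(x-1)$, $K^0f(x)=(x+k)f(x)$, and $S_{\alpha,\beta}=\exp\big(\beta(-K^++\tfrac1pK^-)\big)\exp(i\alpha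 K^0)$. * **SEP$(2j)$**, $2j\in\{1,2,\dots\}$, $0<p<1$: $X=\{0,\dots,2j\}$, $r(a,b)=a(2j-b)$, $w(x)=\binom{2j}{x}\big(\tfrac p{1-p}\big)^x(1-p)^{2j}$, $D^{\rm ch}(x,y)=\delta_{x,y}\frac{(2j-y)!\,y!}{(2j)!}\big(\tfrac{1-p}p\big)^y$, $J^+f(x)=(2j-x)f(x+1)$, $J^-f(x)=xf(x-1)$, $J^0f(x)=(x-j)f(x)$, and $S_{\alpha,\beta}=\exp\big(\beta(-J^++\tfrac{1-p}pJ^-)\big)\exp(i\alpha J^0)$ (matrix exponentials). * **IRW**, $p>0$: $X=\mathbb N$, $r(a,b)=a$, $w(x)=\frac{p^x}{x!}e^{-p}$, $D^{\rm ch}(x,y)=\delta_{x,y}\,y!\,p^{-y}$, $a^\dagger f(x)=f(x+1)$, $af(x)=xf(x-1)$, and $S_{\alpha,\beta}=\exp\big(\beta(-pa^\dagger+a)\big)\exp(i\alpha aa^\dagger)$. For SIP and IRW, and $A$ one of the operators in the exponents (without the factor $\beta$ or $\alpha$), $\exp(tA)f$ for finitely supported $f$ denotes the value $g(t)$ of the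 solution $g:\mathbb R\to L^2(w)$ of $g'=Ag$, $g(0)=f$ (derivative in the norm of $L^2(w)$). On finitely supported functions on $X^V$ let $S_{\alpha,\beta}^{\otimes V}$ be the operator with matrix elements $\prod_{i\in V}(S_{\alpha,\beta}\,\delta_{y_i})(x_i)$, and let $w^{\otimes V}(\mathbf x)=\prod_i w(x_i)$. Put $D_{\alpha,\beta}(x,y)=S_{\alpha,\beta}\big(D^{\rm ch}(x,\cdot)\big)(y)$. **Theorem.** For SIP and IRW the exponentials above are well defined: for each finitely supported $f$ the solution $g$ exists and is unique. For each of the three systems and all $\alpha,\beta\in\mathbb R$: 1. $S_{\alpha,\beta}^{\otimes V}$ commutes with the generator: $S_{\alpha,\beta}^{\otimes V}LF=L\,S_{\alpha,\beta}^{\otimes V}F$ for every finitely supported $F$ on $X^V$. 2. $S_{\alpha,\beta}$ extends to a unitary operator on $L^2(w)$, and $S_{\alpha,\beta}^{\otimes V}$ to a unitary operator on $L^2(w^{\otimes V})$. For SEP these operators are already defined on the whole space and are unitary. 3. $\mathbf D(\mathbf x,\mathbf y)=\prod_{i\in V} D_{\alpha,\beta}(x_i,y_i)$ is a self-duality function of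 $L$: $[L\mathbf D(\cdot,\mathbf y)](\mathbf x)=[L\mathbf D(\mathbf x,\cdot)](\mathbf y)$ for all $\mathbf x,\mathbf y\in X^V$. 4. The functions $D_{\alpha,\beta}(x,\cdot)$, $x\in X$, lie in $L^2(w)$, are pairwise orthogonal, and $\|D_{\alpha,\beta}(x,\cdot)\|^2_w=\|D^{\rm ch}(x,\cdot)\|_w^2$. Likewise the functions $\mathbf D(\mathbf x,\cdot)$ in $L^2(w^{\otimes V})$, with the norms of $\prod_i D^{\rm ch}(x_i,\cdot)$. Moreover, for all $x,y\in X$: * SIP$(2k)$, $\alpha=\pi$, $\beta=\sqrt p\,\operatorname{artanh}\sqrt p$: $D_{\alpha,\beta}(x,y)=(p-1)^k\sum_{m\ge0}\frac{(-x)_m(-y)_m}{(2k)_m\,m!}\big(1-\tfrac1p\big)^m$ (Meixner polynomials), where $(p-1)^k=e^{i\pi k}(1-p)^k$. * SEP$(2j)$, $\alpha=\pi$, $\beta=\sqrt{\tfrac p{1-p}}\arctan\sqrt{\tfrac p{1-p}}$: $D_{\alpha,\beta}(x,y)=e^{-i\pi j}(1-p)^j\sum_{m=0}^{\min(x,y)}\frac{(-x)_m(-y)_m}{(-2j)_m\,m!}\,p^{-m}$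 (Krawtchouk polynomials). * IRW, $\alpha=\pi$, $\beta=1$: $D_{\alpha,\beta}(x,y)=e^{-p/2}\sum_{m\ge0}\frac{(-x)_m(-y)_m}{m!}\big(-\tfrac1p\big)^m$ (Charlier polynomials). -/

import Mathlib

open MeasureTheory
open scoped ENNReal

namespace OrthDuality

noncomputable section

/-! ### Weighted `L²` spaces over a countable set -/

section Abstract

variable {X : Type*}

/-- The measure on a countable set with point masses `w x`. -/
def weightMeasure [MeasurableSpace X] (w : X → ℝ) : Measure X :=
  Measure.count.withDensity fun x => ENNReal.ofReal (w x)

/-- The complex Hilbert space `L²(μ)`. -/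
abbrev L2 [MeasurableSpace X] (μ : Measure X) : Type _ := Lp ℂ 2 μ

/-- `g` is the trajectory of `f` under `A` in `L²(μ)`: it solves the Cauchy problem
`g' = A g`, `g 0 = f`, with the derivative taken in the norm of `L²(μ)`. (For the measures used
below all point masses are positive, so that elements of `L²(μ)` are functions, and
`A (g t)` is the given difference operator applied to the function `g t`.) -/
def IsExpOrbit [MeasurableSpace X] (μ : Measure X) (A : (X → ℂ) →ₗ[ℂ] (X → ℂ)) (f : X → ℂ)
    (g : ℝ → L2 μ) : Prop :=
  g 0 =ᵐ[μ] f ∧ ∀ t : ℝ, ∃ v : L2 μ, v =ᵐ[μ] A (g t) ∧ HasDerivAt g v t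

open Classical in
/-- `exp(t A) f` for a possibly unbounded operator `A` in `L²(μ)`: the value at time `t` of the
unique solution of the Cauchy problem `g' = A g`, `g 0 = f` (and `0` if there is no unique
solution). -/
def expOp [MeasurableSpace X] (μ : Measure X) (A : (X → ℂ) →ₗ[ℂ] (X → ℂ)) (t : ℝ)
    (f : X → ℂ) : X → ℂ :=
  if h : ∃! g : ℝ → L2 μ, IsExpOrbit μ A f g then ⇑(h.choose t) else 0

/-- `exp(t A) f` is well defined for every finitely supported `f`. -/
def ExpWellDefined [MeasurableSpace X] (μ : Measure X) (A : (X → ℂ) →ₗ[ℂ] (X → ℂ)) : Prop :=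
  ∀ f : X → ℂ, f.support.Finite → ∃! g : ℝ → L2 μ, IsExpOrbit μ A f g

/-- The operator `S`, considered on the finitely supported functions, extends to a unitary
operator of `L²(μ)`. On a finite set every function is finitely supported, and the condition says
that `S` itself is unitary. -/
def ExtendsToUnitary [MeasurableSpace X] (μ : Measure X) (S : (X → ℂ) → (X → ℂ)) : Prop :=
  ∃ U ∈ unitary (L2 μ →L[ℂ] L2 μ), ∀ f : X → ℂ, f.support.Finite →
    ∀ φ : L2 μ, φ =ᵐ[μ] f → U φ =ᵐ[μ] S f

/-- The functions `D x ·` lie in `L²(μ)`, are pairwise orthogonal, and `D x ·` has the same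
squared norm as `d x ·`. -/
def OrthogonalWithNormOf [MeasurableSpace X] [DecidableEq X] (μ : Measure X)
    (D : X → X → ℂ) (d : X → X → ℝ) : Prop :=
  (∀ x, MemLp (D x) 2 μ) ∧
    ∀ x x', ∫ y, D x y * (starRingEnd ℂ) (D x' y) ∂μ =
      if x = x' then ((∫ y, d x y ^ 2 ∂μ : ℝ) : ℂ) else 0

/-! ### Difference operators on one site

The site space is `ℕ` or `{0, …, n}`, the latter realised as `Fin (n + 1)`. Sums and differences in
`Fin (n + 1)` are taken modulo `n + 1`, but below the coefficient of `f (x + 1)` vanishes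
at `x = n`, and the coefficient of `f (x - 1)` vanishes at `x = 0`. This is the convention
`f (-1) = 0 = f (n + 1)`. -/

/-- `f ↦ c(x) f(x + 1)` -/
def shiftUp [Add X] [One X] (c : X → ℝ) : (X → ℂ) →ₗ[ℂ] (X → ℂ) where
  toFun f x := (c x : ℂ) * f (x + 1)
  map_add' f g := by ext x; simp [mul_add]
  map_smul' a f := by ext x; simp [mul_left_comm]

/-- `f ↦ c(x) f(x - 1)` -/
def shiftDown [Sub X] [One X] (c : X → ℝ) : (X → ℂ) →ₗ[ℂ] (X → ℂ) where
  toFun f x := (c x : ℂ) * f (x - 1)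
  map_add' f g := by ext x; simp [mul_add]
  map_smul' a f := by ext x; simp [mul_left_comm]

/-- `f ↦ c(x) f(x)` -/
def multBy (c : X → ℝ) : (X → ℂ) →ₗ[ℂ] (X → ℂ) where
  toFun f x := (c x : ℂ) * f x
  map_add' f g := by ext x; simp [mul_add]
  map_smul' a f := by ext x; simp [mul_left_comm]

/-! ### Particle systems on a finite graph -/

variable {V : Type*}

/-- The configuration `x - δ_i + δ_l`: one particle moves from `i` to `l`. (It enters the generators
only with a rate that vanishes when `i` is empty or `l` is full.) -/
def moveParticle [DecidableEq V] [Add X] [Sub X] [One X] (x : V → X) (i l : V) : V → X :=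
  Function.update (Function.update x i (x i - 1)) l (x l + 1)

/-- The generator for the edge `(i, l)`; `r a b` is the jump rate from a site with `a` particles to
a site with `b` particles. -/
def pairGen [DecidableEq V] [Add X] [Sub X] [One X] (r : X → X → ℝ) (i l : V)
    (f : (V → X) → ℂ) (x : V → X) : ℂ :=
  (r (x i) (x l) : ℂ) * (f (moveParticle x i l) - f x) +
    (r (x l) (x i) : ℂ) * (f (moveParticle x l i) - f x)

/-- The generator of the process: the sum over the edges `(i, l)`, `i < l`, of the graph. -/
def gen [Fintype V] [LinearOrder V] (G : SimpleGraph V) [DecidableRel G.Adj]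
    [Add X] [Sub X] [One X] (r : X → X → ℝ) (f : (V → X) → ℂ) (x : V → X) : ℂ :=
  ∑ i, ∑ l, if i < l ∧ G.Adj i l then pairGen r i l f x else 0

/-- The product operator `S ⊗ ⋯ ⊗ S`, one factor for each site, on finitely supported functions of
the configuration. Its matrix elements are `∏ᵢ (S δ_{yᵢ})(xᵢ)`. -/
def tensorOp [Fintype V] [DecidableEq X] (S : (X → ℂ) → (X → ℂ)) (F : (V → X) → ℂ)
    (x : V → X) : ℂ :=
  ∑ᶠ y : V → X, (∏ i, S (Pi.single (y i) 1) (x i)) * F y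

/-- `S` is a symmetry of `L`: the product operator commutes with the generator (on finitely
supported functions, that is, `[S, L] = 0` as matrices). -/
def IsSymmetry [Fintype V] [DecidableEq X] (L : ((V → X) → ℂ) → ((V → X) → ℂ))
    (S : (X → ℂ) → (X → ℂ)) : Prop :=
  ∀ F : (V → X) → ℂ, F.support.Finite → tensorOp S (L F) = L (tensorOp S F)

/-- The weight function of the homogeneous product measure with one-site weights `w`. -/
def prodWeight [Fintype V] (w : X → ℝ) (x : V → X) : ℝ := ∏ i, w (x i)

/-- The product function `∏ᵢ d(xᵢ, yᵢ)` of a one-site function `d`. -/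
def prodFun {M : Type*} [CommMonoid M] [Fintype V] (d : X → X → M) (x y : V → X) : M :=
  ∏ i, d (x i) (y i)

/-- `D` is a self-duality function of the generator `L`: `[L D(·, y)](x) = [L D(x, ·)](y)`. -/
def IsSelfDuality (L : ((V → X) → ℂ) → ((V → X) → ℂ)) (D : (V → X) → (V → X) → ℂ) : Prop :=
  ∀ x y, L (fun x' => D x' y) x = L (fun y' => D x y') y

/-- `S (d(x, ·)) (y)` -/
def applyTo (S : (X → ℂ) → (X → ℂ)) (d : X → X → ℝ) (x y : X) : ℂ :=
  S (fun z => (d x z : ℂ)) y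

end Abstract

/-! ### Hypergeometric functions and orthogonal polynomials -/

/-- The hypergeometric series `ᵣFₛ(a₁, …, aᵣ; b₁, …, bₛ; z)`; `ascPochhammer` is the rising
factorial. -/
def hyp (a b : List ℝ) (z : ℝ) : ℝ :=
  ∑' m : ℕ, (a.map fun t => (ascPochhammer ℝ m).eval t).prod /
    (b.map fun t => (ascPochhammer ℝ m).eval t).prod * (z ^ m / (m.factorial : ℝ))

/-- Meixner polynomials `₂F₁(-x, -y; 2k; 1 - 1/p)`. -/
def meixner (k p : ℝ) (x y : ℕ) : ℝ := hyp [-(x : ℝ), -(y : ℝ)] [2 * k] (1 - 1 / p)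

/-- Krawtchouk polynomials `₂F₁(-x, -y; -n; 1/p)`, `x, y = 0, …, n` (where `n = 2j`). -/
def krawtchouk (n : ℕ) (p : ℝ) (x y : Fin (n + 1)) : ℝ :=
  hyp [-((x : ℕ) : ℝ), -((y : ℕ) : ℝ)] [-(n : ℝ)] (1 / p)

/-- Charlier polynomials `₂F₀(-x, -y; -; -1/p)`. -/
def charlier (p : ℝ) (x y : ℕ) : ℝ := hyp [-(x : ℝ), -(y : ℝ)] [] (-1 / p)

/-! ### The inclusion process `SIP(2k)` and `su(1,1)` -/

namespace SIP

def Kplus (k : ℝ) : (ℕ → ℂ) →ₗ[ℂ] (ℕ → ℂ) := shiftUp fun x => 2 * k + x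

def Kminus : (ℕ → ℂ) →ₗ[ℂ] (ℕ → ℂ) := shiftDown fun x => x

def Kzero (k : ℝ) : (ℕ → ℂ) →ₗ[ℂ] (ℕ → ℂ) := multBy fun x => x + k

/-- negative binomial weights -/
def w (k p : ℝ) (x : ℕ) : ℝ :=
  Real.Gamma (2 * k + x) / ((x.factorial : ℝ) * Real.Gamma (2 * k)) * p ^ x * (1 - p) ^ (2 * k)

abbrev μ (k p : ℝ) : Measure ℕ := weightMeasure (w k p)

def rate (k : ℝ) (a b : ℕ) : ℝ := a * (2 * k + b)

/-- the cheap self-duality function on one site -/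
def cheap (k p : ℝ) (x y : ℕ) : ℝ :=
  if x = y then
    (y.factorial : ℝ) * Real.Gamma (2 * k) / Real.Gamma (2 * k + y) * (p ^ y)⁻¹ else 0

/-- `-K⁺ + K⁻ / p` -/
def A (k p : ℝ) : (ℕ → ℂ) →ₗ[ℂ] (ℕ → ℂ) := -Kplus k + ((1 / p : ℝ) : ℂ) • Kminus

/-- `exp(β (-K⁺ + K⁻ / p)) exp(i α K⁰)` -/
def S (k p α β : ℝ) (f : ℕ → ℂ) : ℕ → ℂ :=
  expOp (μ k p) (A k p) β (expOp (μ k p) (Complex.I • Kzero k) α f)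

end SIP

/-! ### The exclusion process `SEP(2j)` and `su(2)`, with `n = 2j` -/

namespace SEP

variable (n : ℕ)

def Jplus : (Fin (n + 1) → ℂ) →ₗ[ℂ] (Fin (n + 1) → ℂ) := shiftUp fun x => (n : ℝ) - ((x : ℕ) : ℝ)

def Jminus : (Fin (n + 1) → ℂ) →ₗ[ℂ] (Fin (n + 1) → ℂ) := shiftDown fun x => ((x : ℕ) : ℝ)

def Jzero : (Fin (n + 1) → ℂ) →ₗ[ℂ] (Fin (n + 1) → ℂ) :=
  multBy fun x => ((x : ℕ) : ℝ) - (n : ℝ) / 2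

/-- binomial weights -/
def w (p : ℝ) (x : Fin (n + 1)) : ℝ :=
  (n.choose (x : ℕ) : ℝ) * (p / (1 - p)) ^ (x : ℕ) * (1 - p) ^ n

abbrev μ (p : ℝ) : Measure (Fin (n + 1)) := weightMeasure (w n p)

def rate (a b : Fin (n + 1)) : ℝ := ((a : ℕ) : ℝ) * ((n : ℝ) - ((b : ℕ) : ℝ))

/-- the cheap self-duality function on one site -/
def cheap (p : ℝ) (x y : Fin (n + 1)) : ℝ :=
  if x = y then
    ((n - (y : ℕ)).factorial : ℝ) * ((y : ℕ).factorial : ℝ) / (n.factorial : ℝ) *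
      ((1 - p) / p) ^ (y : ℕ) else 0

/-- `-J⁺ + ((1 - p) / p) J⁻` -/
def A (p : ℝ) : (Fin (n + 1) → ℂ) →ₗ[ℂ] (Fin (n + 1) → ℂ) :=
  -Jplus n + (((1 - p) / p : ℝ) : ℂ) • Jminus n

/-- `exp(β (-J⁺ + ((1 - p) / p) J⁻)) exp(i α J⁰)`, with the exponentials of matrices. -/
def S (p α β : ℝ) (f : Fin (n + 1) → ℂ) : Fin (n + 1) → ℂ :=
  (NormedSpace.exp (LinearMap.toMatrix' ((β : ℂ) • A n p)) *
    NormedSpace.exp (LinearMap.toMatrix' ((Complex.I * α) • Jzero n))).mulVec f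

end SEP

/-! ### Independent random walkers and the Heisenberg algebra -/

namespace IRW

def adag : (ℕ → ℂ) →ₗ[ℂ] (ℕ → ℂ) := shiftUp fun _ => 1

def a : (ℕ → ℂ) →ₗ[ℂ] (ℕ → ℂ) := shiftDown fun x => x

/-- Poisson weights -/
def w (p : ℝ) (x : ℕ) : ℝ := p ^ x / (x.factorial : ℝ) * Real.exp (-p)

abbrev μ (p : ℝ) : Measure ℕ := weightMeasure (w p)

def rate (m _ : ℕ) : ℝ := m

/-- the cheap self-duality function on one site -/
def cheap (p : ℝ) (x y : ℕ) : ℝ := if x = y then (y.factorial : ℝ) / p ^ y else 0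

/-- `-p a† + a` -/
def A (p : ℝ) : (ℕ → ℂ) →ₗ[ℂ] (ℕ → ℂ) := -((p : ℂ) • adag) + a

/-- `exp(β (-p a† + a)) exp(i α a a†)` -/
def S (p α β : ℝ) (f : ℕ → ℂ) : ℕ → ℂ :=
  expOp (μ p) (A p) β (expOp (μ p) (Complex.I • (a ∘ₗ adag)) α f)

end IRW

end

end OrthDuality

namespace OrthDuality

noncomputable section

open Filter Topology ComplexConjugate

/-! ### `L²` of a countable set with positive weights: functions, inner products, differentiation -/

section WeightedL2

/-! All three systems follow one algebraic scheme. The site operators K⁺, K⁻ and the number operator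
N satisfy [N, K⁻] = K⁻, [N, K⁺] = -K⁺ and [K⁺, K⁻] = κ + 2σN, with σ = 1, -1, 0 for inclusion,
exclusion and independent walkers. The generator of an edge is the Casimir tensor K⁺⊗K⁻ + K⁻⊗K⁺ - 2σ
N⊗N - κ(N⊗1 + 1⊗N). For A = -uK⁺ + vK⁻, conjugation by exp(tA) is an explicit automorphism of the
algebra, with coefficients in C = cosh ωt and s = sinh ωt / ω, ω² = σuv, and it preserves this
tensor (`casimir_invariant`).

On ℕ the operators are unbounded, so orbits are constructed instead of manipulating exponentials.
The orbit of the indicator of m particles is Q(t)^m vac(t) / m!, where Q(t) is the conjugate of K⁻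
and vac(t) is the explicit orbit of the empty site. The commutation relations make it a pointwise
solution (`hasDerivAt_state`), and geometric bounds make it a solution in `L²` (`hasDerivAt_toLp`).
The weights satisfy a balance relation that makes A skew-symmetric on its maximal domain
(`isMaximallySkew_nat`, `isMaximallySkew_of_finite`). Pairings of orbits are therefore conserved
(`IsExpOrbit.inner_add`). This gives uniqueness, orthogonality of the columns of the matrix of S,
and the adjoint relation between times t and -t, hence unitarity
(`IsIsometricKernel.extendsToUnitary`).

Divide each column of the matrix of S by its weight. On the resulting function D(x, y), the
operators K⁺, K⁻, N in y act as the conjugated operators in x (`intertwines`), up to reciprocal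
scalars that cancel in the Casimir tensor. Invariance of the tensor is then self-duality, and with
reversibility (`finsum_gen`) it becomes commutation of S with the generator.

For the polynomials, the states are eigenvectors of the conjugated N. At a time with C = v s the
eigenvalue equation is a hypergeometric difference equation whose solution is fixed by its value at
the empty site. The adjoint relation expresses that value through vac(-t). -/

theorem finite_support_single {X : Type*} [DecidableEq X] (y : X) (c : ℂ) :
    (Pi.single y c : X → ℂ).support.Finite :=
  (Set.finite_singleton y).subset Pi.support_single_subset

theorem eq_sum_single {X : Type*} [DecidableEq X] {f : X → ℂ} (hf : f.support.Finite) :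
    f = ∑ y ∈ hf.toFinset, f y • Pi.single y (1 : ℂ) := by
  funext x
  simp only [Finset.sum_apply, Pi.smul_apply, Pi.single_apply, smul_eq_mul,
    mul_ite, mul_one, mul_zero, Finset.sum_ite_eq, Set.Finite.mem_toFinset, Function.mem_support]
  split_ifs with h
  · rfl
  · simpa using h

theorem weightMeasure_singleton {X : Type*} [MeasurableSpace X] [MeasurableSingletonClass X]
    (w : X → ℝ) (x : X) :
    weightMeasure w {x} = ENNReal.ofReal (w x) := by
  rw [weightMeasure, withDensity_apply _ (measurableSet_singleton x)]
  simp

theorem lp_ext {X : Type*} [MeasurableSpace X] {w : X → ℝ}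
    {φ ψ : L2 (weightMeasure w)} (h : ∀ x, φ x = ψ x) : φ = ψ :=
  Lp.ext (ae_of_all _ h)

/-- Each point has positive mass, so only the empty set is null. Elements of `L2` can therefore be
treated as genuine functions and almost everywhere equalities as equalities. -/
theorem ae_weightMeasure_iff {X : Type*} [MeasurableSpace X] [MeasurableSingletonClass X]
    {w : X → ℝ} (hw : ∀ x, 0 < w x) {P : X → Prop} :
    (∀ᵐ x ∂weightMeasure w, P x) ↔ ∀ x, P x := by
  refine ⟨fun h x => ?_, fun h => ae_of_all _ h⟩
  by_contra hx
  have h1 : weightMeasure w {x} ≤ weightMeasure w {x | ¬ P x} := measure_mono (by simpa using hx)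
  rw [ae_iff.1 h, weightMeasure_singleton] at h1
  simp [(hw x).not_ge] at h1

variable {X : Type*} [MeasurableSpace X] [MeasurableSingletonClass X] {w : X → ℝ}

theorem eq_of_ae_eq (hw : ∀ x, 0 < w x) {M : Type*} {f g : X → M}
    (h : f =ᵐ[weightMeasure w] g) : f = g :=
  funext ((ae_weightMeasure_iff hw).1 h)

theorem coeFn_toLp_eq (hw : ∀ x, 0 < w x) {f : X → ℂ} (hf : MemLp f 2 (weightMeasure w)) :
    ⇑(hf.toLp f) = f :=
  eq_of_ae_eq hw hf.coeFn_toLp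

theorem coeFn_add_eq (hw : ∀ x, 0 < w x) (φ ψ : L2 (weightMeasure w)) : ⇑(φ + ψ) = ⇑φ + ⇑ψ :=
  eq_of_ae_eq hw (Lp.coeFn_add φ ψ)

theorem coeFn_sub_eq (hw : ∀ x, 0 < w x) (φ ψ : L2 (weightMeasure w)) : ⇑(φ - ψ) = ⇑φ - ⇑ψ :=
  eq_of_ae_eq hw (Lp.coeFn_sub φ ψ)

theorem coeFn_smul_eq (hw : ∀ x, 0 < w x) (c : ℂ) (φ : L2 (weightMeasure w)) :
    ⇑(c • φ) = c • ⇑φ :=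
  eq_of_ae_eq hw (Lp.coeFn_smul c φ)

theorem coeFn_zero_eq (hw : ∀ x, 0 < w x) : ⇑(0 : L2 (weightMeasure w)) = 0 :=
  eq_of_ae_eq hw (Lp.coeFn_zero _ _ _)

theorem coeFn_sum_eq (hw : ∀ x, 0 < w x) {ι : Type*} (s : Finset ι)
    (φ : ι → L2 (weightMeasure w)) : ⇑(∑ i ∈ s, φ i) = ∑ i ∈ s, ⇑(φ i) := by
  classical
  induction s using Finset.induction_on with
  | empty => simpa using coeFn_zero_eq hw
  | insert i s hi ih => rw [Finset.sum_insert hi, Finset.sum_insert hi, coeFn_add_eq hw, ih]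

theorem isExpOrbit_iff (hw : ∀ x, 0 < w x) {A : (X → ℂ) →ₗ[ℂ] (X → ℂ)} {f : X → ℂ}
    {g : ℝ → L2 (weightMeasure w)} :
    IsExpOrbit (weightMeasure w) A f g ↔
      ⇑(g 0) = f ∧ ∀ t, ∃ v : L2 (weightMeasure w), ⇑v = A (g t) ∧ HasDerivAt g v t := by
  have h : ∀ {f g : X → ℂ}, f =ᵐ[weightMeasure w] g ↔ f = g :=
    ⟨fun h => eq_of_ae_eq hw h, fun h => by rw [h]⟩
  simp only [IsExpOrbit, h]

variable [Countable X]

instance sigmaFinite_weightMeasure (w : X → ℝ) : SigmaFinite (weightMeasure w) := by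
  unfold weightMeasure; infer_instance

theorem weightMeasure_eq_sum_dirac (w : X → ℝ) :
    weightMeasure w = Measure.sum fun x => ENNReal.ofReal (w x) • Measure.dirac x := by
  conv_lhs => rw [← Measure.sum_smul_dirac (weightMeasure w)]
  simp only [weightMeasure_singleton]

theorem integrable_weightMeasure_iff (hw : ∀ x, 0 < w x) {E : Type*} [NormedAddCommGroup E]
    {f : X → E} :
    Integrable f (weightMeasure w) ↔ Summable fun x => w x * ‖f x‖ := by
  rw [weightMeasure_eq_sum_dirac, integrable_sum_dirac_iff (fun _ => ENNReal.ofReal_ne_top)]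
  simp only [ENNReal.toReal_ofReal (hw _).le]

theorem hasSum_integral_weightMeasure (hw : ∀ x, 0 < w x) {E : Type*} [NormedAddCommGroup E]
    [NormedSpace ℝ E] [CompleteSpace E] {f : X → E} (hf : Integrable f (weightMeasure w)) :
    HasSum (fun x => w x • f x) (∫ x, f x ∂weightMeasure w) := by
  have h := (integrable_weightMeasure_iff hw).1 hf
  rw [weightMeasure_eq_sum_dirac]
  have := hasSum_integral_sum_dirac (x := (id : X → X)) (c := fun x => ENNReal.ofReal (w x))
    (f := f) (fun _ => ENNReal.ofReal_ne_top)
    (by simpa only [ENNReal.toReal_ofReal (hw _).le, id_eq] using h)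
  simpa only [ENNReal.toReal_ofReal (hw _).le, id_eq] using this

theorem memLp_weightMeasure_iff (hw : ∀ x, 0 < w x) {f : X → ℂ} :
    MemLp f 2 (weightMeasure w) ↔ Summable fun x => w x * ‖f x‖ ^ 2 := by
  rw [memLp_two_iff_integrable_sq_norm (by fun_prop), integrable_weightMeasure_iff hw]
  simp

theorem memLp_of_finite_support (hw : ∀ x, 0 < w x) {f : X → ℂ} (hf : f.support.Finite) :
    MemLp f 2 (weightMeasure w) := by
  rw [memLp_weightMeasure_iff hw]
  refine summable_of_hasFiniteSupport (hf.subset fun x hx => ?_)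
  contrapose! hx
  simp_all

theorem hasSum_inner (hw : ∀ x, 0 < w x) (φ ψ : L2 (weightMeasure w)) :
    HasSum (fun x => (w x : ℂ) * (conj (φ x) * ψ x)) (inner ℂ φ ψ) := by
  have h := hasSum_integral_weightMeasure hw (L2.integrable_inner (𝕜 := ℂ) φ ψ)
  rw [← L2.inner_def] at h
  simpa [RCLike.inner_apply, mul_comm] using h

/-- The indicator function of a point, as an element of `L²`. -/
def deltaLp [DecidableEq X] (hw : ∀ x, 0 < w x) (y : X) : L2 (weightMeasure w) :=
  (memLp_of_finite_support hw (finite_support_single y 1)).toLp (Pi.single y (1 : ℂ))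

theorem coeFn_deltaLp [DecidableEq X] (hw : ∀ x, 0 < w x) (y : X) :
    ⇑(deltaLp hw y) = Pi.single y (1 : ℂ) :=
  coeFn_toLp_eq hw _

theorem inner_deltaLp [DecidableEq X] (hw : ∀ x, 0 < w x) (y : X) (φ : L2 (weightMeasure w)) :
    inner ℂ (deltaLp hw y) φ = w y * φ y := by
  rw [← (hasSum_inner hw _ φ).tsum_eq, tsum_eq_single y]
  · simp [coeFn_deltaLp]
  · intro x hx
    simp [coeFn_deltaLp, hx]

theorem eq_sum_deltaLp [DecidableEq X] (hw : ∀ x, 0 < w x) {f : X → ℂ} (hf : f.support.Finite)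
    {φ : L2 (weightMeasure w)} (hφ : ⇑φ = f) :
    φ = ∑ y ∈ hf.toFinset, f y • deltaLp hw y := by
  refine lp_ext fun x => ?_
  rw [coeFn_sum_eq hw, hφ, Finset.sum_apply]
  simp only [coeFn_smul_eq hw, coeFn_deltaLp, Pi.smul_apply, Pi.single_apply, smul_eq_mul,
    mul_ite, mul_one, mul_zero, Finset.sum_ite_eq, Set.Finite.mem_toFinset, Function.mem_support]
  split_ifs with h
  · rfl
  · simpa using h

/-- A family of functions with pointwise derivatives which are dominated by a square integrable
function is differentiable in `L²`. -/
theorem hasDerivAt_toLp (hw : ∀ x, 0 < w x) {f f' : ℝ → X → ℂ}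
    (hf : ∀ t, MemLp (f t) 2 (weightMeasure w)) (hf' : ∀ t, MemLp (f' t) 2 (weightMeasure w))
    (hd : ∀ t x, HasDerivAt (fun s => f s x) (f' t x) t) {t : ℝ} {b : X → ℝ}
    (hb : Summable fun x => w x * b x ^ 2) {R : ℝ} (hR : 0 < R)
    (hbd : ∀ s, |s - t| < R → ∀ x, ‖f' s x‖ ≤ b x) :
    HasDerivAt (fun s => (hf s).toLp (f s)) ((hf' t).toLp (f' t)) t := by
  have hb0 : ∀ x, 0 ≤ b x := fun x => (norm_nonneg _).trans (hbd t (by simpa using hR) x)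
  rw [hasDerivAt_iff_tendsto_slope_zero, tendsto_iff_norm_sub_tendsto_zero]
  set Q : ℝ → L2 (weightMeasure w) := fun h =>
    h⁻¹ • ((hf (t + h)).toLp (f (t + h)) - (hf t).toLp (f t)) - (hf' t).toLp (f' t) with hQ
  have hQx : ∀ h x, Q h x = h⁻¹ • (f (t + h) x - f t x) - f' t x := by
    intro h x
    have h1 : Q h = ((h⁻¹ : ℝ) : ℂ) • ((hf (t + h)).toLp (f (t + h)) - (hf t).toLp (f t))
        - (hf' t).toLp (f' t) := by
      rw [hQ]; congr 1
    rw [h1, coeFn_sub_eq hw, coeFn_smul_eq hw, coeFn_sub_eq hw, coeFn_toLp_eq hw,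
      coeFn_toLp_eq hw, coeFn_toLp_eq hw]
    simp
  -- The error of the difference quotient tends to 0 at each point. The mean value inequality bounds
  -- it by 2 b, so 4 w b² dominates the squared terms.
  have key : Tendsto (fun h => ∑' x, w x * ‖Q h x‖ ^ 2) (𝓝[≠] 0) (𝓝 (∑' _ : X, (0 : ℝ))) := by
    refine tendsto_tsum_of_dominated_convergence (bound := fun x => 4 * (w x * b x ^ 2))
      (hb.mul_left 4) (fun x => ?_) ?_
    · have h1 := (hasDerivAt_iff_tendsto_slope_zero.1 (hd t x))
      have h2 : Tendsto (fun h => Q h x) (𝓝[≠] 0) (𝓝 0) := by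
        simp only [hQx]
        simpa using h1.sub_const (f' t x)
      simpa using (h2.norm.pow 2).const_mul (w x)
    · have hball : ∀ᶠ h : ℝ in 𝓝[≠] 0, |h| < R :=
        eventually_nhdsWithin_of_eventually_nhds
          ((continuous_abs.tendsto (0 : ℝ)).eventually (by simpa using gt_mem_nhds hR))
      filter_upwards [hball] with h hh x
      have hmv : ‖f (t + h) x - f t x‖ ≤ b x * ‖t + h - t‖ := by
        refine (convex_Ioo (t - R) (t + R)).norm_image_sub_le_of_norm_hasDerivWithin_le
          (f := fun s => f s x) (f' := fun s => f' s x)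
          (fun s _ => (hd s x).hasDerivWithinAt) (fun s hs => hbd s ?_ x) ?_ ?_
        · rw [abs_lt]; constructor <;> linarith [hs.1, hs.2]
        · constructor <;> linarith
        · rw [abs_lt] at hh; constructor <;> linarith
      have h3 : ‖Q h x‖ ≤ 2 * b x := by
        rw [hQx]
        refine (norm_sub_le _ _).trans ?_
        have h4 : ‖f' t x‖ ≤ b x := hbd t (by simpa using hR) x
        have h5 : ‖h⁻¹ • (f (t + h) x - f t x)‖ ≤ b x := by
          rw [norm_smul, norm_inv]
          -- Only |h| < R was retained from the filter, so h = 0 remains; there `h⁻¹` is 0.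
          rcases eq_or_ne h 0 with rfl | hne
          · simpa using hb0 x
          · rw [inv_mul_le_iff₀ (norm_pos_iff.2 hne)]
            simpa [mul_comm] using hmv
        linarith
      rw [Real.norm_of_nonneg (by have := hw x; positivity)]
      have := hw x
      calc w x * ‖Q h x‖ ^ 2 ≤ w x * (2 * b x) ^ 2 := by gcongr
        _ = 4 * (w x * b x ^ 2) := by ring
  have hnorm : ∀ φ : L2 (weightMeasure w), ‖φ‖ = √(∑' x, w x * ‖φ x‖ ^ 2) := by
    intro φ
    rw [@norm_eq_sqrt_re_inner ℂ]
    congr 1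
    have h1 := (Complex.hasSum_iff _ _).1 (hasSum_inner hw φ φ)
    rw [RCLike.re_eq_complex_re, ← h1.1.tsum_eq]
    refine tsum_congr fun x => ?_
    rw [Complex.re_ofReal_mul, ← Complex.normSq_eq_conj_mul_self, Complex.ofReal_re,
      Complex.normSq_eq_norm_sq]
  have h6 := (Real.continuous_sqrt.tendsto _).comp key
  simp only [tsum_zero, Real.sqrt_zero] at h6
  refine h6.congr fun h => ?_
  rw [Function.comp_apply, ← hnorm]

/-! ### Orbits of skew-symmetric operators -/

/-- The maximal operator in `L²(μ)` defined by `A` is skew-symmetric. -/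
def IsMaximallySkew (w : X → ℝ) (A : (X → ℂ) →ₗ[ℂ] (X → ℂ)) : Prop :=
  ∀ φ ψ v v' : L2 (weightMeasure w), ⇑v = A φ → ⇑v' = A ψ →
    inner ℂ v ψ + inner ℂ φ v' = 0

variable {A : (X → ℂ) →ₗ[ℂ] (X → ℂ)}

/-- The derivative in s is ⟨Ag, h⟩ + ⟨g, Ah⟩ = 0. Taking t = 0 gives conservation of inner products;
taking s = -t gives the adjoint relation between opposite times. -/
theorem IsExpOrbit.inner_add (hw : ∀ x, 0 < w x) (hA : IsMaximallySkew w A) {f f' : X → ℂ}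
    {g h : ℝ → L2 (weightMeasure w)} (hg : IsExpOrbit (weightMeasure w) A f g)
    (hh : IsExpOrbit (weightMeasure w) A f' h) (t s : ℝ) :
    inner ℂ (g (t + s)) (h s) = inner ℂ (g t) (h 0) := by
  rw [isExpOrbit_iff hw] at hg hh
  have hd : ∀ s, HasDerivAt (fun s => inner ℂ (g (t + s)) (h s)) 0 s := by
    intro s
    obtain ⟨v, hv, hgv⟩ := hg.2 (t + s)
    obtain ⟨v', hv', hhv⟩ := hh.2 s
    have h1 : HasDerivAt (fun s => g (t + s)) v s := hgv.comp_const_add t s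
    have h2 := h1.inner ℂ hhv
    rwa [add_comm, hA _ _ v v' hv hv'] at h2
  have := is_const_of_deriv_eq_zero (fun s => (hd s).differentiableAt) (fun s => (hd s).deriv) s 0
  simpa using this

/-- The difference of two orbits is an orbit of 0, and its norm is conserved. -/
theorem IsExpOrbit.unique (hw : ∀ x, 0 < w x) (hA : IsMaximallySkew w A) {f : X → ℂ}
    {g h : ℝ → L2 (weightMeasure w)} (hg : IsExpOrbit (weightMeasure w) A f g)
    (hh : IsExpOrbit (weightMeasure w) A f h) : g = h := by
  have h0 : IsExpOrbit (weightMeasure w) A 0 (fun t => g t - h t) := by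
    rw [isExpOrbit_iff hw] at hg hh ⊢
    refine ⟨by rw [coeFn_sub_eq hw, hg.1, hh.1, sub_self], fun t => ?_⟩
    obtain ⟨v, hv, hgv⟩ := hg.2 t
    obtain ⟨v', hv', hhv⟩ := hh.2 t
    exact ⟨v - v', by rw [coeFn_sub_eq hw, hv, hv', coeFn_sub_eq hw, map_sub], hgv.sub hhv⟩
  funext t
  have h1 := h0.inner_add hw hA h0 0 t
  have h2 : g 0 - h 0 = 0 := by
    refine lp_ext fun x => ?_
    have := ((isExpOrbit_iff hw).1 h0).1
    rw [this, coeFn_zero_eq hw]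
  rw [h2, inner_zero_right, zero_add] at h1
  exact sub_eq_zero.1 (inner_self_eq_zero.1 h1)

theorem isExpOrbit_sum (hw : ∀ x, 0 < w x) {ι : Type*} (s : Finset ι) (c : ι → ℂ)
    {f : ι → X → ℂ} {g : ι → ℝ → L2 (weightMeasure w)}
    (h : ∀ i, IsExpOrbit (weightMeasure w) A (f i) (g i)) :
    IsExpOrbit (weightMeasure w) A (∑ i ∈ s, c i • f i) (fun t => ∑ i ∈ s, c i • g i t) := by
  simp only [isExpOrbit_iff hw] at h ⊢
  refine ⟨?_, fun t => ?_⟩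
  · rw [coeFn_sum_eq hw]
    exact Finset.sum_congr rfl fun i _ => by rw [coeFn_smul_eq hw, (h i).1]
  · choose v hv hd using fun i => (h i).2 t
    refine ⟨∑ i ∈ s, c i • v i, ?_, HasDerivAt.fun_sum fun i _ => (hd i).const_smul (c i)⟩
    rw [coeFn_sum_eq hw, coeFn_sum_eq hw, map_sum]
    exact Finset.sum_congr rfl fun i _ => by
      rw [coeFn_smul_eq hw, coeFn_smul_eq hw, map_smul, hv]

theorem expWellDefined_of_single [DecidableEq X] (hw : ∀ x, 0 < w x) (hA : IsMaximallySkew w A)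
    {g : X → ℝ → L2 (weightMeasure w)}
    (hg : ∀ y, IsExpOrbit (weightMeasure w) A (Pi.single y 1) (g y)) :
    ExpWellDefined (weightMeasure w) A := by
  intro f hf
  have hsum := isExpOrbit_sum hw hf.toFinset f hg
  rw [← eq_sum_single hf] at hsum
  refine ⟨fun t => ∑ y ∈ hf.toFinset, f y • g y t, ?_, fun h hh => ?_⟩
  · exact hsum
  · exact hh.unique hw hA hsum

theorem expOp_eq_of_isExpOrbit (hw : ∀ x, 0 < w x) (hA : IsMaximallySkew w A) {f : X → ℂ}
    {g : ℝ → L2 (weightMeasure w)} (hg : IsExpOrbit (weightMeasure w) A f g) (t : ℝ) :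
    expOp (weightMeasure w) A t f = g t := by
  have h : ∃! g : ℝ → L2 (weightMeasure w), IsExpOrbit (weightMeasure w) A f g :=
    ⟨g, hg, fun h hh => hh.unique hw hA hg⟩
  rw [expOp, dif_pos h, h.choose_spec.1.unique hw hA hg]

theorem expOp_eq_finsum [DecidableEq X] (hw : ∀ x, 0 < w x) (hA : IsMaximallySkew w A)
    {g : X → ℝ → L2 (weightMeasure w)}
    (hg : ∀ y, IsExpOrbit (weightMeasure w) A (Pi.single y 1) (g y)) {f : X → ℂ}
    (hf : f.support.Finite) (t : ℝ) (x : X) :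
    expOp (weightMeasure w) A t f x = ∑ᶠ y, g y t x * f y := by
  have h1 := isExpOrbit_sum hw hf.toFinset f hg
  rw [← eq_sum_single hf] at h1
  rw [expOp_eq_of_isExpOrbit hw hA h1, coeFn_sum_eq hw, Finset.sum_apply,
    finsum_eq_sum_of_support_subset (s := hf.toFinset)]
  · exact Finset.sum_congr rfl fun y _ => by
      rw [coeFn_smul_eq hw, Pi.smul_apply, smul_eq_mul, mul_comm]
  · intro y hy
    simp only [Set.Finite.coe_toFinset, Function.mem_support]
    exact right_ne_zero_of_mul hy

end WeightedL2

/-! ### Isometric kernels and unitary operators -/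

section Kernel

/-- The columns `M · y` of `M` are orthogonal in `L²(w)`, with the norms of the indicator functions
of points. -/
def IsIsometricKernel {X : Type*} [MeasurableSpace X] [DecidableEq X] (w : X → ℝ)
    (M : X → X → ℂ) : Prop :=
  (∀ y, MemLp (fun x => M x y) 2 (weightMeasure w)) ∧
    ∀ y y', ∫ x, M x y * conj (M x y') ∂weightMeasure w = if y = y' then (w y : ℂ) else 0

variable {X : Type*} [Countable X] [MeasurableSpace X] [MeasurableSingletonClass X]
  [DecidableEq X] {w : X → ℝ} {M M' : X → X → ℂ}

theorem IsIsometricKernel.inner_toLp (hw : ∀ x, 0 < w x) (hM : IsIsometricKernel w M) (y y' : X) :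
    inner ℂ ((hM.1 y).toLp) ((hM.1 y').toLp) = if y = y' then (w y : ℂ) else 0 := by
  rw [L2.inner_def]
  simp only [coeFn_toLp_eq hw, RCLike.inner_apply]
  rw [hM.2]
  simp only [eq_comm (a := y')]
  split_ifs with h
  · rw [h]
  · rfl

theorem integral_cheap_sq (hw : ∀ x, 0 < w x) (c : X → ℝ) (x : X) :
    ∫ y, (if x = y then c x else 0) ^ 2 ∂weightMeasure w = w x * c x ^ 2 := by
  have hi : Integrable (fun y => (if x = y then c x else 0) ^ 2) (weightMeasure w) := by
    rw [integrable_weightMeasure_iff hw]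
    refine summable_of_hasFiniteSupport ((Set.finite_singleton x).subset fun y hy => ?_)
    contrapose! hy
    simp_all [eq_comm]
  rw [← (hasSum_integral_weightMeasure hw hi).tsum_eq, tsum_eq_single x]
  · simp
  · intro y hy
    simp [hy.symm]

/-- The row of the duality function at x is c x times the column of M at x, which has squared norm w
x. Only orthogonality of columns is needed. -/
theorem IsIsometricKernel.orthogonalWithNormOf (hw : ∀ x, 0 < w x) (hM : IsIsometricKernel w M)
    (c : X → ℝ) : OrthogonalWithNormOf (weightMeasure w) (fun x y => c x * M y x)
      (fun x y => if x = y then c x else 0) := by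
  refine ⟨fun x => (hM.1 x).const_mul _, fun x x' => ?_⟩
  rw [integral_cheap_sq hw]
  have h : ∀ y, (c x : ℂ) * M y x * conj ((c x' : ℂ) * M y x') =
      (c x * c x' : ℂ) * (M y x * conj (M y x')) := by
    intro y
    rw [map_mul, Complex.conj_ofReal]
    ring
  simp only [h]
  rw [integral_const_mul, hM.2]
  split_ifs with h
  · subst h
    push_cast
    ring
  · ring

/-- The indicator functions of points, divided by their norms, are a Hilbert basis of `L²(w)`. -/
theorem exists_hilbertBasis_deltaLp (hw : ∀ x, 0 < w x) :
    ∃ e : HilbertBasis X ℂ (L2 (weightMeasure w)),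
      ∀ y, e y = (((√(w y))⁻¹ : ℝ) : ℂ) • deltaLp hw y := by
  have hon : Orthonormal ℂ fun y => (((√(w y))⁻¹ : ℝ) : ℂ) • deltaLp hw y := by
    rw [orthonormal_iff_ite]
    intro y y'
    rw [inner_smul_left, inner_smul_right, inner_deltaLp, coeFn_deltaLp, Complex.conj_ofReal,
      Pi.single_apply]
    split_ifs with h
    · subst h
      have h1 : (√(w y))⁻¹ * ((√(w y))⁻¹ * w y) = 1 := by
        have h2 := Real.mul_self_sqrt (hw y).le
        have h3 := (Real.sqrt_pos.2 (hw y)).ne'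
        field_simp
        nlinarith
      rw [mul_one]
      exact_mod_cast h1
    · simp
  refine ⟨HilbertBasis.mkOfOrthogonalEqBot hon ?_, fun y => by
    rw [HilbertBasis.coe_mkOfOrthogonalEqBot]⟩
  rw [Submodule.eq_bot_iff]
  intro φ hφ
  refine lp_ext fun y => ?_
  have h1 := (Submodule.mem_orthogonal _ _).1 hφ _ (Submodule.subset_span ⟨y, rfl⟩)
  simp only [inner_smul_left, inner_deltaLp, mul_eq_zero, map_eq_zero] at h1
  have h2 := (Real.sqrt_pos.2 (hw y)).ne'
  have h3 := (hw y).ne'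
  rw [coeFn_zero_eq hw]
  simp_all

/-- The isometry of `L²(w)` defined by an isometric kernel. -/
theorem IsIsometricKernel.exists_linearIsometry (hw : ∀ x, 0 < w x)
    (hM : IsIsometricKernel w M) :
    ∃ U : L2 (weightMeasure w) →ₗᵢ[ℂ] L2 (weightMeasure w),
      ∀ y, U (deltaLp hw y) = (hM.1 y).toLp := by
  obtain ⟨e, he⟩ := exists_hilbertBasis_deltaLp hw
  have hon : Orthonormal ℂ fun y => (((√(w y))⁻¹ : ℝ) : ℂ) • (hM.1 y).toLp := by
    have h := e.orthonormal
    rw [orthonormal_iff_ite] at h ⊢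
    intro y y'
    rw [← h y y', he, he]
    simp only [inner_smul_left, inner_smul_right, inner_deltaLp, coeFn_deltaLp,
      hM.inner_toLp hw, Pi.single_apply]
    simp
  let U := hon.orthogonalFamily.linearIsometry.comp e.repr.toLinearIsometry
  refine ⟨U, fun y => ?_⟩
  have h1 : U (e y) = (((√(w y))⁻¹ : ℝ) : ℂ) • (hM.1 y).toLp := by
    simp only [U, LinearIsometry.coe_comp, Function.comp_apply,
      LinearIsometryEquiv.coe_toLinearIsometry, HilbertBasis.repr_self]
    rw [OrthogonalFamily.linearIsometry_apply_single]
    simp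
  have h2 : (((√(w y))⁻¹ : ℝ) : ℂ) ≠ 0 := by
    have := (Real.sqrt_pos.2 (hw y)).ne'
    exact_mod_cast inv_ne_zero this
  rw [he, map_smul] at h1
  exact smul_right_injective _ h2 h1

/-- Both kernels define isometries, and the weighted transposition relation, tested on the basis of
point masses, says that one is the adjoint of the other. An isometry whose adjoint is an isometry is
unitary, so surjectivity needs no separate argument. -/
theorem IsIsometricKernel.extendsToUnitary (hw : ∀ x, 0 < w x) (hM : IsIsometricKernel w M)
    (hM' : IsIsometricKernel w M') (hadj : ∀ x y, (w x : ℂ) * M x y = w y * conj (M' y x))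
    {S : (X → ℂ) → (X → ℂ)}
    (hS : ∀ f : X → ℂ, f.support.Finite → S f = fun x => ∑ᶠ y, M x y * f y) :
    ExtendsToUnitary (weightMeasure w) S := by
  obtain ⟨U, hU⟩ := hM.exists_linearIsometry hw
  obtain ⟨U', hU'⟩ := hM'.exists_linearIsometry hw
  obtain ⟨e, he⟩ := exists_hilbertBasis_deltaLp hw
  have hd : Dense ((Submodule.span ℂ (Set.range e) : Submodule ℂ _) :
      Set (L2 (weightMeasure w))) := by
    rw [Submodule.dense_iff_topologicalClosure_eq_top]
    exact e.dense_span
  have hinner : ∀ y x, inner ℂ (U' (e y)) (e x) = inner ℂ (e y) (U (e x)) := by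
    intro y x
    simp only [he, map_smul, inner_smul_left, inner_smul_right, hU, hU', inner_deltaLp,
      coeFn_toLp_eq hw, hadj]
    rw [← inner_conj_symm _ (deltaLp hw x), inner_deltaLp, coeFn_toLp_eq hw, map_mul]
    simp only [Complex.conj_ofReal]
  have hadjU : U'.toContinuousLinearMap = star U.toContinuousLinearMap := by
    rw [ContinuousLinearMap.star_eq_adjoint]
    refine ContinuousLinearMap.ext_on hd ?_
    rintro _ ⟨y, rfl⟩
    have h2 : ∀ ψ, inner ℂ (U' (e y)) ψ = inner ℂ (e y) (U ψ) := by
      intro ψ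
      have h3 : (innerSL ℂ (U' (e y))) =
          (innerSL ℂ (e y)).comp U.toContinuousLinearMap := by
        refine ContinuousLinearMap.ext_on hd ?_
        rintro _ ⟨x, rfl⟩
        exact hinner y x
      exact congrArg (fun T : L2 (weightMeasure w) →L[ℂ] ℂ => T ψ) h3
    refine ext_inner_right ℂ fun ψ => ?_
    rw [ContinuousLinearMap.adjoint_inner_left]
    exact h2 ψ
  have hiso : ∀ T : L2 (weightMeasure w) →ₗᵢ[ℂ] L2 (weightMeasure w),
      star T.toContinuousLinearMap * T.toContinuousLinearMap = 1 := by
    intro T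
    rw [ContinuousLinearMap.star_eq_adjoint]
    exact (ContinuousLinearMap.norm_map_iff_adjoint_comp_self _).1 T.norm_map
  refine ⟨U.toContinuousLinearMap, ?_, ?_⟩
  · rw [Unitary.mem_iff]
    refine ⟨hiso U, ?_⟩
    have h4 := hiso U'
    rwa [hadjU, star_star] at h4
  · intro f hf φ hφ
    have hφ' := eq_of_ae_eq hw hφ
    refine ae_of_all _ fun x => ?_
    rw [eq_sum_deltaLp hw hf hφ', map_sum, coeFn_sum_eq hw, Finset.sum_apply, hS f hf]
    beta_reduce
    rw [finsum_eq_sum_of_support_subset (s := hf.toFinset)]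
    · refine Finset.sum_congr rfl fun y _ => ?_
      rw [map_smul, coeFn_smul_eq hw, LinearIsometry.coe_toContinuousLinearMap, hU,
        coeFn_toLp_eq hw, Pi.smul_apply, smul_eq_mul, mul_comm]
    · intro y hy
      simp only [Set.Finite.coe_toFinset, Function.mem_support]
      exact right_ne_zero_of_mul hy

end Kernel

/-! ### Products over the sites of the graph -/

section ProductKernel

theorem prodFun_ite {X V : Type*} [DecidableEq X] [Fintype V] (c : X → ℝ) :
    prodFun (V := V) (fun x y => if x = y then c x else 0) =
      fun x y => if x = y then ∏ i, c (x i) else 0 := by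
  funext x y
  rw [prodFun]
  split_ifs with h
  · subst h
    simp
  · obtain ⟨i, hi⟩ := Function.ne_iff.1 h
    exact Finset.prod_eq_zero (Finset.mem_univ i) (if_neg hi)

theorem prodWeight_pos {X V : Type*} [Fintype V] {w : X → ℝ} (hw : ∀ x, 0 < w x) (x : V → X) :
    0 < prodWeight w x :=
  Finset.prod_pos fun i _ => hw (x i)

theorem weightMeasure_prodWeight {X V : Type*} [Countable X] [MeasurableSpace X]
    [MeasurableSingletonClass X] [Fintype V] {w : X → ℝ} (hw : ∀ x, 0 < w x) :
    weightMeasure (prodWeight (V := V) w) = Measure.pi fun _ => weightMeasure w := by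
  refine Measure.ext_of_singleton fun x => ?_
  rw [weightMeasure_singleton, Measure.pi_singleton, prodWeight,
    ENNReal.ofReal_prod_of_nonneg fun i _ => (hw (x i)).le]
  simp only [weightMeasure_singleton]

variable {X V : Type*} [Countable X] [MeasurableSpace X] [MeasurableSingletonClass X]
  [DecidableEq X] [Fintype V] {w : X → ℝ} {M M' : X → X → ℂ}

/-- The product weights define the product measure, so integrals of product functions factor over
the sites. -/
theorem IsIsometricKernel.prodFun (hw : ∀ x, 0 < w x) (hM : IsIsometricKernel w M) :
    IsIsometricKernel (prodWeight (V := V) w) (prodFun M) := by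
  rw [IsIsometricKernel, weightMeasure_prodWeight hw]
  refine ⟨fun y => ?_, fun y y' => ?_⟩
  · rw [memLp_two_iff_integrable_sq_norm (by fun_prop)]
    simp only [OrthDuality.prodFun, norm_prod, ← Finset.prod_pow]
    exact Integrable.fintype_prod (f := fun i x => ‖M x (y i)‖ ^ 2) fun i =>
      (memLp_two_iff_integrable_sq_norm (by fun_prop)).1 (hM.1 (y i))
  · simp only [OrthDuality.prodFun, map_prod, ← Finset.prod_mul_distrib]
    rw [integral_fintype_prod_eq_prod (fun i x => M x (y i) * conj (M x (y' i)))]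
    simp only [hM.2]
    split_ifs with h
    · subst h
      simp [prodWeight]
    · obtain ⟨i, hi⟩ := Function.ne_iff.1 h
      exact Finset.prod_eq_zero (Finset.mem_univ i) (if_neg hi)

end ProductKernel

/-! ### The Lie algebra, its conjugation by the flow, and ladder states -/

section LadderAlgebra

variable {R : Type*} [Ring R] [Algebra ℂ R]

/-- Relations of the ladder operators `P`, `Q`, `N`: they span `su(1,1)`, `su(2)` or the Heisenberg
algebra (with the number operator), depending on the sign of `σ`. -/
structure LadderRelations (κ σ : ℂ) (P Q N : R) : Prop where
  N_mul_Q : N * Q = Q * N + Q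
  N_mul_P : N * P = P * N - P
  P_mul_Q : P * Q = Q * P + (κ • (1 : R) + (2 * σ) • N)

/-- For `C = cosh ωt`, `s = sinh ωt / ω`, `ω² = σuv` and `A = -uP + vQ`, this is
`exp(tA) Q exp(-tA)`. -/
def conjQ (κ σ u C s : ℂ) (P Q N : R) : R :=
  C ^ 2 • Q - (u * C * s) • (κ • (1 : R) + (2 * σ) • N) + (u ^ 2 * σ * s ^ 2) • P

/-- `exp(tA) P exp(-tA)`, as in `conjQ` -/
def conjP (κ σ v C s : ℂ) (P Q N : R) : R :=
  C ^ 2 • P - (v * C * s) • (κ • (1 : R) + (2 * σ) • N) + (v ^ 2 * σ * s ^ 2) • Q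

/-- `exp(tA) N exp(-tA)`, as in `conjQ` -/
def conjN (κ σ u v C s : ℂ) (P Q N : R) : R :=
  N - (C * s) • (u • P + v • Q) + (u * v * s ^ 2) • (κ • (1 : R) + (2 * σ) • N)

variable {κ σ u v C s : ℂ} {P Q N : R}

/-- A polynomial identity modulo C² - σuvs² = 1; no exponential of operators has to exist. -/
theorem LadderRelations.conj (h : LadderRelations κ σ P Q N)
    (hC : C ^ 2 - σ * u * v * s ^ 2 = 1) :
    LadderRelations κ σ (conjP κ σ v C s P Q N) (conjQ κ σ u C s P Q N)
      (conjN κ σ u v C s P Q N) := by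
  constructor <;>
  · simp only [conjQ, conjP, conjN, mul_add, add_mul, mul_sub, sub_mul, smul_mul_assoc,
      mul_smul_comm, h.N_mul_Q, h.N_mul_P, h.P_mul_Q, smul_add, smul_sub, one_mul, mul_one]
    match_scalars <;> grind

/-- The last bracket is the time derivative of the conjugated Q when C' = σuvs and s' = C, so this
is the equation Q' = [A, Q]. -/
theorem LadderRelations.commutator_conjQ (h : LadderRelations κ σ P Q N) :
    (-(u • P) + v • Q) * conjQ κ σ u C s P Q N =
      conjQ κ σ u C s P Q N * (-(u • P) + v • Q) + ((2 * C * (σ * u * v * s)) • Q -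
      (u * (C * C + σ * u * v * s * s)) • (κ • (1 : R) + (2 * σ) • N) +
      (u ^ 2 * σ * (2 * s * C)) • P) := by
  simp only [conjQ, mul_add, add_mul, mul_sub, sub_mul, smul_mul_assoc, neg_mul, mul_neg,
      mul_smul_comm, h.N_mul_Q, h.N_mul_P, h.P_mul_Q, smul_add, smul_sub, one_mul, mul_one]
  match_scalars <;> ring

/-- The states `Q ^ m f₀ / m!` built on the vacuum `f₀`. -/
def ladderState {E : Type*} [AddCommGroup E] [Module ℂ E] (Q : Module.End ℂ E) (f₀ : E) : ℕ → E
  | 0 => f₀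
  | m + 1 => ((m : ℂ) + 1)⁻¹ • Q (ladderState Q f₀ m)

section States

variable {E : Type*} [AddCommGroup E] [Module ℂ E] {κ σ : ℂ} {P Q N : Module.End ℂ E} {f₀ : E}

theorem apply_ladderState (Q : Module.End ℂ E) (f₀ : E) (m : ℕ) :
    Q (ladderState Q f₀ m) = ((m : ℂ) + 1) • ladderState Q f₀ (m + 1) := by
  rw [ladderState, smul_smul, mul_inv_cancel₀ (Nat.cast_add_one_ne_zero m), one_smul]

theorem LadderRelations.N_ladderState (h : LadderRelations κ σ P Q N) (hN : N f₀ = 0) (m : ℕ) :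
    N (ladderState Q f₀ m) = (m : ℂ) • ladderState Q f₀ m := by
  induction m with
  | zero => simpa [ladderState] using hN
  | succ m ih =>
    have h1 := congrArg (fun T : Module.End ℂ E => T (ladderState Q f₀ m)) h.N_mul_Q
    simp only [Module.End.mul_apply, LinearMap.add_apply, ih, map_smul] at h1
    rw [ladderState, map_smul, h1]
    push_cast
    module

/-- Commuting P through m + 1 factors Q collects the sum of κ + 2σi over i ≤ m, which is (m + 1)(κ +
σm); the normalisation removes the factor m + 1. -/
theorem LadderRelations.P_ladderState_succ (h : LadderRelations κ σ P Q N) (hN : N f₀ = 0)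
    (hP : P f₀ = 0) (m : ℕ) :
    P (ladderState Q f₀ (m + 1)) = (κ + σ * m) • ladderState Q f₀ m := by
  have h1 : ∀ m, P (ladderState Q f₀ (m + 1)) = ((m : ℂ) + 1)⁻¹ •
      (Q (P (ladderState Q f₀ m)) + (κ + 2 * σ * m) • ladderState Q f₀ m) := by
    intro m
    have h1 := congrArg (fun T : Module.End ℂ E => T (ladderState Q f₀ m)) h.P_mul_Q
    simp only [Module.End.mul_apply, LinearMap.add_apply, LinearMap.smul_apply,
      Module.End.one_apply, h.N_ladderState hN] at h1
    rw [ladderState, map_smul, h1]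
    module
  induction m with
  | zero => rw [h1, ladderState, hP]; simp
  | succ m ih =>
    rw [h1, ih, map_smul, apply_ladderState, smul_smul, ← add_smul, smul_smul]
    congr 1
    have := Nat.cast_add_one_ne_zero (R := ℂ) (m + 1)
    field_simp
    push_cast
    ring

end States

end LadderAlgebra

/-! ### Sites, flows and the explicit orbits -/

section Site

/-- A site space, in which site `x` has `idx x` particles, and parameters of the operators
`f ↦ (κ + σ idx x) f(x + 1)` and `f ↦ idx x f(x - 1)`. -/
structure LadderSite (X : Type*) [Add X] [Sub X] [One X] where
  idx : X → ℕ
  κ : ℝ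
  σ : ℝ
  idx_injective : Function.Injective idx
  pred : ∀ x, idx x ≠ 0 → idx (x - 1) + 1 = idx x ∧ x - 1 + 1 = x ∧ κ + σ * idx (x - 1) ≠ 0
  succ : ∀ x, κ + σ * idx x ≠ 0 → idx (x + 1) = idx x + 1 ∧ x + 1 - 1 = x

namespace LadderSite

variable {X : Type*} [Add X] [Sub X] [One X] (L : LadderSite X)

def up (x : X) : ℝ := L.κ + L.σ * L.idx x

def Kp : Module.End ℂ (X → ℂ) := shiftUp L.up

def Km : Module.End ℂ (X → ℂ) := shiftDown fun x => L.idx x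

def Kn : Module.End ℂ (X → ℂ) := multBy fun x => L.idx x

/-- the jump rates -/
def rate (a b : X) : ℝ := L.idx a * L.up b

theorem Kp_apply (f : X → ℂ) (x : X) : L.Kp f x = L.up x * f (x + 1) := rfl

theorem Km_apply (f : X → ℂ) (x : X) : L.Km f x = L.idx x * f (x - 1) := by
  simp [Km, shiftDown]

theorem Kn_apply (f : X → ℂ) (x : X) : L.Kn f x = L.idx x * f x := by
  simp [Kn, multBy]

/-- The case distinctions deal with the ends of the site space: where a shift would wrap around or
truncate, its coefficient vanishes, so the relations hold there too. -/
theorem relations : LadderRelations (L.κ : ℂ) (L.σ : ℂ) L.Kp L.Km L.Kn := by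
  constructor <;> refine LinearMap.ext fun f => funext fun x => ?_
  · simp only [Module.End.mul_apply, LinearMap.add_apply, Pi.add_apply, Kn_apply, Km_apply]
    rcases eq_or_ne (L.idx x) 0 with h | h
    · simp [h]
    · rw [← (L.pred x h).1]
      push_cast
      ring
  · simp only [Module.End.mul_apply, LinearMap.sub_apply, Pi.sub_apply, Kn_apply, Kp_apply]
    rcases eq_or_ne (L.up x) 0 with h | h
    · simp [h]
    · rw [(L.succ x h).1]
      push_cast
      ring
  · simp only [Module.End.mul_apply, LinearMap.add_apply, Pi.add_apply, Kn_apply, Kp_apply,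
      Km_apply, LinearMap.smul_apply, Pi.smul_apply, Module.End.one_apply, smul_eq_mul]
    have h1 : (L.up x : ℂ) * (L.idx (x + 1) * f (x + 1 - 1)) =
        L.up x * ((L.idx x + 1) * f x) := by
      rcases eq_or_ne (L.up x) 0 with h | h
      · simp [h]
      · rw [(L.succ x h).1, (L.succ x h).2]
        push_cast
        ring
    have h2 : (L.idx x : ℂ) * (L.up (x - 1) * f (x - 1 + 1)) =
        L.idx x * ((L.up x - L.σ) * f x) := by
      rcases eq_or_ne (L.idx x) 0 with h | h
      · simp [h]
      · rw [(L.pred x h).2.1, up, up, ← (L.pred x h).1]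
        push_cast
        ring
    rw [h1, h2, up]
    push_cast
    ring

end LadderSite

/-- A solution `(C, s, vac)` of the equations for the flow of `A = -u K⁺ + v K⁻`; `vac` is the orbit
of the indicator function of the empty site. -/
structure LadderFlow (X : Type*) [Add X] [Sub X] [One X] extends LadderSite X where
  u : ℝ
  v : ℝ
  C : ℝ → ℝ
  s : ℝ → ℝ
  vac : ℝ → X → ℂ
  C_zero : C 0 = 1
  s_zero : s 0 = 0
  hasDerivAt_C : ∀ t, HasDerivAt C (σ * u * v * s t) t
  hasDerivAt_s : ∀ t, HasDerivAt s (C t) t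
  C_sq_sub : ∀ t, C t ^ 2 - σ * u * v * s t ^ 2 = 1
  vac_zero : ∀ x, vac 0 x = if idx x = 0 then 1 else 0
  hasDerivAt_vac : ∀ t x, HasDerivAt (fun r => vac r x)
    (-(u * (κ + σ * idx x) * vac t (x + 1)) + v * idx x * vac t (x - 1)) t
  vac_up : ∀ t x, (C t : ℂ) * ((κ + σ * idx x) * vac t (x + 1)) =
    v * s t * (κ + σ * idx x) * vac t x
  vac_down : ∀ t x, (v * s t : ℂ) * (idx x * vac t (x - 1)) = C t * idx x * vac t x

namespace LadderFlow

variable {X : Type*} [Add X] [Sub X] [One X] (L : LadderFlow X)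

/-- the generator of the flow -/
def A : Module.End ℂ (X → ℂ) := -((L.u : ℂ) • L.Kp) + (L.v : ℂ) • L.Km

theorem A_apply (f : X → ℂ) (x : X) :
    L.A f x = -(L.u * L.up x * f (x + 1)) + L.v * L.idx x * f (x - 1) := by
  simp [A, LadderSite.Kp_apply, LadderSite.Km_apply, mul_assoc]

def Q (t : ℝ) : Module.End ℂ (X → ℂ) := conjQ L.κ L.σ L.u (L.C t) (L.s t) L.Kp L.Km L.Kn

def P (t : ℝ) : Module.End ℂ (X → ℂ) := conjP L.κ L.σ L.v (L.C t) (L.s t) L.Kp L.Km L.Kn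

def N (t : ℝ) : Module.End ℂ (X → ℂ) := conjN L.κ L.σ L.u L.v (L.C t) (L.s t) L.Kp L.Km L.Kn

/-- the orbit of the indicator function of the site with `m` particles -/
def state (m : ℕ) (t : ℝ) : X → ℂ := ladderState (L.Q t) (L.vac t) m

theorem C_sq_sub_complex (t : ℝ) : (L.C t : ℂ) ^ 2 - L.σ * L.u * L.v * L.s t ^ 2 = 1 := by
  exact_mod_cast L.C_sq_sub t

theorem relations_conj (t : ℝ) :
    LadderRelations (L.κ : ℂ) (L.σ : ℂ) (L.P t) (L.Q t) (L.N t) :=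
  L.relations.conj (L.C_sq_sub_complex t)

theorem Q_apply (t : ℝ) (f : X → ℂ) (x : X) :
    L.Q t f x = L.C t ^ 2 * (L.idx x * f (x - 1)) -
      L.u * L.C t * L.s t * ((L.κ + 2 * L.σ * L.idx x) * f x) +
      L.u ^ 2 * L.σ * L.s t ^ 2 * (L.up x * f (x + 1)) := by
  simp only [Q, conjQ, LinearMap.add_apply, LinearMap.sub_apply, LinearMap.smul_apply,
    Pi.add_apply, Pi.sub_apply, Pi.smul_apply, LadderSite.Kp_apply, LadderSite.Km_apply,
    LadderSite.Kn_apply, Module.End.one_apply, smul_eq_mul]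
  ring

theorem P_apply (t : ℝ) (f : X → ℂ) (x : X) :
    L.P t f x = L.C t ^ 2 * (L.up x * f (x + 1)) -
      L.v * L.C t * L.s t * ((L.κ + 2 * L.σ * L.idx x) * f x) +
      L.v ^ 2 * L.σ * L.s t ^ 2 * (L.idx x * f (x - 1)) := by
  simp only [P, conjP, LinearMap.add_apply, LinearMap.sub_apply, LinearMap.smul_apply,
    Pi.add_apply, Pi.sub_apply, Pi.smul_apply, LadderSite.Kp_apply, LadderSite.Km_apply,
    LadderSite.Kn_apply, Module.End.one_apply, smul_eq_mul]
  ring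

theorem N_apply (t : ℝ) (f : X → ℂ) (x : X) :
    L.N t f x = L.idx x * f x -
      L.C t * L.s t * (L.u * (L.up x * f (x + 1)) + L.v * (L.idx x * f (x - 1))) +
      L.u * L.v * L.s t ^ 2 * ((L.κ + 2 * L.σ * L.idx x) * f x) := by
  simp only [N, conjN, LinearMap.add_apply, LinearMap.sub_apply, LinearMap.smul_apply,
    Pi.add_apply, Pi.sub_apply, Pi.smul_apply, LadderSite.Kp_apply, LadderSite.Km_apply,
    LadderSite.Kn_apply, Module.End.one_apply, smul_eq_mul]
  ring

/-- The two first-order relations `vac_up` and `vac_down` say that the vacuum orbit is essentially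
geometric in x. The second-order operator P applied to it is a combination of the two; the same
relations, with C² - σuvs² = 1, give the vanishing under N. -/
theorem P_vac (t : ℝ) : L.P t (L.vac t) = 0 := by
  funext x
  have h1 := L.vac_up t x
  have h2 := L.vac_down t x
  rw [P_apply, LadderSite.up, Pi.zero_apply]
  push_cast
  linear_combination (L.C t : ℂ) * h1 + (L.v * L.σ * L.s t : ℂ) * h2

theorem N_vac (t : ℝ) : L.N t (L.vac t) = 0 := by
  funext x
  have h1 := L.vac_up t x
  have h2 := L.vac_down t x
  have h3 := L.C_sq_sub_complex t
  rw [N_apply, LadderSite.up, Pi.zero_apply]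
  push_cast
  linear_combination (-(L.u * L.s t : ℂ)) * h1 - (L.C t : ℂ) * h2 - L.idx x * L.vac t x * h3

theorem Q_state (m : ℕ) (t : ℝ) : L.Q t (L.state m t) = ((m : ℂ) + 1) • L.state (m + 1) t :=
  apply_ladderState _ _ m

theorem N_state (m : ℕ) (t : ℝ) : L.N t (L.state m t) = (m : ℂ) • L.state m t :=
  (L.relations_conj t).N_ladderState (L.N_vac t) m

theorem P_state_zero (t : ℝ) : L.P t (L.state 0 t) = 0 := L.P_vac t

theorem P_state_succ (m : ℕ) (t : ℝ) :
    L.P t (L.state (m + 1) t) = (L.κ + L.σ * m : ℂ) • L.state m t :=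
  (L.relations_conj t).P_ladderState_succ (L.N_vac t) (L.P_vac t) m

theorem state_succ (m : ℕ) (t : ℝ) : L.state (m + 1) t = ((m : ℂ) + 1)⁻¹ • L.Q t (L.state m t) :=
  rfl

/-- At time 0 the conjugated Q is K⁻, which maps the indicator of level m to m + 1 times that of
level m + 1. -/
theorem state_at_zero (m : ℕ) (x : X) : L.state m 0 x = if L.idx x = m then 1 else 0 := by
  induction m generalizing x with
  | zero => exact L.vac_zero x
  | succ m ih =>
    rw [state_succ, Pi.smul_apply, Q_apply, L.C_zero, L.s_zero, ih]
    have hm := Nat.cast_add_one_ne_zero (R := ℂ) m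
    rcases eq_or_ne (L.idx x) 0 with h | h
    · simp [h]
    · have h1 := (L.pred x h).1
      have h2 : L.idx (x - 1) = m ↔ L.idx x = m + 1 := by omega
      simp only [h2]
      split_ifs with h3
      · simp [h3, hm]
      · simp

theorem hasDerivAt_Q_apply {f f' : ℝ → X → ℂ} {t : ℝ}
    (hf : ∀ x, HasDerivAt (fun r => f r x) (f' t x) t) (x : X) :
    HasDerivAt (fun r => L.Q r (f r) x)
      (L.Q t (f' t) x + ((2 * L.C t * (L.σ * L.u * L.v * L.s t)) * (L.idx x * f t (x - 1)) -
      (L.u * (L.C t * L.C t + L.σ * L.u * L.v * L.s t * L.s t)) *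
        ((L.κ + 2 * L.σ * L.idx x) * f t x) +
      (L.u ^ 2 * L.σ * (2 * L.s t * L.C t)) * (L.up x * f t (x + 1)))) t := by
  simp only [Q_apply]
  have hC := (L.hasDerivAt_C t).ofReal_comp
  have hs := (L.hasDerivAt_s t).ofReal_comp
  have h1 := (hC.pow 2).mul ((hf (x - 1)).const_mul (L.idx x : ℂ))
  have h2 := ((hC.const_mul (L.u : ℂ)).mul hs).mul
    ((hf x).const_mul (L.κ + 2 * L.σ * L.idx x : ℂ))
  have h3 := ((hs.pow 2).const_mul (L.u ^ 2 * L.σ : ℂ)).mul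
    ((hf (x + 1)).const_mul (L.up x : ℂ))
  refine ((h1.sub h2).add h3).congr_deriv ?_
  push_cast
  simp only [Pi.pow_apply, Pi.mul_apply]
  ring

/-- If ψ' = Aψ, then (Qψ)' = Q'ψ + QAψ = AQψ because Q' = [A, Q]. Thus the equation passes from one
level to the next, starting from the vacuum orbit. -/
theorem hasDerivAt_state (m : ℕ) (t : ℝ) (x : X) :
    HasDerivAt (fun r => L.state m r x) (L.A (L.state m t) x) t := by
  induction m generalizing x with
  | zero =>
    rw [A_apply, LadderSite.up]
    exact (L.hasDerivAt_vac t x).congr_deriv (by push_cast; rfl)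
  | succ m ih =>
    simp only [state_succ, Pi.smul_apply, map_smul]
    have h1 := L.hasDerivAt_Q_apply (f := L.state m) (f' := fun t => L.A (L.state m t)) ih x
    refine (h1.congr_deriv ?_).const_smul ((m : ℂ) + 1)⁻¹
    have h2 := congrArg (fun T : Module.End ℂ (X → ℂ) => T (L.state m t) x)
      (L.relations.commutator_conjQ (u := L.u) (v := L.v) (C := L.C t) (s := L.s t))
    change L.A (L.Q t (L.state m t)) x = L.Q t (L.A (L.state m t)) x + _ at h2
    rw [h2]
    congr 1
    simp only [LinearMap.add_apply, LinearMap.sub_apply, LinearMap.smul_apply,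
      Pi.add_apply, Pi.sub_apply, Pi.smul_apply, LadderSite.Kp_apply, LadderSite.Km_apply,
      LadderSite.Kn_apply, Module.End.one_apply, smul_eq_mul]
    ring

end LadderFlow

end Site

/-! ### The generator: Casimir tensor, self-duality, reversibility, symmetry -/

section Generator

variable {X V : Type*} [Add X] [Sub X] [One X]

theorem prod_eq_mul_mul_erase [Fintype V] [DecidableEq V] {M : Type*} [CommMonoid M] {i l : V}
    (hil : i ≠ l)
    (F : V → M) :
    ∏ j, F j = F i * F l * ∏ j ∈ (Finset.univ.erase i).erase l, F j := by
  rw [mul_assoc, Finset.mul_prod_erase _ _ (by simp [hil.symm]),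
    Finset.mul_prod_erase _ _ (Finset.mem_univ i)]

theorem moveParticle_apply_left [DecidableEq V] (x : V → X) {i l : V} (hil : i ≠ l) :
    moveParticle x i l i = x i - 1 := by
  simp [moveParticle, hil]

theorem moveParticle_apply_right [DecidableEq V] (x : V → X) (i l : V) :
    moveParticle x i l l = x l + 1 := by
  simp [moveParticle]

theorem moveParticle_apply_of_ne [DecidableEq V] (x : V → X) {i l j : V} (hi : j ≠ i)
    (hl : j ≠ l) : moveParticle x i l j = x j := by
  simp [moveParticle, hi, hl]

/-- A nonzero rate excludes an empty source and a full target, so neither coordinate shift wraps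
around or truncates and the move can be undone. -/
theorem LadderSite.moveParticle_moveParticle [DecidableEq V] (L : LadderSite X) {y : V → X}
    {i l : V} (hil : i ≠ l) (h : L.rate (y i) (y l) ≠ 0) :
    moveParticle (moveParticle y i l) l i = y := by
  obtain ⟨h1, h2⟩ := mul_ne_zero_iff.1 h
  have h3 := (L.pred (y i) (by exact_mod_cast h1)).2.1
  have h4 := (L.succ (y l) h2).2
  funext j
  rcases eq_or_ne j i with rfl | hi
  · rw [moveParticle_apply_right, moveParticle_apply_left y hil, h3]
  rcases eq_or_ne j l with rfl | hl
  · rw [moveParticle_apply_left _ hil.symm, moveParticle_apply_right, h4]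
  · rw [moveParticle_apply_of_ne _ hl hi, moveParticle_apply_of_ne _ hi hl]

theorem LadderSite.rate_moveParticle_ne_zero [DecidableEq V] (L : LadderSite X) {y : V → X}
    {i l : V} (hil : i ≠ l) (h : L.rate (y i) (y l) ≠ 0) :
    L.rate (moveParticle y i l l) (moveParticle y i l i) ≠ 0 := by
  obtain ⟨h1, h2⟩ := mul_ne_zero_iff.1 h
  have h3 := (L.pred (y i) (by exact_mod_cast h1)).2.2
  have h4 := (L.succ (y l) h2).1
  rw [moveParticle_apply_right, moveParticle_apply_left y hil, LadderSite.rate, h4]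
  exact mul_ne_zero (by positivity) h3

variable [Fintype V]

theorem prodFun_moveParticle_left [DecidableEq V] (D : X → X → ℂ) (x y : V → X) {i l : V}
    (hil : i ≠ l) : prodFun D (moveParticle x i l) y =
      D (x i - 1) (y i) * D (x l + 1) (y l) *
        ∏ j ∈ (Finset.univ.erase i).erase l, D (x j) (y j) := by
  rw [prodFun, prod_eq_mul_mul_erase hil, moveParticle_apply_left x hil, moveParticle_apply_right]
  congr 1
  refine Finset.prod_congr rfl fun j hj => ?_
  simp only [Finset.mem_erase, Finset.mem_univ, and_true] at hj
  rw [moveParticle_apply_of_ne x hj.2 hj.1]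

theorem prodFun_moveParticle_right [DecidableEq V] (D : X → X → ℂ) (x y : V → X) {i l : V}
    (hil : i ≠ l) : prodFun D x (moveParticle y i l) =
      D (x i) (y i - 1) * D (x l) (y l + 1) *
        ∏ j ∈ (Finset.univ.erase i).erase l, D (x j) (y j) :=
  prodFun_moveParticle_left (fun a b => D b a) y x hil

/-- `D` intertwines the ladder operators in its second variable with the conjugated ladder operators
in its first variable. -/
structure LadderFlow.Intertwines (L : LadderFlow X) (t : ℝ) (D : X → X → ℂ) (c : ℂ) : Prop where
  ne_zero : c ≠ 0
  Q_apply : ∀ x y, L.Q t (fun x' => D x' y) x = c * (L.up y * D x (y + 1))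
  P_apply : ∀ x y, L.P t (fun x' => D x' y) x = c⁻¹ * (L.idx y * D x (y - 1))
  N_apply : ∀ x y, L.N t (fun x' => D x' y) x = L.idx y * D x y

/-- Invariance of the Casimir tensor under conjugation, evaluated on a pure tensor: the variables
stand for the values of K⁺f, K⁻f, Nf, f at one site and, primed, at another. Pure tensors suffice
because the duality function is a product. -/
theorem casimir_invariant {κ σ u v C s : ℂ} (hC : C ^ 2 - σ * u * v * s ^ 2 = 1)
    (P Q n d P' Q' n' d' : ℂ) :
    (C ^ 2 * P - v * C * s * (κ * d + 2 * σ * n) + v ^ 2 * σ * s ^ 2 * Q) *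
        (C ^ 2 * Q' - u * C * s * (κ * d' + 2 * σ * n') + u ^ 2 * σ * s ^ 2 * P') +
      (C ^ 2 * P' - v * C * s * (κ * d' + 2 * σ * n') + v ^ 2 * σ * s ^ 2 * Q') *
        (C ^ 2 * Q - u * C * s * (κ * d + 2 * σ * n) + u ^ 2 * σ * s ^ 2 * P) -
      2 * σ * ((n - C * s * (u * P + v * Q) + u * v * s ^ 2 * (κ * d + 2 * σ * n)) *
        (n' - C * s * (u * P' + v * Q') + u * v * s ^ 2 * (κ * d' + 2 * σ * n'))) -
      κ * ((n - C * s * (u * P + v * Q) + u * v * s ^ 2 * (κ * d + 2 * σ * n)) * d' +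
        d * (n' - C * s * (u * P' + v * Q') + u * v * s ^ 2 * (κ * d' + 2 * σ * n'))) =
    P * Q' + P' * Q - 2 * σ * (n * n') - κ * (n * d' + d * n') := by
  grind

/-- Expanding the rates `idx a * up b` exhibits the edge generator as the Casimir tensor. In x it
equals the tensor of conjugated operators, which the intertwining turns into the tensor in y. -/
theorem LadderFlow.Intertwines.pairGen_prodFun [DecidableEq V] {L : LadderFlow X} {t : ℝ}
    {D : X → X → ℂ} {c : ℂ} (h : L.Intertwines t D c) (x y : V → X) {i l : V} (hil : i ≠ l) :
    pairGen L.rate i l (fun x' => prodFun D x' y) x =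
      pairGen L.rate i l (fun y' => prodFun D x y') y := by
  simp only [pairGen, prodFun_moveParticle_left D x y hil, prodFun_moveParticle_right D x y hil,
    prodFun_moveParticle_left D x y hil.symm, prodFun_moveParticle_right D x y hil.symm]
  rw [Finset.erase_right_comm (a := l) (b := i), prodFun, prod_eq_mul_mul_erase hil]
  set r := ∏ j ∈ (Finset.univ.erase i).erase l, D (x j) (y j)
  have hr : ∀ a b, (L.rate a b : ℂ) = L.idx a * (L.κ + L.σ * L.idx b) := fun a b => by
    simp [LadderSite.rate, LadderSite.up]
  have hu : ∀ a, (L.up a : ℂ) = L.κ + L.σ * L.idx a := fun a => by simp [LadderSite.up]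
  have hQi := h.Q_apply (x i) (y i)
  have hQl := h.Q_apply (x l) (y l)
  have hPi := h.P_apply (x i) (y i)
  have hPl := h.P_apply (x l) (y l)
  have hNi := h.N_apply (x i) (y i)
  have hNl := h.N_apply (x l) (y l)
  rw [LadderFlow.Q_apply] at hQi hQl
  rw [LadderFlow.P_apply] at hPi hPl
  rw [LadderFlow.N_apply] at hNi hNl
  have key := casimir_invariant (κ := (L.κ : ℂ)) (L.C_sq_sub_complex t)
    (L.up (x i) * D (x i + 1) (y i)) (L.idx (x i) * D (x i - 1) (y i))
    (L.idx (x i) * D (x i) (y i)) (D (x i) (y i))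
    (L.up (x l) * D (x l + 1) (y l)) (L.idx (x l) * D (x l - 1) (y l))
    (L.idx (x l) * D (x l) (y l)) (D (x l) (y l))
  have hH : ∀ n d : ℂ, (L.κ + 2 * L.σ * n) * d = L.κ * d + 2 * L.σ * (n * d) :=
    fun n d => by ring
  rw [hH] at hQi hQl hPi hPl hNi hNl
  rw [hQi, hQl, hPi, hPl, hNi, hNl] at key
  have hc : c⁻¹ * c = 1 := inv_mul_cancel₀ h.ne_zero
  simp only [hr, hu] at key ⊢
  -- Every raising operator is paired with a lowering operator on the other site, so c and its
  -- inverse cancel.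
  have hc1 : ∀ a b : ℂ, c⁻¹ * a * (c * b) = a * b := fun a b => by
    linear_combination a * b * hc
  rw [hc1, hc1] at key
  linear_combination (-r) * key

/-- Reversibility of the product weights. -/
structure LadderSite.Reversible (L : LadderSite X) (w : X → ℝ) (q : ℝ) : Prop where
  pos : ∀ x, 0 < w x
  balance : ∀ x, L.up x ≠ 0 → L.idx (x + 1) * w (x + 1) = q * (L.up x * w x)

/-- The one-site balance relations at the departure and arrival sites carry the same factor q, which
cancels because the particle number is conserved. -/
theorem LadderSite.Reversible.detailed_balance [DecidableEq V] {L : LadderSite X} {w : X → ℝ}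
    {q : ℝ} (hw : L.Reversible w q) {y : V → X} {i l : V} (hil : i ≠ l)
    (h : L.rate (y i) (y l) ≠ 0) :
    prodWeight w y * L.rate (y i) (y l) = prodWeight w (moveParticle y i l) *
      L.rate (moveParticle y i l l) (moveParticle y i l i) := by
  obtain ⟨h1, h2⟩ := mul_ne_zero_iff.1 h
  have h3 := (L.pred (y i) (by exact_mod_cast h1))
  have h5 := hw.balance (y l) h2
  have h6 := hw.balance (y i - 1) h3.2.2
  rw [h3.2.1] at h6
  have h7 : ∏ j ∈ (Finset.univ.erase i).erase l, w (moveParticle y i l j) =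
      ∏ j ∈ (Finset.univ.erase i).erase l, w (y j) := by
    refine Finset.prod_congr rfl fun j hj => ?_
    simp only [Finset.mem_erase, Finset.mem_univ, and_true] at hj
    rw [moveParticle_apply_of_ne y hj.2 hj.1]
  rw [prodWeight, prodWeight, prod_eq_mul_mul_erase hil, prod_eq_mul_mul_erase hil, h7,
    moveParticle_apply_right, moveParticle_apply_left y hil, LadderSite.rate, LadderSite.rate]
  set r := ∏ j ∈ (Finset.univ.erase i).erase l, w (y j)
  linear_combination (r * w (y l) * L.up (y l)) * h6 - (r * w (y i - 1) * L.up (y i - 1)) * h5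

/-- Substitution by the move from i to l, a bijection from the configurations where this move has
nonzero rate to those where the reverse move has nonzero rate; detailed balance matches the
coefficients. -/
theorem LadderSite.Reversible.finsum_move [DecidableEq V] {L : LadderSite X} {w : X → ℝ}
    {q : ℝ} (hw : L.Reversible w q) {i l : V} (hil : i ≠ l) (F H : (V → X) → ℂ) :
    ∑ᶠ y, (prodWeight w y * L.rate (y i) (y l) : ℂ) * (F (moveParticle y i l) * H y) =
      ∑ᶠ y, (prodWeight w y * L.rate (y l) (y i) : ℂ) * (F y * H (moveParticle y l i)) := by
  set a : (V → X) → ℂ := fun y =>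
    (prodWeight w y * L.rate (y i) (y l) : ℂ) * (F (moveParticle y i l) * H y)
  set b : (V → X) → ℂ := fun y =>
    (prodWeight w y * L.rate (y l) (y i) : ℂ) * (F y * H (moveParticle y l i))
  have ha : ∑ᶠ y ∈ {y : V → X | L.rate (y i) (y l) ≠ 0}, a y = ∑ᶠ y, a y := by
    rw [← finsum_mem_univ a]
    refine finsum_mem_inter_support_eq' a _ _ fun y hy => ?_
    simp only [Set.mem_ofPred_eq, Set.mem_univ, iff_true]
    rintro h
    simp [a, h] at hy
  have hb : ∑ᶠ y ∈ {y : V → X | L.rate (y l) (y i) ≠ 0}, b y = ∑ᶠ y, b y := by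
    rw [← finsum_mem_univ b]
    refine finsum_mem_inter_support_eq' b _ _ fun y hy => ?_
    simp only [Set.mem_ofPred_eq, Set.mem_univ, iff_true]
    rintro h
    simp [b, h] at hy
  rw [← ha, ← hb]
  refine finsum_mem_eq_of_bijOn (fun y => moveParticle y i l) ?_ fun y hy => ?_
  · refine Set.InvOn.bijOn (f' := fun y => moveParticle y l i) ⟨fun y hy => ?_, fun y hy => ?_⟩
      (fun y hy => ?_) (fun y hy => ?_)
    · exact L.moveParticle_moveParticle hil hy
    · exact L.moveParticle_moveParticle hil.symm hy
    · exact L.rate_moveParticle_ne_zero hil hy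
    · exact L.rate_moveParticle_ne_zero hil.symm hy
  · have h1 := hw.detailed_balance hil hy
    have h2 : (prodWeight w y * L.rate (y i) (y l) : ℂ) = prodWeight w (moveParticle y i l) *
      L.rate (moveParticle y i l l) (moveParticle y i l i) := by exact_mod_cast h1
    simp only [a, b]
    rw [h2, L.moveParticle_moveParticle hil hy]

theorem LadderSite.finite_support_move {X V : Type*} [Add X] [Sub X] [One X] [DecidableEq V]
    (L : LadderSite X) {i l : V}
    (hil : i ≠ l) {F : (V → X) → ℂ} (hF : F.support.Finite) (c : (V → X) → ℂ)
    (H : (V → X) → ℂ) : (fun y => (c y * L.rate (y i) (y l) : ℂ) *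
      (F (moveParticle y i l) * H y)).support.Finite := by
  refine (hF.image fun y => moveParticle y l i).subset fun y hy => ?_
  simp only [Function.mem_support, ne_eq, mul_eq_zero, not_or, Complex.ofReal_eq_zero] at hy
  exact ⟨moveParticle y i l, hy.2.1, L.moveParticle_moveParticle hil hy.1.2⟩

theorem finite_support_sum {ι Y : Type*} [Fintype ι] {f : ι → Y → ℂ}
    (h : ∀ i, (f i).support.Finite) : (fun y => ∑ i, f i y).support.Finite := by
  refine (Set.finite_iUnion h).subset fun y hy => ?_
  rw [Function.mem_support] at hy
  obtain ⟨i, _, hi⟩ := Finset.exists_ne_zero_of_sum_ne_zero hy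
  exact Set.mem_iUnion.2 ⟨i, hi⟩

theorem finite_support_mul_left {Y : Type*} {F : Y → ℂ} (hF : F.support.Finite) (c H : Y → ℂ) :
    (fun y => c y * (F y * H y)).support.Finite :=
  hF.subset fun y hy => by
    simp only [Function.mem_support, ne_eq, mul_eq_zero, not_or] at hy
    exact hy.2.1

theorem LadderSite.Reversible.finsum_pairGen [DecidableEq V] {L : LadderSite X} {w : X → ℝ}
    {q : ℝ} (hw : L.Reversible w q) {i l : V} (hil : i ≠ l) {F : (V → X) → ℂ}
    (hF : F.support.Finite) (H : (V → X) → ℂ) :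
    (fun y => (prodWeight w y : ℂ) * (pairGen L.rate i l F y * H y)).support.Finite ∧
    ∑ᶠ y, (prodWeight w y : ℂ) * (pairGen L.rate i l F y * H y) =
      ∑ᶠ y, (prodWeight w y : ℂ) * (F y * pairGen L.rate i l H y) := by
  have f1 := L.finite_support_move hil hF (fun y => (prodWeight w y : ℂ)) H
  have f2 := L.finite_support_move hil.symm hF (fun y => (prodWeight w y : ℂ)) H
  have f3 := finite_support_mul_left hF (fun y => (prodWeight w y : ℂ) *
    (L.rate (y i) (y l) + L.rate (y l) (y i))) H
  have g1 := finite_support_mul_left hF (fun y => (prodWeight w y : ℂ) * L.rate (y l) (y i))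
    (fun y => H (moveParticle y l i))
  have g2 := finite_support_mul_left hF (fun y => (prodWeight w y : ℂ) * L.rate (y i) (y l))
    (fun y => H (moveParticle y i l))
  have e1 : (fun y => (prodWeight w y : ℂ) * (pairGen L.rate i l F y * H y)) = fun y =>
      ((prodWeight w y * L.rate (y i) (y l) : ℂ) * (F (moveParticle y i l) * H y) +
        (prodWeight w y * L.rate (y l) (y i) : ℂ) * (F (moveParticle y l i) * H y)) -
      ((prodWeight w y : ℂ) * (L.rate (y i) (y l) + L.rate (y l) (y i))) * (F y * H y) := by
    funext y
    rw [pairGen]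
    ring
  have e2 : (fun y => (prodWeight w y : ℂ) * (F y * pairGen L.rate i l H y)) = fun y =>
      ((prodWeight w y * L.rate (y l) (y i) : ℂ) * (F y * H (moveParticle y l i)) +
        (prodWeight w y * L.rate (y i) (y l) : ℂ) * (F y * H (moveParticle y i l))) -
      ((prodWeight w y : ℂ) * (L.rate (y i) (y l) + L.rate (y l) (y i))) * (F y * H y) := by
    funext y
    rw [pairGen]
    ring
  have f12 := (f1.union f2).subset (Function.support_add _ _)
  refine ⟨?_, ?_⟩
  · rw [e1]
    exact (f12.union f3).subset (Function.support_sub _ _)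
  · rw [e1, e2, finsum_sub_distrib f12 f3, finsum_sub_distrib
      ((g1.union g2).subset (Function.support_add _ _)) f3, finsum_add_distrib f1 f2,
      finsum_add_distrib g1 g2, hw.finsum_move hil, hw.finsum_move hil.symm]

variable [LinearOrder V] (G : SimpleGraph V) [DecidableRel G.Adj]

/-- The generator is symmetric with respect to the reversible product weights. -/
theorem LadderSite.Reversible.finsum_gen {L : LadderSite X} {w : X → ℝ}
    {q : ℝ} (hw : L.Reversible w q) {F : (V → X) → ℂ}
    (hF : F.support.Finite) (H : (V → X) → ℂ) :
    ∑ᶠ y, (prodWeight w y : ℂ) * (gen G L.rate F y * H y) =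
      ∑ᶠ y, (prodWeight w y : ℂ) * (F y * gen G L.rate H y) := by
  have h1 : ∀ i l, (fun y => (prodWeight w y : ℂ) *
      ((if i < l ∧ G.Adj i l then pairGen L.rate i l F y else 0) * H y)).support.Finite := by
    intro i l
    split_ifs with h
    · exact (hw.finsum_pairGen h.1.ne hF H).1
    · simp
  have h2 : ∀ i l, (fun y => (prodWeight w y : ℂ) *
      (F y * (if i < l ∧ G.Adj i l then pairGen L.rate i l H y else 0))).support.Finite :=
    fun i l => finite_support_mul_left hF _ _
  simp only [gen, Finset.sum_mul, Finset.mul_sum]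
  have h3 : ∀ i, (fun y => ∑ l, (prodWeight w y : ℂ) *
      ((if i < l ∧ G.Adj i l then pairGen L.rate i l F y else 0) * H y)).support.Finite :=
    fun i => finite_support_sum (h1 i)
  have h4 : ∀ i, (fun y => ∑ l, (prodWeight w y : ℂ) *
      (F y * (if i < l ∧ G.Adj i l then pairGen L.rate i l H y else 0))).support.Finite :=
    fun i => finite_support_sum (h2 i)
  rw [finsum_sum_comm Finset.univ _ fun i _ => h3 i, finsum_sum_comm Finset.univ _ fun i _ => h4 i]
  refine Finset.sum_congr rfl fun i _ => ?_
  rw [finsum_sum_comm Finset.univ _ fun l _ => h1 i l,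
    finsum_sum_comm Finset.univ _ fun l _ => h2 i l]
  refine Finset.sum_congr rfl fun l _ => ?_
  split_ifs with h
  · exact (hw.finsum_pairGen h.1.ne hF H).2
  · simp

theorem gen_sum {ι : Type*} (r : X → X → ℝ) (s : Finset ι) (F : ι → (V → X) → ℂ) (x : V → X) :
    gen G r (fun x => ∑ k ∈ s, F k x) x = ∑ k ∈ s, gen G r (F k) x := by
  simp only [gen]
  symm
  rw [Finset.sum_comm]
  refine Finset.sum_congr rfl fun i _ => ?_
  rw [Finset.sum_comm]
  refine Finset.sum_congr rfl fun l _ => ?_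
  split_ifs
  · simp only [pairGen, mul_sub, Finset.mul_sum, Finset.sum_add_distrib, Finset.sum_sub_distrib]
  · simp

theorem gen_const_mul (r : X → X → ℝ) (c : ℂ) (F : (V → X) → ℂ) (x : V → X) :
    gen G r (fun x => c * F x) x = c * gen G r F x := by
  simp only [gen, Finset.mul_sum, pairGen]
  refine Finset.sum_congr rfl fun i _ => Finset.sum_congr rfl fun l _ => ?_
  split_ifs <;> ring

theorem LadderFlow.Intertwines.gen_prodFun {L : LadderFlow X} {t : ℝ}
    {D : X → X → ℂ} {c : ℂ} (h : L.Intertwines t D c) (x y : V → X) :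
    gen G L.rate (fun x' => prodFun D x' y) x = gen G L.rate (fun y' => prodFun D x y') y := by
  simp only [gen]
  refine Finset.sum_congr rfl fun i _ => Finset.sum_congr rfl fun l _ => ?_
  split_ifs with hil
  · exact h.pairGen_prodFun x y hil.1.ne
  · rfl

theorem LadderFlow.Intertwines.isSelfDuality {L : LadderFlow X} {t : ℝ}
    {D : X → X → ℂ} {c : ℂ} (h : L.Intertwines t D c) (a : ℂ) :
    IsSelfDuality (gen G L.rate) (prodFun (V := V) fun x y => a * D y x) := by
  intro x y
  have h1 : ∀ x y : V → X, prodFun (fun x y => a * D y x) x y =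
      (∏ _i : V, a) * prodFun D y x := fun x y => by simp [prodFun, Finset.prod_mul_distrib]
  simp only [h1, gen_const_mul]
  rw [h.gen_prodFun G]

/-- In the sum of w(y) F(y) D(x, y) over y, reversibility moves the generator from F to the second
variable of D, self-duality moves it to the first variable, and linearity takes it out of the finite
sum. -/
theorem LadderFlow.Intertwines.isSymmetry [DecidableEq X] {L : LadderFlow X} {t : ℝ}
    {D : X → X → ℂ} {c : ℂ} (h : L.Intertwines t D c) {w : X → ℝ} {q : ℝ}
    (hw : L.Reversible w q) {S : (X → ℂ) → (X → ℂ)}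
    (hS : ∀ x y, S (Pi.single y 1) x = w y * D x y) :
    IsSymmetry (V := V) (gen G L.rate) S := by
  have h1 : ∀ F : (V → X) → ℂ, tensorOp S F = fun x =>
      ∑ᶠ y, (prodWeight w y : ℂ) * (F y * prodFun D x y) := by
    intro F
    funext x
    refine finsum_congr fun y => ?_
    simp only [hS, Finset.prod_mul_distrib, prodWeight, prodFun]
    push_cast
    ring
  intro F hF
  funext x
  rw [h1, h1]
  beta_reduce
  rw [hw.finsum_gen G hF]
  have h2 : ∀ H : (V → X) → ℂ, ∑ᶠ y, (prodWeight w y : ℂ) * (F y * H y) =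
      ∑ y ∈ hF.toFinset, (prodWeight w y : ℂ) * F y * H y := by
    intro H
    rw [finsum_eq_sum_of_support_subset (s := hF.toFinset)]
    · simp only [mul_assoc]
    · intro y hy
      simp only [Function.mem_support, ne_eq, mul_eq_zero, not_or] at hy
      simpa using hy.2.1
  simp only [h2, gen_sum, gen_const_mul, h.gen_prodFun G]

end Generator

/-! ### The exponential of a multiplication operator -/

section Multiplication

variable {X : Type*} [Countable X] [MeasurableSpace X] [MeasurableSingletonClass X]
  [DecidableEq X] {w : X → ℝ}

theorem I_smul_multBy_apply {X : Type*} (c : X → ℝ) (f : X → ℂ) (x : X) :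
    (Complex.I • multBy c : (X → ℂ) →ₗ[ℂ] (X → ℂ)) f x = Complex.I * (c x * f x) := rfl

theorem isMaximallySkew_multBy {X : Type*} [Countable X] [MeasurableSpace X]
    [MeasurableSingletonClass X] {w : X → ℝ} (hw : ∀ x, 0 < w x) (c : X → ℝ) :
    IsMaximallySkew w (Complex.I • multBy c) := by
  intro φ ψ v v' hv hv'
  have h := (hasSum_inner hw v ψ).add (hasSum_inner hw φ v')
  refine h.unique ?_
  convert hasSum_zero using 2 with x
  rw [hv, hv', I_smul_multBy_apply, I_smul_multBy_apply, map_mul, map_mul, Complex.conj_I,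
    Complex.conj_ofReal]
  ring

theorem isExpOrbit_multBy (hw : ∀ x, 0 < w x) (c : X → ℝ) (y : X) :
    IsExpOrbit (weightMeasure w) (Complex.I • multBy c) (Pi.single y 1)
      (fun t : ℝ => Complex.exp (Complex.I * t * c y) • deltaLp hw y) := by
  rw [isExpOrbit_iff hw]
  refine ⟨by simp [coeFn_deltaLp], fun t =>
    ⟨(Complex.exp (Complex.I * t * c y) * (Complex.I * c y)) • deltaLp hw y, ?_, ?_⟩⟩
  · funext x
    rw [coeFn_smul_eq hw, coeFn_smul_eq hw, coeFn_deltaLp, I_smul_multBy_apply]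
    rcases eq_or_ne x y with rfl | h
    · simp
      ring
    · simp [h]
  · refine HasDerivAt.smul_const ?_ _
    refine HasDerivAt.cexp ?_
    have h1 : HasDerivAt (fun t : ℝ => (t : ℂ)) 1 t := Complex.ofRealCLM.hasDerivAt
    exact ((h1.const_mul Complex.I).mul_const (c y : ℂ)).congr_deriv (by ring)

theorem expOp_multBy (hw : ∀ x, 0 < w x) (c : X → ℝ) {f : X → ℂ} (hf : f.support.Finite) (t : ℝ) :
    expOp (weightMeasure w) (Complex.I • multBy c) t f =
      fun x => Complex.exp (Complex.I * t * c x) * f x := by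
  funext x
  rw [expOp_eq_finsum hw (isMaximallySkew_multBy hw c) (isExpOrbit_multBy hw c) hf,
    finsum_eq_single _ x]
  · simp [coeFn_smul_eq hw, coeFn_deltaLp]
  · intro y hy
    simp [coeFn_smul_eq hw, coeFn_deltaLp, hy.symm]

end Multiplication

/-! ### Consequences of admissibility: orbits, adjoints, intertwining, dualities -/

section Admissible

variable {X : Type*} [Add X] [Sub X] [One X] [Countable X] [MeasurableSpace X]
  [MeasurableSingletonClass X] [DecidableEq X] {w : X → ℝ} {q : ℝ} {L : LadderFlow X}

/-- The conditions on a flow and reversible weights `w` under which the states are orbits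
in `L²(w)`. -/
structure LadderFlow.IsAdmissible (L : LadderFlow X) (w : X → ℝ) (q : ℝ) : Prop
    extends L.Reversible w q where
  q_ne_zero : q ≠ 0
  skew : IsMaximallySkew w L.A
  memLp_state : ∀ m t, MemLp (L.state m t) 2 (weightMeasure w)
  memLp_A_state : ∀ m t, MemLp (L.A (L.state m t)) 2 (weightMeasure w)
  dominated : ∀ m t, ∃ (b : X → ℝ) (R : ℝ), 0 < R ∧ (Summable fun x => w x * b x ^ 2) ∧
    ∀ r, |r - t| < R → ∀ x, ‖L.A (L.state m r) x‖ ≤ b x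

/-- The matrix of `exp(t A) exp(i α (N + θ))`. -/
def LadderFlow.kernel (L : LadderFlow X) (α θ t : ℝ) (x y : X) : ℂ :=
  Complex.exp (Complex.I * α * (L.idx y + θ)) * L.state (L.idx y) t x

namespace LadderFlow.IsAdmissible

theorem isExpOrbit_state (h : L.IsAdmissible w q) (m : ℕ) :
    IsExpOrbit (weightMeasure w) L.A (fun x => if L.idx x = m then 1 else 0)
      (fun t => (h.memLp_state m t).toLp) := by
  rw [isExpOrbit_iff h.pos]
  refine ⟨?_, fun t => ⟨(h.memLp_A_state m t).toLp, ?_, ?_⟩⟩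
  · rw [coeFn_toLp_eq h.pos]
    exact funext (L.state_at_zero m)
  · rw [coeFn_toLp_eq h.pos, coeFn_toLp_eq h.pos]
  · obtain ⟨b, R, hR, hb, hbd⟩ := h.dominated m t
    exact hasDerivAt_toLp h.pos (h.memLp_state m) (h.memLp_A_state m)
      (fun t x => L.hasDerivAt_state m t x) hb hR hbd

theorem isExpOrbit_state_idx (h : L.IsAdmissible w q) (y : X) :
    IsExpOrbit (weightMeasure w) L.A (Pi.single y 1)
      (fun t => (h.memLp_state (L.idx y) t).toLp) := by
  have h1 : (Pi.single y 1 : X → ℂ) = fun x => if L.idx x = L.idx y then 1 else 0 := by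
    funext x
    rw [Pi.single_apply]
    simp only [L.idx_injective.eq_iff]
  rw [h1]
  exact h.isExpOrbit_state _

theorem expWellDefined (h : L.IsAdmissible w q) : ExpWellDefined (weightMeasure w) L.A :=
  expWellDefined_of_single h.pos h.skew h.isExpOrbit_state_idx

/-- The phase factor preserves finite support, so the outer exponential acts on a finite combination
of the constructed orbits. -/
theorem expOp_expOp (h : L.IsAdmissible w q) (α θ t : ℝ) {f : X → ℂ} (hf : f.support.Finite) :
    expOp (weightMeasure w) L.A t
      (expOp (weightMeasure w) (Complex.I • multBy fun x => L.idx x + θ) α f) =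
      fun x => ∑ᶠ y, L.kernel α θ t x y * f y := by
  have h1 := expOp_multBy h.pos (fun x => L.idx x + θ) hf α
  funext x
  rw [h1, expOp_eq_finsum h.pos h.skew h.isExpOrbit_state_idx]
  · refine finsum_congr fun y => ?_
    rw [coeFn_toLp_eq h.pos, kernel]
    push_cast
    ring
  · exact hf.subset fun x hx => right_ne_zero_of_mul hx

/-- At an unoccupied level the orbit starts at 0 and vanishes by uniqueness. This terminates the
ladder on a finite site space. -/
theorem state_eq_zero (h : L.IsAdmissible w q) {m : ℕ} (hm : ∀ x, L.idx x ≠ m) (t : ℝ) :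
    L.state m t = 0 := by
  have h1 := h.isExpOrbit_state m
  have h2 : IsExpOrbit (weightMeasure w) L.A (fun x => if L.idx x = m then 1 else 0)
      (fun _ => (0 : L2 (weightMeasure w))) := by
    rw [isExpOrbit_iff h.pos]
    refine ⟨?_, fun t => ⟨0, ?_, hasDerivAt_const _ _⟩⟩
    · funext x
      rw [coeFn_zero_eq h.pos, if_neg (hm x), Pi.zero_apply]
    · rw [coeFn_zero_eq h.pos, map_zero]
  have h3 := congrFun (h1.unique h.pos h.skew h2) t
  rw [← coeFn_toLp_eq h.pos (h.memLp_state m t), h3, coeFn_zero_eq h.pos]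

/-- Conservation of the pairing of the orbits of y and x, between the time pairs (0, -t) and (t, 0).
-/
theorem state_adjoint (h : L.IsAdmissible w q) (t : ℝ) (x y : X) :
    (w x : ℂ) * L.state (L.idx y) t x = w y * conj (L.state (L.idx x) (-t) y) := by
  have h1 := (h.isExpOrbit_state_idx y).inner_add h.pos h.skew (h.isExpOrbit_state_idx x) t (-t)
  have h2 : ∀ y, (h.memLp_state (L.idx y) 0).toLp = deltaLp h.pos y := by
    intro y
    refine lp_ext fun x => ?_
    rw [coeFn_deltaLp]
    exact congrFun ((isExpOrbit_iff h.pos).1 (h.isExpOrbit_state_idx y)).1 x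
  simp only [add_neg_cancel, h2] at h1
  rw [← inner_conj_symm _ (deltaLp h.pos x), inner_deltaLp, inner_deltaLp, coeFn_toLp_eq h.pos,
    coeFn_toLp_eq h.pos] at h1
  have h3 := congrArg conj h1
  rw [Complex.conj_conj, map_mul, Complex.conj_ofReal] at h3
  exact h3.symm

theorem integral_state (h : L.IsAdmissible w q) (t : ℝ) (y y' : X) :
    ∫ x, L.state (L.idx y) t x * conj (L.state (L.idx y') t x) ∂weightMeasure w =
      if y = y' then (w y : ℂ) else 0 := by
  have h1 := (h.isExpOrbit_state_idx y').inner_add h.pos h.skew (h.isExpOrbit_state_idx y) 0 t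
  have h2 : ∀ y, (h.memLp_state (L.idx y) 0).toLp = deltaLp h.pos y := by
    intro y
    refine lp_ext fun x => ?_
    rw [coeFn_deltaLp]
    exact congrFun ((isExpOrbit_iff h.pos).1 (h.isExpOrbit_state_idx y)).1 x
  simp only [zero_add, h2] at h1
  rw [inner_deltaLp, coeFn_deltaLp, L2.inner_def] at h1
  simp only [coeFn_toLp_eq h.pos, RCLike.inner_apply] at h1
  rw [h1, Pi.single_apply]
  simp only [eq_comm (a := y')]
  split_ifs with h3
  · rw [h3, mul_one]
  · rw [mul_zero]

theorem conj_phase_mul (α a : ℝ) :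
    Complex.exp (Complex.I * α * a) * conj (Complex.exp (Complex.I * α * a)) = 1 := by
  rw [← Complex.exp_conj, ← Complex.exp_add]
  simp

theorem isIsometricKernel (h : L.IsAdmissible w q) (α θ t : ℝ) :
    IsIsometricKernel w (L.kernel α θ t) := by
  refine ⟨fun y => (h.memLp_state _ t).const_mul _, fun y y' => ?_⟩
  have h1 : ∀ x, L.kernel α θ t x y * conj (L.kernel α θ t x y') =
      (Complex.exp (Complex.I * α * (L.idx y + θ)) *
        conj (Complex.exp (Complex.I * α * (L.idx y' + θ)))) *
      (L.state (L.idx y) t x * conj (L.state (L.idx y') t x)) := by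
    intro x
    rw [kernel, kernel, map_mul]
    ring
  simp only [h1]
  rw [integral_const_mul, h.integral_state]
  split_ifs with h2
  · have h3 := conj_phase_mul α (L.idx y + θ)
    push_cast at h3
    rw [← h2, h3, one_mul]
  · rw [mul_zero]

/-- This is the matrix of exp(-iα(N + θ)) exp(-tA), the candidate for the adjoint of `kernel`. -/
theorem isIsometricKernel_adjoint (h : L.IsAdmissible w q) (α θ t : ℝ) :
    IsIsometricKernel w fun x y =>
      conj (Complex.exp (Complex.I * α * (L.idx x + θ))) * L.state (L.idx y) (-t) x := by
  have h4 : ∀ x, Complex.exp (Complex.I * α * (L.idx x + θ)) *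
      conj (Complex.exp (Complex.I * α * (L.idx x + θ))) = 1 := by
    intro x
    have h3 := conj_phase_mul α (L.idx x + θ)
    push_cast at h3
    exact h3
  refine ⟨fun y => ?_, fun y y' => ?_⟩
  · refine (h.memLp_state (L.idx y) (-t)).of_le (by fun_prop) (ae_of_all _ fun x => ?_)
    have h3 : ‖Complex.exp (Complex.I * α * (L.idx x + θ))‖ = 1 := by
      have h5 : Complex.I * α * (L.idx x + θ) = ((α * (L.idx x + θ) : ℝ) : ℂ) * Complex.I := by
        push_cast
        ring
      rw [h5, Complex.norm_exp_ofReal_mul_I]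
    rw [norm_mul, RCLike.norm_conj, h3, one_mul]
  · rw [← h.integral_state (-t) y y']
    refine integral_congr_ae (ae_of_all _ fun x => ?_)
    simp only [map_mul, Complex.conj_conj]
    linear_combination (L.state (L.idx y) (-t) x * conj (L.state (L.idx y') (-t) x)) * h4 x

theorem kernel_adjoint (h : L.IsAdmissible w q) (α θ t : ℝ) (x y : X) :
    (w x : ℂ) * L.kernel α θ t x y = w y * conj
      (conj (Complex.exp (Complex.I * α * (L.idx y + θ))) * L.state (L.idx x) (-t) y) := by
  rw [map_mul, Complex.conj_conj, kernel]
  linear_combination Complex.exp (Complex.I * α * (L.idx y + θ)) * h.state_adjoint t x y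

/-- Raising the level of a state is raising y, up to normalisation. In the constant, q comes from
the balance relation between w y and w (y + 1), and the exponential from the change of phase between
neighbouring levels. -/
theorem intertwines (h : L.IsAdmissible w q) (α θ t : ℝ) :
    L.Intertwines t (fun x y => (w y : ℂ)⁻¹ * L.kernel α θ t x y)
      (q * Complex.exp (-(Complex.I * α))) := by
  have hq : (q : ℂ) ≠ 0 := by exact_mod_cast h.q_ne_zero
  have hw : ∀ x, (w x : ℂ) ≠ 0 := fun x => by exact_mod_cast (h.pos x).ne'
  have hD : ∀ y, (fun x => (w y : ℂ)⁻¹ * L.kernel α θ t x y) =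
      ((w y : ℂ)⁻¹ * Complex.exp (Complex.I * α * (L.idx y + θ))) • L.state (L.idx y) t := by
    intro y
    funext x
    rw [kernel, Pi.smul_apply, smul_eq_mul]
    ring
  refine ⟨mul_ne_zero hq (Complex.exp_ne_zero _), fun x y => ?_, fun x y => ?_, fun x y => ?_⟩
  · rw [hD, map_smul, Q_state]
    rcases eq_or_ne (L.up y) 0 with hy | hy
    -- At the top of a finite ladder the right side has coefficient 0, and the left side is a state
    -- at a level that no site value attains.
    · rw [h.state_eq_zero (m := L.idx y + 1), hy]
      · simp
      · intro z hz
        have h1 := L.pred z (by omega)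
        have h2 : z - 1 = y := L.idx_injective (by omega)
        rw [h2] at h1
        exact h1.2.2 hy
    · have h1 := L.succ y hy
      have h2 : ((L.idx (y + 1) : ℂ)) * w (y + 1) = q * (L.up y * w y) := by
        exact_mod_cast h.balance y hy
      rw [kernel, h1.1]
      rw [h1.1] at h2
      have h3 : Complex.exp (Complex.I * α * (((L.idx y + 1 : ℕ) : ℂ) + θ)) =
          Complex.exp (Complex.I * α * (L.idx y + θ)) * Complex.exp (Complex.I * α) := by
        rw [← Complex.exp_add]
        push_cast
        ring_nf
      have h4 : Complex.exp (-(Complex.I * α)) * Complex.exp (Complex.I * α) = 1 := by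
        rw [← Complex.exp_add]
        simp
      rw [h3]
      simp only [Pi.smul_apply, smul_eq_mul]
      push_cast at h2 ⊢
      set e := Complex.exp (Complex.I * α * (L.idx y + θ))
      set f := L.state (L.idx y + 1) t x
      have h5 : (w y : ℂ)⁻¹ * (L.idx y + 1) = q * L.up y * (w (y + 1) : ℂ)⁻¹ := by
        have := hw y
        have := hw (y + 1)
        field_simp
        linear_combination h2
      linear_combination e * f * h5 - q * (L.up y) * (w (y + 1) : ℂ)⁻¹ * e * f * h4
  · rw [hD, map_smul]
    rcases hm : L.idx y with _ | m
    · rw [P_state_zero]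
      simp
    · have h1 := L.pred y (by omega)
      have h0 : L.idx (y - 1) = m := by omega
      have h2 : ((L.idx (y - 1 + 1) : ℂ)) * w (y - 1 + 1) = q * (L.up (y - 1) * w (y - 1)) := by
        exact_mod_cast h.balance (y - 1) h1.2.2
      rw [h1.2.1, hm, LadderSite.up, h0] at h2
      rw [P_state_succ, kernel, h0]
      have h3 : Complex.exp (Complex.I * α * (((m + 1 : ℕ) : ℂ) + θ)) =
          Complex.exp (Complex.I * α * (m + θ)) * Complex.exp (Complex.I * α) := by
        rw [← Complex.exp_add]
        push_cast
        ring_nf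
      rw [h3, mul_inv, Complex.exp_neg, inv_inv]
      simp only [Pi.smul_apply, smul_eq_mul]
      push_cast at h2 ⊢
      set e := Complex.exp (Complex.I * α * (m + θ))
      set f := L.state m t x
      have h5 : (w y : ℂ)⁻¹ * (L.κ + L.σ * m) = (q : ℂ)⁻¹ * (m + 1) * (w (y - 1) : ℂ)⁻¹ := by
        have := hw y
        have := hw (y - 1)
        field_simp
        linear_combination -h2
      linear_combination e * Complex.exp (Complex.I * α) * f * h5
  · rw [hD, map_smul, N_state, kernel]
    simp only [Pi.smul_apply, smul_eq_mul]
    ring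

/-- The six properties common to the three particle systems. -/
theorem dualities (h : L.IsAdmissible w q) {V : Type*} [Fintype V] [LinearOrder V]
    (G : SimpleGraph V) [DecidableRel G.Adj] (α θ t : ℝ) {S : (X → ℂ) → (X → ℂ)}
    (hS : ∀ f : X → ℂ, f.support.Finite → S f = fun x => ∑ᶠ y, L.kernel α θ t x y * f y)
    {d : X → ℝ} {a : ℝ} (hd : ∀ x, d x * w x = a) :
    IsSymmetry (gen G L.rate) S ∧
    ExtendsToUnitary (weightMeasure w) S ∧
    ExtendsToUnitary (weightMeasure (prodWeight (V := V) w)) (tensorOp S) ∧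
    IsSelfDuality (gen G L.rate) (prodFun (applyTo S fun x y => if x = y then d x else 0)) ∧
    OrthogonalWithNormOf (weightMeasure w) (applyTo S fun x y => if x = y then d x else 0)
      (fun x y => if x = y then d x else 0) ∧
    OrthogonalWithNormOf (weightMeasure (prodWeight (V := V) w))
      (prodFun (applyTo S fun x y => if x = y then d x else 0))
      (prodFun fun x y => if x = y then d x else 0) := by
  have hw : ∀ x, (w x : ℂ) ≠ 0 := fun x => by exact_mod_cast (h.pos x).ne'
  have hsingle : ∀ x y, S (Pi.single y 1) x = L.kernel α θ t x y := by
    intro x y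
    rw [hS _ (finite_support_single y 1)]
    beta_reduce
    rw [finsum_eq_single _ y]
    · simp
    · intro z hz
      simp [hz]
  have happly : (applyTo S fun x y => if x = y then d x else 0) =
      fun x y => d x * L.kernel α θ t y x := by
    funext x y
    have h1 : (fun z => (((if x = z then d x else 0 : ℝ)) : ℂ)) = Pi.single x (d x : ℂ) := by
      funext z
      rw [Pi.single_apply]
      simp only [eq_comm (a := z)]
      split_ifs <;> simp
    rw [applyTo, h1, hS _ (finite_support_single x _)]
    beta_reduce
    rw [finsum_eq_single _ x]
    · simp [mul_comm]
    · intro z hz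
      simp [hz]
  have hM := h.isIsometricKernel α θ t
  have hM' := h.isIsometricKernel_adjoint α θ t
  have hP := h.intertwines α θ t
  have hpos := prodWeight_pos (V := V) h.pos
  refine ⟨hP.isSymmetry G h.toReversible fun x y => ?_,
    hM.extendsToUnitary h.pos hM' (h.kernel_adjoint α θ t) hS,
    (hM.prodFun h.pos).extendsToUnitary hpos (hM'.prodFun h.pos) (fun x y => ?_) fun F _ => ?_,
    ?_, ?_, ?_⟩
  · rw [hsingle, mul_inv_cancel_left₀ (hw y)]
  · simp only [prodWeight, prodFun, Complex.ofReal_prod, map_prod, ← Finset.prod_mul_distrib]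
    exact Finset.prod_congr rfl fun i _ => h.kernel_adjoint α θ t (x i) (y i)
  · funext x
    simp only [tensorOp, hsingle, prodFun]
  · rw [happly]
    -- Since d w is the constant a, the duality function is a times the transpose of the
    -- intertwining function.
    have h2 : (fun x y => (d x : ℂ) * L.kernel α θ t y x) =
        fun x y => (a : ℂ) * ((w x : ℂ)⁻¹ * L.kernel α θ t y x) := by
      funext x y
      have h3 : (d x : ℂ) * w x = a := by exact_mod_cast hd x
      rw [← h3]
      have := hw x
      field_simp
    rw [h2]
    exact hP.isSelfDuality G a
  · rw [happly]
    exact hM.orthogonalWithNormOf h.pos d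
  · rw [happly, prodFun_ite]
    have h4 : (prodFun (V := V) fun x y => (d x : ℂ) * L.kernel α θ t y x) =
        fun x y => ((∏ i, d (x i) : ℝ) : ℂ) * prodFun (L.kernel α θ t) y x := by
      funext x y
      simp [prodFun, Finset.prod_mul_distrib]
    rw [h4]
    exact (hM.prodFun h.pos).orthogonalWithNormOf hpos fun x => ∏ i, d (x i)

end LadderFlow.IsAdmissible

end Admissible

/-! ### Newton series and hypergeometric difference equations -/

section NewtonSeries

/-- The Newton series `∑ j ≤ n, aⱼ (n choose j)`. -/
def newtonSum (a : ℕ → ℝ) (n : ℕ) : ℝ := ∑ j ∈ Finset.range (n + 1), a j * n.choose j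

theorem newtonSum_eq_sum_range (a : ℕ → ℝ) {n K : ℕ} (h : n < K) :
    newtonSum a n = ∑ j ∈ Finset.range K, a j * n.choose j := by
  refine Finset.sum_subset (Finset.range_subset_range.2 h) fun j _ hj => ?_
  rw [Nat.choose_eq_zero_of_lt (by simpa using hj)]
  simp

theorem newtonSum_succ_sub (a : ℕ → ℝ) {n K : ℕ} (h : n + 1 < K) :
    newtonSum a (n + 1) - newtonSum a n =
      ∑ j ∈ Finset.range K, a (j + 1) * n.choose j := by
  rw [newtonSum_eq_sum_range a (show n + 1 < K + 1 by omega),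
    newtonSum_eq_sum_range a (show n < K + 1 by omega), Finset.sum_range_succ',
    Finset.sum_range_succ' (fun j => a j * (n.choose j : ℝ))]
  simp only [Nat.choose_zero_right, add_sub_add_right_eq_sub, ← Finset.sum_sub_distrib]
  refine Finset.sum_congr rfl fun j _ => ?_
  rw [Nat.choose_succ_succ]
  push_cast
  ring

/-- The operator n(1 - backward shift) is diagonal on binomials: n((n choose j) - (n-1 choose j)) =
j (n choose j). At n = 0 the truncated predecessor is harmless because of the factor n. -/
theorem mul_newtonSum_sub_pred (a : ℕ → ℝ) {n K : ℕ} (h : n < K) :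
    n * (newtonSum a n - newtonSum a (n - 1)) =
      ∑ j ∈ Finset.range K, j * a j * n.choose j := by
  rcases n with _ | n
  · rw [Finset.sum_eq_zero]
    · simp
    · intro j _
      rcases j with _ | j <;> simp
  · rw [Nat.add_sub_cancel, newtonSum_succ_sub a h, Finset.mul_sum]
    obtain ⟨K, rfl⟩ : ∃ K', K = K' + 1 := ⟨K - 1, by omega⟩
    rw [Finset.sum_range_succ' (fun j => (j : ℝ) * a j * ((n + 1).choose j : ℝ)),
      Finset.sum_range_succ, Nat.choose_eq_zero_of_lt (show n < K by omega)]
    simp only [Nat.cast_zero, mul_zero, zero_mul, add_zero]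
    refine Finset.sum_congr rfl fun j _ => ?_
    have h1 := Nat.add_one_mul_choose_eq n j
    have h2 : ((n : ℝ) + 1) * n.choose j = (n + 1).choose (j + 1) * (j + 1) := by exact_mod_cast h1
    push_cast
    linear_combination a (j + 1) * h2

/-- A second order difference equation, solved by a hypergeometric Newton series. -/
theorem newtonSum_difference_eq {κ σ u v : ℝ} {a : ℕ → ℝ} {m n : ℕ}
    (ha : ∀ j ≤ n, u * (κ + σ * j) * a (j + 1) = (v - σ * u) * (j - m) * a j) :
    u * (κ + σ * n) * (newtonSum a (n + 1) - newtonSum a n) -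
      v * (n * (newtonSum a n - newtonSum a (n - 1))) + (v - σ * u) * m * newtonSum a n = 0 := by
  -- The identity (n - j)(n choose j) = (j + 1)(n choose j + 1) trades the coefficient depending on
  -- n for coefficients depending on j, so that the recursion for a applies termwise.
  have e1 : ∀ j, (κ + σ * n) * (a (j + 1) * n.choose j : ℝ) =
      (κ + σ * j) * a (j + 1) * n.choose j + σ * ((j + 1 : ℕ) * a (j + 1) * n.choose (j + 1)) := by
    intro j
    have h1 : ((n : ℝ) - j) * n.choose j = (j + 1) * n.choose (j + 1) := by
      rcases le_or_gt j n with h | h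
      · have := Nat.choose_succ_right_eq n j
        have h2 : (n.choose (j + 1) : ℝ) * (j + 1) = n.choose j * ((n - j : ℕ) : ℝ) := by
          exact_mod_cast this
        rw [Nat.cast_sub h] at h2
        linear_combination -h2
      · rw [Nat.choose_eq_zero_of_lt h, Nat.choose_eq_zero_of_lt (by omega)]
        simp
    push_cast
    linear_combination σ * a (j + 1) * h1
  have e2 : ∑ j ∈ Finset.range (n + 2), ((j + 1 : ℕ) : ℝ) * a (j + 1) * n.choose (j + 1) =
      n * (newtonSum a n - newtonSum a (n - 1)) := by
    rw [mul_newtonSum_sub_pred a (show n < n + 3 by omega), Finset.sum_range_succ' _ (n + 2)]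
    simp
  have e3 : ∀ j, u * ((κ + σ * j) * a (j + 1) * n.choose j) =
      (v - σ * u) * (j * a j * n.choose j) - (v - σ * u) * m * (a j * n.choose j) := by
    intro j
    rcases le_or_gt j n with h | h
    · linear_combination (n.choose j : ℝ) * ha j h
    · rw [Nat.choose_eq_zero_of_lt h]
      simp
  rw [newtonSum_succ_sub a (show n + 1 < n + 2 by omega), mul_assoc u, Finset.mul_sum]
  simp only [e1, Finset.sum_add_distrib, ← Finset.mul_sum]
  rw [e2, mul_add, Finset.mul_sum]
  simp only [e3, Finset.sum_sub_distrib, ← Finset.mul_sum]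
  rw [← mul_newtonSum_sub_pred a (show n < n + 2 by omega),
    ← newtonSum_eq_sum_range a (show n < n + 2 by omega)]
  ring

/-- The hypergeometric function `ᵣ₊₂Fₛ(-m, -n, …; b; z)` as a Newton series in `n`. -/
theorem hyp_eq_newtonSum (m n : ℕ) (b : List ℝ) (z : ℝ) :
    hyp [-(m : ℝ), -(n : ℝ)] b z = newtonSum (fun j => (ascPochhammer ℝ j).eval (-(m : ℝ)) /
      (b.map fun t => (ascPochhammer ℝ j).eval t).prod * (-z) ^ j) n := by
  have h1 : ∀ j, (ascPochhammer ℝ j).eval (-(n : ℝ)) = (-1) ^ j * (j.factorial * n.choose j) := by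
    intro j
    rw [ascPochhammer_eval_neg_eq_descPochhammer, descPochhammer_eval_eq_descFactorial,
      Nat.descFactorial_eq_factorial_mul_choose]
    push_cast
    rfl
  rw [hyp, newtonSum, tsum_eq_sum (s := Finset.range (n + 1))]
  · refine Finset.sum_congr rfl fun j _ => ?_
    have := Nat.cast_ne_zero (R := ℝ) |>.2 j.factorial_ne_zero
    simp only [List.map_cons, List.map_nil, List.prod_cons, List.prod_nil, mul_one, h1]
    rw [neg_pow z]
    field_simp
  · intro j hj
    simp only [List.map_cons, List.map_nil, List.prod_cons, List.prod_nil, mul_one, h1]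
    rw [Nat.choose_eq_zero_of_lt (by simpa using hj)]
    simp

end NewtonSeries

/-! ### Evaluation of the duality functions as orthogonal polynomials -/

section Polynomials

namespace LadderFlow

variable {X : Type*} [Add X] [Sub X] [One X] {L : LadderFlow X}

/-- The difference equation of the states at a time with `C = v s`. -/
theorem state_difference_eq {t : ℝ} (hz : L.C t = L.v * L.s t) (hC : L.C t ≠ 0) (m : ℕ) (x : X) :
    L.u * L.up x * (L.state m t (x + 1) - L.state m t x) -
      L.v * (L.idx x * (L.state m t x - L.state m t (x - 1))) +
      (L.v - L.σ * L.u) * m * L.state m t x = 0 := by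
  have h1 := congrFun (L.N_state m t) x
  rw [N_apply, Pi.smul_apply, smul_eq_mul] at h1
  have h2 := L.C_sq_sub_complex t
  have h3 : (L.C t : ℂ) = L.v * L.s t := by exact_mod_cast hz
  have h4 : (L.v * L.s t ^ 2 : ℂ) ≠ 0 := by
    rw [hz] at hC
    have := left_ne_zero_of_mul hC
    have := right_ne_zero_of_mul hC
    exact_mod_cast mul_ne_zero ‹L.v ≠ 0› (pow_ne_zero 2 ‹L.s t ≠ 0›)
  -- With C = v s the relation C² - σuvs² = 1 reads v s² (v - σu) = 1, so the eigenvalue equation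
  -- for N is v s² times the difference equation.
  refine (mul_eq_zero.1 (?_ : (L.v * L.s t ^ 2 : ℂ) * _ = 0)).resolve_left h4
  have hu : (L.up x : ℂ) = L.κ + L.σ * L.idx x := by simp [LadderSite.up]
  rw [h3] at h1 h2
  rw [hu] at h1 ⊢
  linear_combination -h1 + (L.idx x - m) * L.state m t x * h2 * (-1)

theorem _root_.OrthDuality.LadderSite.up_ne_zero_of_lt (L : LadderSite X) (x : X) (j : ℕ)
    (hj : j < L.idx x) : L.κ + L.σ * (j : ℝ) ≠ 0 := by
  induction hn : L.idx x generalizing x with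
  | zero => omega
  | succ n ih =>
    have h1 := L.pred x (by omega)
    rcases Nat.lt_succ_iff_lt_or_eq.1 (hn ▸ hj) with h | h
    · exact ih (x - 1) (by omega) (by omega)
    · have h2 : L.idx (x - 1) = j := by omega
      rw [← h2]
      exact h1.2.2

/-- The difference equation gives the value at x + 1 from those at x and x - 1. At the empty site
the coefficient of x - 1 vanishes, so a solution is determined by its value there, and the Newton
series is the solution with value 1. -/
theorem state_eq_newtonSum {t : ℝ} (hz : L.C t = L.v * L.s t) (hC : L.C t ≠ 0) (hu : L.u ≠ 0)
    {m : ℕ} {a : ℕ → ℝ} (ha0 : a 0 = 1)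
    (ha : ∀ j : ℕ, L.κ + L.σ * j ≠ 0 →
      L.u * (L.κ + L.σ * j) * a (j + 1) = (L.v - L.σ * L.u) * (j - m) * a j)
    {o : X} (ho : L.idx o = 0) (x : X) :
    L.state m t x = L.state m t o * (newtonSum a (L.idx x) : ℂ) := by
  induction hn : L.idx x using Nat.strong_induction_on generalizing x with
  | _ n ih =>
    rcases n with _ | n
    · have h1 : x = o := L.idx_injective (by omega)
      simp [h1, newtonSum, ha0]
    · have h1 := L.pred x (by omega)
      have h2 : L.idx (x - 1) = n := by omega
      have h3 := state_difference_eq hz hC m (x - 1)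
      have h4 := newtonSum_difference_eq (n := n) fun j hj =>
        ha j (L.up_ne_zero_of_lt x j (by omega))
      have h5 := ih n (by omega) (x - 1) h2
      have h6 : (n : ℂ) * L.state m t (x - 1 - 1) =
          n * (L.state m t o * (newtonSum a (n - 1) : ℂ)) := by
        rcases Nat.eq_zero_or_pos n with h0 | h0
        · simp [h0]
        · have h7 := (L.pred (x - 1) (by omega)).1
          rw [ih (n - 1) (by omega) (x - 1 - 1) (by omega)]
      have h8 : (L.u * L.up (x - 1) : ℂ) ≠ 0 := by
        exact_mod_cast mul_ne_zero hu h1.2.2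
      have h9 := congrArg (fun r : ℝ => (r : ℂ)) h4
      simp only [LadderSite.up, h1.2.1, h2, h5] at h3 h8
      push_cast at h3 h8 h9
      refine mul_left_cancel₀ h8 ?_
      linear_combination h3 - L.state m t o * h9 - L.v * h6

/-- Evaluation of the duality function of an admissible flow, for `α = π` and a time with
`C = v s`. -/
theorem IsAdmissible.applyTo_eq [Countable X] [MeasurableSpace X] [MeasurableSingletonClass X]
    [DecidableEq X] {w : X → ℝ} {q : ℝ} (h : L.IsAdmissible w q) (θ : ℝ) {t : ℝ}
    (hz : L.C t = L.v * L.s t) (hC : L.C t ≠ 0) (hu : L.u ≠ 0) {c : ℝ}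
    (hvac : ∀ x, L.vac (-t) x = (-1) ^ L.idx x * c)
    {S : (X → ℂ) → (X → ℂ)}
    (hS : ∀ f : X → ℂ, f.support.Finite →
      S f = fun x => ∑ᶠ y, L.kernel Real.pi θ t x y * f y)
    {d : X → ℝ} {o : X} (ho : L.idx o = 0) (hd : ∀ x, d x * w x = w o) {b : List ℝ} {z : ℝ}
    (hb : ∀ m j : ℕ, L.κ + L.σ * j ≠ 0 →
      L.u * (L.κ + L.σ * j) * ((ascPochhammer ℝ (j + 1)).eval (-(m : ℝ)) /
        (b.map fun t => (ascPochhammer ℝ (j + 1)).eval t).prod * (-z) ^ (j + 1)) =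
      (L.v - L.σ * L.u) * (j - m) * ((ascPochhammer ℝ j).eval (-(m : ℝ)) /
        (b.map fun t => (ascPochhammer ℝ j).eval t).prod * (-z) ^ j))
    (hb0 : (b.map fun t => (ascPochhammer ℝ 0).eval t).prod = 1) (x y : X) :
    applyTo S (fun x y => if x = y then d x else 0) x y =
      Complex.exp (Complex.I * Real.pi * θ) * c *
        (hyp [-(L.idx x : ℝ), -(L.idx y : ℝ)] b z : ℂ) := by
  have h1 : (fun z => (((if x = z then d x else 0 : ℝ)) : ℂ)) = Pi.single x (d x : ℂ) := by
    funext z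
    rw [Pi.single_apply]
    simp only [eq_comm (a := z)]
    split_ifs <;> simp
  rw [applyTo, h1, hS _ (finite_support_single x _)]
  beta_reduce
  rw [finsum_eq_single _ x fun z hz => by simp [hz], hyp_eq_newtonSum, kernel,
    state_eq_newtonSum hz hC hu (a := fun j => (ascPochhammer ℝ j).eval (-(L.idx x : ℝ)) /
      (b.map fun t => (ascPochhammer ℝ j).eval t).prod * (-z) ^ j) (by rw [hb0]; simp)
      (hb (L.idx x)) ho]
  -- The value of the state at the empty site is a weight ratio times the conjugate of the vacuum
  -- orbit at time -t.
  have h2 := h.state_adjoint t o x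
  rw [ho] at h2
  change _ = (w x : ℂ) * conj (L.vac (-t) x) at h2
  rw [hvac] at h2
  simp only [map_mul, Complex.conj_ofReal, map_pow, map_neg, map_one] at h2
  -- At α = π the phase contributes the sign (-1)^x, which cancels the alternating sign of the
  -- vacuum orbit.
  have h4 : Complex.exp (Complex.I * Real.pi * (L.idx x + θ)) =
      (-1) ^ L.idx x * Complex.exp (Complex.I * Real.pi * θ) := by
    rw [mul_add, Complex.exp_add, mul_comm (Complex.I * Real.pi) (L.idx x : ℂ),
      Complex.exp_nat_mul, mul_comm Complex.I, Complex.exp_pi_mul_I]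
  have h5 : ((-1 : ℂ) ^ L.idx x) * (-1) ^ L.idx x = 1 := by
    rw [← mul_pow]
    simp
  have h6 : (d x : ℂ) * w x = w o := by exact_mod_cast hd x
  have h7 : (w o : ℂ) ≠ 0 := by exact_mod_cast (h.pos o).ne'
  rw [h4, Pi.single_eq_same]
  refine mul_left_cancel₀ h7 ?_
  set H := (newtonSum (fun j => (ascPochhammer ℝ j).eval (-(L.idx x : ℝ)) /
    (b.map fun t => (ascPochhammer ℝ j).eval t).prod * (-z) ^ j) (L.idx y) : ℂ)
  set e := Complex.exp (Complex.I * Real.pi * θ)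
  linear_combination ((-1) ^ L.idx x * e * d x * H) * h2 + e * c * H * d x * w x * h5 +
    e * c * H * h6

end LadderFlow

end Polynomials

/-! ### Admissibility on a finite site space -/

section FiniteSite

namespace LadderFlow

theorem continuous_A_state {X : Type*} [Add X] [Sub X] [One X] (L : LadderFlow X) (m : ℕ) (x : X) :
    Continuous fun t => L.A (L.state m t) x := by
  have h : ∀ x, Continuous fun t => L.state m t x := fun x =>
    continuous_iff_continuousAt.2 fun t => (L.hasDerivAt_state m t x).continuousAt
  simp only [A_apply]
  have h1 := h (x + 1)
  have h2 := h (x - 1)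
  fun_prop

variable {X : Type*} [Add X] [Sub X] [One X] [Finite X] [MeasurableSpace X]
  [MeasurableSingletonClass X] {w : X → ℝ} {q : ℝ} {L : LadderFlow X}

/-- By the balance relation the adjoint of K⁺ in `L²(w)` is q⁻¹K⁻; with u = qv this makes A
skew-symmetric. -/
theorem isMaximallySkew_of_finite (hw : L.Reversible w q) (huv : L.u = q * L.v) :
    IsMaximallySkew w L.A := by
  have := Fintype.ofFinite X
  intro φ ψ f f' hf hf'
  have h := (hasSum_inner hw.pos f ψ).add (hasSum_inner hw.pos φ f')
  refine h.unique ?_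
  simp only [hf, hf', A_apply, map_add, map_neg, map_mul, Complex.conj_ofReal, map_natCast]
  convert hasSum_fintype _ using 1
  have key : ∑ x, (L.u * L.up x * w x : ℂ) *
      (conj (φ (x + 1)) * ψ x + conj (φ x) * ψ (x + 1)) =
      ∑ x, (L.v * L.idx x * w x : ℂ) * (conj (φ x) * ψ (x - 1) + conj (φ (x - 1)) * ψ x) := by
    -- Summation by parts as the shift x ↦ x + 1 between nonzero terms only; the wrap-around terms
    -- have coefficient 0.
    refine Finset.sum_bij_ne_zero (fun x _ _ => x + 1) (fun _ _ _ => Finset.mem_univ _) ?_ ?_ ?_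
    · intro x _ hx y _ hy hxy
      have hx' : L.up x ≠ 0 := by rintro h0; simp [h0] at hx
      have hy' : L.up y ≠ 0 := by rintro h0; simp [h0] at hy
      rw [← (L.succ x hx').2, hxy, (L.succ y hy').2]
    · intro x _ hx
      have hx' : L.idx x ≠ 0 := by rintro h0; simp [h0] at hx
      have h1 := L.pred x hx'
      have h2 := hw.balance (x - 1) h1.2.2
      rw [h1.2.1] at h2
      refine ⟨x - 1, Finset.mem_univ _, ?_, h1.2.1⟩
      rw [h1.2.1]
      convert hx using 2
      rw [huv]
      push_cast
      have h3 : (L.idx x * w x : ℂ) = q * (L.up (x - 1) * w (x - 1)) := by exact_mod_cast h2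
      linear_combination -(L.v : ℂ) * h3
    · intro x _ hx
      have hx' : L.up x ≠ 0 := by rintro h0; simp [h0] at hx
      have h1 := L.succ x hx'
      have h2 := hw.balance x hx'
      have h3 : (L.idx (x + 1) * w (x + 1) : ℂ) = q * (L.up x * w x) := by exact_mod_cast h2
      rw [h1.2, huv]
      push_cast
      linear_combination -(L.v : ℂ) * (conj (φ (x + 1)) * ψ x + conj (φ x) * ψ (x + 1)) * h3
  rw [← sub_eq_zero, ← Finset.sum_sub_distrib] at key
  rw [← neg_eq_zero, ← Finset.sum_neg_distrib] at key
  rw [← key]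
  refine Finset.sum_congr rfl fun x _ => ?_
  ring

theorem isAdmissible_of_finite (hw : L.Reversible w q) (hq : q ≠ 0) (huv : L.u = q * L.v) :
    L.IsAdmissible w q where
  toReversible := hw
  q_ne_zero := hq
  skew := isMaximallySkew_of_finite hw huv
  memLp_state _ _ := memLp_of_finite_support hw.pos (Set.toFinite _)
  memLp_A_state _ _ := memLp_of_finite_support hw.pos (Set.toFinite _)
  dominated m t := by
    have h : ∀ x, ∃ b : ℝ, ∀ r ∈ Metric.closedBall t 1, ‖L.A (L.state m r) x‖ ≤ b := fun x =>
      (isCompact_closedBall t 1).exists_bound_of_continuousOn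
        (L.continuous_A_state m x).continuousOn
    choose b hb using h
    exact ⟨b, 1, one_pos, summable_of_hasFiniteSupport (Set.toFinite _), fun r hr x =>
      hb x r (Metric.mem_closedBall.2 (by rw [Real.dist_eq]; exact hr.le))⟩

end LadderFlow

end FiniteSite

/-! ### Admissibility on ℕ: vanishing boundary terms and geometric bounds -/

section NatSite

/-- The site space `ℕ`. -/
def natSite (κ σ : ℝ) (hκ : 0 < κ) (hσ : 0 ≤ σ) : LadderSite ℕ where
  idx x := x
  κ := κ
  σ := σ
  idx_injective := Function.injective_id
  pred x hx := ⟨by omega, by omega, by positivity⟩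
  succ x _ := ⟨rfl, by omega⟩

/-- A nonzero limit would force s n to be eventually at least a constant over n + 1, against the
divergence of the harmonic series. -/
theorem eq_zero_of_tendsto_of_le_mul_summable {B : ℕ → ℂ} {l : ℂ} {s : ℕ → ℝ}
    (hB : Tendsto B atTop (𝓝 l)) (hs : Summable s)
    (h : ∀ n, ‖B (n + 1)‖ ≤ (n + 1) * s n) : l = 0 := by
  by_contra hl
  have hl' : 0 < ‖l‖ := norm_pos_iff.2 hl
  have h1 : ∀ᶠ n in atTop, ‖l‖ / 2 < ‖B (n + 1)‖ :=
    ((tendsto_add_atTop_iff_nat 1).2 hB).norm.eventually (lt_mem_nhds (by linarith))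
  have h2 : Summable fun n : ℕ => 1 / ((n : ℝ) + 1) := by
    refine Summable.of_norm_bounded_eventually_nat (hs.mul_left (2 / ‖l‖)) ?_
    filter_upwards [h1] with n hn
    have h3 := hn.trans_le (h n)
    rw [Real.norm_of_nonneg (by positivity), div_mul_eq_mul_div,
      div_le_div_iff₀ (by positivity) hl']
    nlinarith
  have h3 : Summable fun n : ℕ => 1 / (n : ℝ) :=
    (summable_nat_add_iff 1).1 (by simpa using h2)
  exact Real.not_summable_one_div_natCast h3

variable {w : ℕ → ℝ} {q : ℝ}

theorem hasSum_weight_mul_norm_sq (hw : ∀ x, 0 < w x) (φ : L2 (weightMeasure w)) :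
    Summable fun x => w x * ‖φ x‖ ^ 2 :=
  (memLp_weightMeasure_iff hw).1 (Lp.memLp φ)

namespace LadderFlow

variable {L : LadderFlow ℕ}

/-- Summation by parts telescopes the partial sums to the boundary term -B n, which converges
because the inner products do. The coefficients of A grow only linearly and the weights of
neighbours are comparable, so B (n + 1) is at most n + 1 times a summable sequence, and its limit is
0. No decay beyond square integrability is used. -/
theorem isMaximallySkew_nat (hidx : ∀ x, L.idx x = x) (hκ : 0 < L.κ) (hσ : 0 ≤ L.σ)
    (hw : L.Reversible w q) (hq : 0 < q) (huv : L.u = q * L.v) : IsMaximallySkew w L.A := by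
  have hup : ∀ x, L.up x ≠ 0 := fun x => by
    rw [LadderSite.up]
    positivity
  have hbal : ∀ x : ℕ, ((x : ℝ) + 1) * w (x + 1) = q * (L.up x * w x) := by
    intro x
    have := hw.balance x (hup x)
    rw [hidx] at this
    exact_mod_cast this
  have hratio : ∀ x, w (x + 1) ≤ q * (L.κ + L.σ) * w x := by
    intro x
    have h1 := hbal x
    have h2 := hw.pos x
    rw [LadderSite.up, hidx] at h1
    have h3 : (0 : ℝ) ≤ x := x.cast_nonneg
    have h4 : ((x : ℝ) + 1) * w (x + 1) ≤ (x + 1) * (q * (L.κ + L.σ) * w x) := by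
      rw [h1]
      have : L.κ + L.σ * x ≤ (x + 1) * (L.κ + L.σ) := by nlinarith
      calc q * ((L.κ + L.σ * x) * w x) ≤ q * (((x + 1) * (L.κ + L.σ)) * w x) := by gcongr
        _ = _ := by ring
    exact le_of_mul_le_mul_left h4 (by positivity)
  intro φ ψ f f' hf hf'
  have h := (hasSum_inner hw.pos f ψ).add (hasSum_inner hw.pos φ f')
  set B : ℕ → ℂ := fun x => (L.v * x * w x : ℂ) *
    (conj (φ (x - 1)) * ψ x + conj (φ x) * ψ (x - 1)) with hB
  have hterm : ∀ x, (w x : ℂ) * (conj (f x) * ψ x) + (w x : ℂ) * (conj (φ x) * f' x) =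
      -(B (x + 1) - B x) := by
    intro x
    have h1 : ((x : ℂ) + 1) * w (x + 1) = q * (L.up x * w x) := by exact_mod_cast hbal x
    simp only [hf, hf', A_apply, map_add, map_neg, map_mul, Complex.conj_ofReal, map_natCast, hB,
      Nat.add_sub_cancel, huv, hidx]
    push_cast
    linear_combination L.v * (conj (φ x) * ψ (x + 1) + conj (φ (x + 1)) * ψ x) * h1
  have hlim := h.tendsto_sum_nat
  simp only [hterm, Finset.sum_neg_distrib, Finset.sum_range_sub] at hlim
  have hB0 : B 0 = 0 := by simp [hB]
  simp only [hB0, sub_zero] at hlim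
  have hs1 := hasSum_weight_mul_norm_sq hw.pos φ
  have hs2 := hasSum_weight_mul_norm_sq hw.pos ψ
  have hs := hs1.add hs2
  refine eq_zero_of_tendsto_of_le_mul_summable hlim
    ((((summable_nat_add_iff 1).2 hs).add (hs.mul_left (q * (L.κ + L.σ)))).mul_left |L.v|)
    fun n => ?_
  have hwn := hw.pos (n + 1)
  have hwn' := hw.pos n
  simp only [hB, Nat.add_sub_cancel, norm_neg, norm_mul, Complex.norm_real, Real.norm_eq_abs,
    Complex.norm_natCast, abs_of_pos hwn]
  have h2 : ‖conj (φ n) * ψ (n + 1) + conj (φ (n + 1)) * ψ n‖ ≤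
      ‖φ n‖ * ‖ψ (n + 1)‖ + ‖φ (n + 1)‖ * ‖ψ n‖ := by
    refine (norm_add_le _ _).trans_eq ?_
    rw [norm_mul, norm_mul, RCLike.norm_conj, RCLike.norm_conj]
  have h3 : ‖φ n‖ * ‖ψ (n + 1)‖ + ‖φ (n + 1)‖ * ‖ψ n‖ ≤
      (‖φ (n + 1)‖ ^ 2 + ‖ψ (n + 1)‖ ^ 2) + (‖φ n‖ ^ 2 + ‖ψ n‖ ^ 2) := by
    nlinarith [sq_nonneg (‖φ n‖ - ‖ψ (n + 1)‖), sq_nonneg (‖φ (n + 1)‖ - ‖ψ n‖),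
      sq_nonneg ‖φ n‖, sq_nonneg ‖ψ n‖, sq_nonneg ‖φ (n + 1)‖, sq_nonneg ‖ψ (n + 1)‖]
  have h4 : w (n + 1) * (‖φ n‖ ^ 2 + ‖ψ n‖ ^ 2) ≤
      q * (L.κ + L.σ) * w n * (‖φ n‖ ^ 2 + ‖ψ n‖ ^ 2) := by
    gcongr
    exact hratio n
  calc |L.v| * ((n + 1 : ℕ) : ℝ) * w (n + 1) *
        ‖conj (φ n) * ψ (n + 1) + conj (φ (n + 1)) * ψ n‖
      ≤ |L.v| * ((n + 1 : ℕ) : ℝ) * w (n + 1) *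
        ((‖φ (n + 1)‖ ^ 2 + ‖ψ (n + 1)‖ ^ 2) + (‖φ n‖ ^ 2 + ‖ψ n‖ ^ 2)) := by
        gcongr
        exact h2.trans h3
    _ = ((n + 1 : ℕ) : ℝ) * (|L.v| * (w (n + 1) * (‖φ (n + 1)‖ ^ 2 + ‖ψ (n + 1)‖ ^ 2) +
        w (n + 1) * (‖φ n‖ ^ 2 + ‖ψ n‖ ^ 2))) := by ring
    _ ≤ ((n + 1 : ℕ) : ℝ) * (|L.v| * (w (n + 1) * (‖φ (n + 1)‖ ^ 2 + ‖ψ (n + 1)‖ ^ 2) +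
        q * (L.κ + L.σ) * w n * (‖φ n‖ ^ 2 + ‖ψ n‖ ^ 2))) := by gcongr
    _ = _ := by
        push_cast
        ring

end LadderFlow

/-- `f t x` is bounded, locally uniformly in `t`, by a polynomial in `x` times `ρ ^ x`,
where `c ρ² < 1`. -/
def LocallyGeometric (c : ℝ) (f : ℝ → ℕ → ℂ) : Prop :=
  ∀ R : ℝ, ∃ (ρ K : ℝ) (m : ℕ), 0 < ρ ∧ c * ρ ^ 2 < 1 ∧ 0 ≤ K ∧
    ∀ t, |t| ≤ R → ∀ x, ‖f t x‖ ≤ K * ((x + 1) ^ m * ρ ^ x)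

/-- Neighbouring values and a linear factor in x change the constant and the polynomial degree but
not ρ; difference operators with linear coefficients therefore preserve the class. -/
theorem LocallyGeometric.of_le {c : ℝ} {f g : ℝ → ℕ → ℂ} (hf : LocallyGeometric c f)
    (h : ∀ R : ℝ, ∃ K : ℝ, ∀ t, |t| ≤ R → ∀ x : ℕ,
      ‖g t x‖ ≤ K * ((x + 1) * (‖f t (x + 1)‖ + ‖f t x‖ + ‖f t (x - 1)‖))) :
    LocallyGeometric c g := by
  intro R
  obtain ⟨ρ, K, m, hρ, hc, hK, hf⟩ := hf R
  obtain ⟨K', hg⟩ := h R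
  refine ⟨ρ, |K'| * (K * (2 ^ m * ρ + 1 + (1 + ρ⁻¹))), m + 1, hρ, hc, by positivity,
    fun t ht x => ?_⟩
  have h1 : ‖f t (x + 1)‖ ≤ K * (2 ^ m * ρ * ((x + 1) ^ m * ρ ^ x)) := by
    refine (hf t ht (x + 1)).trans ?_
    have : (((x + 1 : ℕ) : ℝ) + 1) ^ m ≤ (2 * ((x : ℝ) + 1)) ^ m := by
      gcongr
      push_cast
      linarith [(x.cast_nonneg : (0 : ℝ) ≤ x)]
    calc K * ((((x + 1 : ℕ) : ℝ) + 1) ^ m * ρ ^ (x + 1))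
        ≤ K * ((2 * ((x : ℝ) + 1)) ^ m * ρ ^ (x + 1)) := by gcongr
      _ = _ := by rw [mul_pow, pow_succ]; ring
  have h2 := hf t ht x
  have h3 : ‖f t (x - 1)‖ ≤ K * ((1 + ρ⁻¹) * ((x + 1) ^ m * ρ ^ x)) := by
    refine (hf t ht (x - 1)).trans ?_
    -- The summand 1 covers x = 0, where the predecessor is truncated.
    have h4 : ρ ^ (x - 1) ≤ (1 + ρ⁻¹) * ρ ^ x := by
      rcases x with _ | x
      · simp [hρ.le]
      · rw [Nat.add_sub_cancel, pow_succ, add_mul]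
        have : ρ⁻¹ * (ρ ^ x * ρ) = ρ ^ x := by field_simp
        rw [this]
        have : 0 < ρ ^ x * ρ := by positivity
        linarith
    have h5 : (((x - 1 : ℕ) : ℝ) + 1) ^ m ≤ ((x : ℝ) + 1) ^ m := by
      gcongr
      omega
    calc K * ((((x - 1 : ℕ) : ℝ) + 1) ^ m * ρ ^ (x - 1))
        ≤ K * (((x : ℝ) + 1) ^ m * ((1 + ρ⁻¹) * ρ ^ x)) := by gcongr
      _ = _ := by ring
  calc ‖g t x‖ ≤ K' * ((x + 1) * (‖f t (x + 1)‖ + ‖f t x‖ + ‖f t (x - 1)‖)) := hg t ht x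
    _ ≤ |K'| * ((x + 1) * (‖f t (x + 1)‖ + ‖f t x‖ + ‖f t (x - 1)‖)) := by
        gcongr
        exact le_abs_self K'
    _ ≤ |K'| * ((x + 1) * (K * (2 ^ m * ρ * ((x + 1) ^ m * ρ ^ x)) +
          K * ((x + 1) ^ m * ρ ^ x) + K * ((1 + ρ⁻¹) * ((x + 1) ^ m * ρ ^ x)))) := by gcongr
    _ = _ := by ring

/-- Ratio test: w (x + 1) / w x tends to qσ and the polynomial factor contributes 1, so the limiting
ratio is qσρ². -/
theorem summable_weight_mul_geometric {κ σ ρ : ℝ} (hw : ∀ x, 0 < w x)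
    (hbal : ∀ x : ℕ, ((x : ℝ) + 1) * w (x + 1) = q * ((κ + σ * x) * w x)) (hρ : 0 < ρ)
    (hc : q * σ * ρ ^ 2 < 1) (m : ℕ) : Summable fun x : ℕ => w x * ((x + 1) ^ m * ρ ^ x) ^ 2 := by
  have hpos : ∀ x : ℕ, 0 < w x * (((x : ℝ) + 1) ^ m * ρ ^ x) ^ 2 := fun x => by
    have := hw x
    positivity
  refine summable_of_ratio_test_tendsto_lt_one hc
    (Eventually.of_forall fun x => (hpos x).ne') ?_
  have h1 := tendsto_one_div_add_atTop_nhds_zero_nat (𝕜 := ℝ)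
  have h2 : Tendsto (fun x : ℕ => q * (σ + (κ - σ) * (1 / ((x : ℝ) + 1))) *
      (1 + 1 / ((x : ℝ) + 1)) ^ (2 * m) * ρ ^ 2) atTop
      (𝓝 (q * (σ + (κ - σ) * 0) * (1 + 0) ^ (2 * m) * ρ ^ 2)) :=
    (((h1.const_mul (κ - σ)).const_add σ).const_mul q |>.mul ((h1.const_add 1).pow _)).mul_const _
  simp only [mul_zero, add_zero, one_pow, mul_one] at h2
  refine h2.congr fun x => ?_
  rw [Real.norm_of_nonneg (hpos _).le, Real.norm_of_nonneg (hpos _).le, eq_div_iff (hpos x).ne']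
  have h3 : (0 : ℝ) < x + 1 := by positivity
  have h4 : w (x + 1) = q * ((κ + σ * x) * w x) / (x + 1) := by
    rw [eq_div_iff h3.ne', ← hbal]
    ring
  have h5 : (1 + 1 / ((x : ℝ) + 1)) ^ (2 * m) * (((x : ℝ) + 1) ^ m) ^ 2 =
      ((((x + 1 : ℕ) : ℝ) + 1) ^ m) ^ 2 := by
    rw [pow_mul', ← mul_pow, ← mul_pow]
    congr 2
    push_cast
    field_simp
  have h6 : q * (σ + (κ - σ) * (1 / ((x : ℝ) + 1))) * w x = w (x + 1) := by
    rw [h4]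
    field_simp
    ring
  rw [mul_pow _ (ρ ^ (x + 1)), ← h5, ← h6]
  ring

namespace LadderFlow

variable {L : LadderFlow ℕ}

theorem locallyGeometric_A (hidx : ∀ x, L.idx x = x) {c : ℝ} {f : ℝ → ℕ → ℂ}
    (hf : LocallyGeometric c f) : LocallyGeometric c fun t => L.A (f t) := by
  refine hf.of_le fun R => ⟨|L.u| * (|L.κ| + |L.σ|) + |L.v|, fun t _ x => ?_⟩
  rw [A_apply, LadderSite.up, hidx]
  have hx : (0 : ℝ) ≤ x := x.cast_nonneg
  have h1 : ‖(((L.κ + L.σ * (x : ℝ)) : ℝ) : ℂ)‖ ≤ (|L.κ| + |L.σ|) * (x + 1) := by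
    rw [Complex.norm_real, Real.norm_eq_abs]
    refine (abs_add_le _ _).trans ?_
    rw [abs_mul, abs_of_nonneg hx]
    nlinarith [abs_nonneg L.κ, abs_nonneg L.σ]
  refine (norm_add_le _ _).trans ?_
  rw [norm_neg, norm_mul, norm_mul, norm_mul, norm_mul, Complex.norm_natCast]
  simp only [Complex.norm_real, Real.norm_eq_abs]
  rw [Complex.norm_real, Real.norm_eq_abs] at h1
  set a := ‖f t (x + 1)‖
  set b := ‖f t (x - 1)‖
  have ha : 0 ≤ a := norm_nonneg _
  have hb : 0 ≤ b := norm_nonneg _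
  calc _ ≤ |L.u| * ((|L.κ| + |L.σ|) * (x + 1)) * a + |L.v| * (x + 1) * b := by
        gcongr
        linarith
    _ ≤ |L.u| * ((|L.κ| + |L.σ|) * (x + 1)) * (a + ‖f t x‖ + b) +
        |L.v| * (x + 1) * (a + ‖f t x‖ + b) := by
        gcongr <;> linarith [norm_nonneg (f t x)]
    _ = _ := by ring

theorem locallyGeometric_Q (hidx : ∀ x, L.idx x = x) {c : ℝ} {f : ℝ → ℕ → ℂ}
    (hf : LocallyGeometric c f) : LocallyGeometric c fun t => L.Q t (f t) := by
  have hC : Continuous L.C := continuous_iff_continuousAt.2 fun t =>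
    (L.hasDerivAt_C t).continuousAt
  have hs : Continuous L.s := continuous_iff_continuousAt.2 fun t =>
    (L.hasDerivAt_s t).continuousAt
  refine hf.of_le fun R => ?_
  obtain ⟨a₁, h₁⟩ := (isCompact_closedBall (0 : ℝ) R).exists_bound_of_continuousOn
    (f := fun t => L.C t ^ 2) (by fun_prop)
  obtain ⟨a₂, h₂⟩ := (isCompact_closedBall (0 : ℝ) R).exists_bound_of_continuousOn
    (f := fun t => L.u * L.C t * L.s t) (by fun_prop)
  obtain ⟨a₃, h₃⟩ := (isCompact_closedBall (0 : ℝ) R).exists_bound_of_continuousOn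
    (f := fun t => L.u ^ 2 * L.σ * L.s t ^ 2) (by fun_prop)
  refine ⟨|a₁| + |a₂| * (|L.κ| + 2 * |L.σ|) + |a₃| * (|L.κ| + |L.σ|), fun t ht x => ?_⟩
  have htm : t ∈ Metric.closedBall (0 : ℝ) R := by simpa using ht
  have e₁ : ‖(L.C t ^ 2 : ℂ)‖ ≤ |a₁| := by
    have := (h₁ t htm).trans (le_abs_self _)
    rw [← Complex.norm_real] at this
    exact_mod_cast this
  have e₂ : ‖(L.u * L.C t * L.s t : ℂ)‖ ≤ |a₂| := by
    have := (h₂ t htm).trans (le_abs_self _)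
    rw [← Complex.norm_real] at this
    exact_mod_cast this
  have e₃ : ‖(L.u ^ 2 * L.σ * L.s t ^ 2 : ℂ)‖ ≤ |a₃| := by
    have := (h₃ t htm).trans (le_abs_self _)
    rw [← Complex.norm_real] at this
    exact_mod_cast this
  rw [Q_apply, LadderSite.up, hidx]
  have hx : (0 : ℝ) ≤ x := x.cast_nonneg
  have i1 : ‖(((L.κ + L.σ * (x : ℝ)) : ℝ) : ℂ)‖ ≤ (|L.κ| + |L.σ|) * (x + 1) := by
    rw [Complex.norm_real, Real.norm_eq_abs]
    refine (abs_add_le _ _).trans ?_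
    rw [abs_mul, abs_of_nonneg hx]
    nlinarith [abs_nonneg L.κ, abs_nonneg L.σ]
  have i2 : ‖(L.κ + 2 * L.σ * x : ℂ)‖ ≤ (|L.κ| + 2 * |L.σ|) * (x + 1) := by
    have : (L.κ + 2 * L.σ * x : ℂ) = ((L.κ + 2 * L.σ * x : ℝ) : ℂ) := by push_cast; rfl
    rw [this, Complex.norm_real, Real.norm_eq_abs]
    refine (abs_add_le _ _).trans ?_
    rw [abs_mul, abs_of_nonneg hx, abs_mul, abs_two]
    nlinarith [abs_nonneg L.κ, abs_nonneg L.σ]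
  set a := ‖f t (x + 1)‖ with ha
  set d := ‖f t x‖ with hd
  set b := ‖f t (x - 1)‖ with hb
  have ha0 : 0 ≤ a := norm_nonneg _
  have hb0 : 0 ≤ b := norm_nonneg _
  have hd0 : 0 ≤ d := norm_nonneg _
  calc _ ≤ ‖(L.C t ^ 2 : ℂ)‖ * ((x : ℝ) * b) +
        ‖(L.u * L.C t * L.s t : ℂ)‖ * (‖(L.κ + 2 * L.σ * x : ℂ)‖ * d) +
        ‖(L.u ^ 2 * L.σ * L.s t ^ 2 : ℂ)‖ *
          (‖(((L.κ + L.σ * (x : ℝ)) : ℝ) : ℂ)‖ * a) := by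
        refine (norm_add_le _ _).trans (add_le_add ((norm_sub_le _ _).trans (add_le_add ?_ ?_)) ?_)
        · rw [norm_mul, norm_mul, Complex.norm_natCast]
        · rw [norm_mul, norm_mul (L.κ + 2 * L.σ * x : ℂ)]
        · rw [norm_mul, norm_mul ((L.κ + L.σ * (x : ℝ) : ℝ) : ℂ)]
    _ ≤ |a₁| * ((x + 1) * (a + d + b)) +
        |a₂| * ((|L.κ| + 2 * |L.σ|) * (x + 1) * (a + d + b)) +
        |a₃| * ((|L.κ| + |L.σ|) * (x + 1) * (a + d + b)) := by
        gcongr <;> linarith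
    _ = _ := by ring

theorem locallyGeometric_state (hidx : ∀ x, L.idx x = x) {c : ℝ}
    (hvac : LocallyGeometric c L.vac) (m : ℕ) : LocallyGeometric c (L.state m) := by
  induction m with
  | zero => exact hvac
  | succ m ih =>
    refine (locallyGeometric_Q hidx ih).of_le fun R => ⟨‖((m : ℂ) + 1)⁻¹‖, fun t _ x => ?_⟩
    rw [state_succ, Pi.smul_apply, smul_eq_mul, norm_mul]
    gcongr
    have hx : (0 : ℝ) ≤ x := x.cast_nonneg
    nlinarith [norm_nonneg (L.Q t (L.state m t) (x + 1)), norm_nonneg (L.Q t (L.state m t) x),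
      norm_nonneg (L.Q t (L.state m t) (x - 1))]

/-- The operators A and Q(t) preserve locally geometric bounds, so a bound on the vacuum orbit
yields square integrability and domination for all states. -/
theorem isAdmissible_nat (hidx : ∀ x, L.idx x = x) (hκ : 0 < L.κ) (hσ : 0 ≤ L.σ)
    (hw : L.Reversible w q) (hq : 0 < q) (huv : L.u = q * L.v)
    (hvac : LocallyGeometric (q * L.σ) L.vac) : L.IsAdmissible w q := by
  have hbal : ∀ x : ℕ, ((x : ℝ) + 1) * w (x + 1) = q * ((L.κ + L.σ * x) * w x) := by
    intro x
    have h1 : L.up x ≠ 0 := by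
      rw [LadderSite.up]
      positivity
    have := hw.balance x h1
    rw [LadderSite.up, hidx, hidx] at this
    exact_mod_cast this
  have hsum : ∀ {ρ K : ℝ} {m : ℕ}, 0 < ρ → q * L.σ * ρ ^ 2 < 1 →
      Summable fun x : ℕ => w x * (K * ((x + 1) ^ m * ρ ^ x)) ^ 2 := by
    intro ρ K m hρ hc
    refine ((summable_weight_mul_geometric hw.pos hbal hρ hc m).mul_left (K ^ 2)).congr fun x => ?_
    ring
  have hmem : ∀ {f : ℝ → ℕ → ℂ}, LocallyGeometric (q * L.σ) f → ∀ t,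
      MemLp (f t) 2 (weightMeasure w) := by
    intro f hf t
    obtain ⟨ρ, K, m, hρ, hc, hK, hf⟩ := hf |t|
    rw [memLp_weightMeasure_iff hw.pos]
    refine Summable.of_nonneg_of_le (fun x => by have := hw.pos x; positivity) (fun x => ?_)
      (hsum (K := K) (m := m) hρ hc)
    have := hw.pos x
    gcongr
    exact hf t le_rfl x
  refine ⟨hw, hq.ne', isMaximallySkew_nat hidx hκ hσ hw hq huv,
    fun m => hmem (locallyGeometric_state hidx hvac m),
    fun m => hmem (locallyGeometric_A hidx (locallyGeometric_state hidx hvac m)), fun m t => ?_⟩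
  obtain ⟨ρ, K, k, hρ, hc, hK, hf⟩ :=
    locallyGeometric_A hidx (locallyGeometric_state hidx hvac m) (|t| + 1)
  refine ⟨fun x => K * ((x + 1) ^ k * ρ ^ x), 1, one_pos, hsum hρ hc, fun r hr x => hf r ?_ x⟩
  have := abs_add_le (r - t) t
  rw [sub_add_cancel] at this
  linarith

end LadderFlow

end NatSite

/-! ### Independent random walkers -/

namespace IRW

/-- Here ω = 0, and cosh ωt and sinh ωt / ω degenerate to 1 and t. -/
def flow (p : ℝ) : LadderFlow ℕ where
  toLadderSite := natSite 1 0 one_pos le_rfl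
  u := p
  v := 1
  C _ := 1
  s t := t
  vac t x := ((Real.exp (-(p * t ^ 2) / 2) * t ^ x : ℝ) : ℂ)
  C_zero := rfl
  s_zero := rfl
  hasDerivAt_C t := by simpa [natSite] using hasDerivAt_const t (1 : ℝ)
  hasDerivAt_s t := hasDerivAt_id t
  C_sq_sub t := by simp [natSite]
  vac_zero x := by cases x <;> simp [natSite]
  hasDerivAt_vac t x := by
    have h1 : HasDerivAt (fun t : ℝ => -(p * t ^ 2) / 2) (-(p * t)) t :=
      (((hasDerivAt_pow 2 t).const_mul p).neg.div_const 2).congr_deriv (by simp; ring)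
    refine (h1.exp.mul (hasDerivAt_pow x t)).ofReal_comp.congr_deriv ?_
    simp only [natSite]
    push_cast
    rcases x with _ | x
    · simp
      ring
    · simp
      ring
  vac_up t x := by
    simp only [natSite]
    push_cast
    ring
  vac_down t x := by
    simp only [natSite]
    rcases x with _ | x
    · simp
    · push_cast [Nat.add_sub_cancel]
      ring

theorem A_eq (p : ℝ) : A p = (flow p).A := by
  refine LinearMap.ext fun f => funext fun x => ?_
  rw [LadderFlow.A_apply]
  simp [A, adag, a, shiftUp, shiftDown, flow, LadderSite.up, natSite]

theorem a_comp_adag : a ∘ₗ adag = multBy fun x => ((flow p).idx x : ℝ) + 0 := by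
  refine LinearMap.ext fun f => funext fun x => ?_
  rcases x with _ | x <;>
  simp [adag, a, shiftUp, shiftDown, flow, natSite, multBy]

theorem w_pos {p : ℝ} (hp : 0 < p) (x : ℕ) : 0 < w p x := by
  unfold w
  positivity

theorem isAdmissible {p : ℝ} (hp : 0 < p) : (flow p).IsAdmissible (w p) p := by
  refine LadderFlow.isAdmissible_nat (fun x => rfl) one_pos le_rfl ⟨w_pos hp, fun x _ => ?_⟩ hp
    (mul_one p).symm fun R => ?_
  · simp only [flow, LadderSite.up, natSite, w, Nat.factorial_succ]
    push_cast
    field_simp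
    ring
  -- Since σ = 0 there is no restriction on ρ; any positive bound for |t| serves.
  · refine ⟨|R| + 1, 1, 0, by positivity, by simp [flow, natSite], zero_le_one, fun t ht x => ?_⟩
    simp only [flow, Complex.norm_real, norm_mul, Real.norm_eq_abs, Real.abs_exp, pow_zero, abs_pow]
    rw [one_mul]
    gcongr
    · rw [Real.exp_le_one_iff]
      have : 0 ≤ p * t ^ 2 := by positivity
      linarith
    · linarith [le_abs_self R]

theorem cheap_eq (p : ℝ) : cheap p = fun x y => if x = y then (x.factorial : ℝ) / p ^ x else 0 := by
  funext x y
  unfold cheap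
  split_ifs with h
  · rw [h]
  · rfl

theorem rate_eq (p : ℝ) : rate = (flow p).rate := by
  funext x y
  simp [rate, LadderSite.rate, LadderSite.up, flow, natSite]

theorem S_eq {p : ℝ} (hp : 0 < p) (α β : ℝ) (f : ℕ → ℂ) (hf : f.support.Finite) :
    S p α β f = fun x => ∑ᶠ y, (flow p).kernel α 0 β x y * f y := by
  rw [← (isAdmissible hp).expOp_expOp α 0 β hf, S, A_eq, a_comp_adag (p := p)]

theorem cheap_mul_w {p : ℝ} (hp : 0 < p) (x : ℕ) :
    (x.factorial : ℝ) / p ^ x * w p x = w p 0 := by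
  simp [w]
  field_simp

theorem applyTo_S_charlier {p : ℝ} (hp : 0 < p) (x y : ℕ) :
    applyTo (S p Real.pi 1) (cheap p) x y = (Real.exp (-p / 2) : ℂ) * (charlier p x y : ℂ) := by
  rw [cheap_eq, (isAdmissible hp).applyTo_eq 0 (t := 1) (c := Real.exp (-p / 2)) (o := 0) (b := [])
    (z := -1 / p) (by simp [flow]) (by simp [flow]) hp.ne' (fun x => ?_) (S_eq hp Real.pi 1) rfl
    (cheap_mul_w hp) (fun m j _ => ?_) (by simp)]
  · simp [charlier, flow, natSite]
  · simp [flow, natSite, mul_comm]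
  · simp only [flow, natSite, ascPochhammer_succ_eval, List.map_nil, List.prod_nil, neg_div,
      neg_neg, pow_succ]
    have := hp.ne'
    field_simp
    ring

end IRW

/-! ### The inclusion process -/

namespace SIP

/-- `tanh(t / √p) / √p` -/
def ratio (p t : ℝ) : ℝ := Real.sinh (t / √p) / (√p * Real.cosh (t / √p))

theorem sqrt_mul_ratio_sq {p : ℝ} (hp : 0 < p) (t : ℝ) :
    p * ratio p t ^ 2 = 1 - 1 / Real.cosh (t / √p) ^ 2 := by
  have h := Real.cosh_pos (t / √p)
  rw [ratio, div_pow, mul_pow, Real.sq_sqrt hp.le, Real.sinh_sq]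
  field_simp

/-- A Riccati equation: for a vacuum orbit of the form a(t) z(t)^x the flow equation forces z' = 1/p
- z² and a' = -2k z a. -/
theorem hasDerivAt_ratio {p : ℝ} (hp : 0 < p) (t : ℝ) :
    HasDerivAt (ratio p) (1 / p - ratio p t ^ 2) t := by
  have h := Real.cosh_pos (t / √p)
  have hs := Real.sqrt_pos.2 hp
  have h1 : HasDerivAt (fun t => t / √p) (1 / √p) t := (hasDerivAt_id t).div_const _
  refine (h1.sinh.div (h1.cosh.const_mul √p) (by positivity)).congr_deriv ?_
  rw [ratio]
  field_simp
  simp only [Real.sq_sqrt hp.le]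
  ring

theorem cosh_mul_ratio {p : ℝ} (hp : 0 < p) (t : ℝ) :
    Real.cosh (t / √p) * ratio p t = 1 / p * (√p * Real.sinh (t / √p)) := by
  have h := Real.cosh_pos (t / √p)
  have hs := Real.sqrt_pos.2 hp
  rw [ratio]
  field_simp
  rw [Real.sq_sqrt hp.le, mul_comm]

theorem hasDerivAt_cosh_rpow (p a t : ℝ) (hp : 0 < p) :
    HasDerivAt (fun t => Real.cosh (t / √p) ^ a) (a * ratio p t * Real.cosh (t / √p) ^ a) t := by
  have h := Real.cosh_pos (t / √p)
  have hs := Real.sqrt_pos.2 hp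
  have h1 : HasDerivAt (fun t => t / √p) (1 / √p) t := (hasDerivAt_id t).div_const _
  refine (h1.cosh.rpow_const (p := a) (Or.inl h.ne')).congr_deriv ?_
  rw [Real.rpow_sub_one h.ne', ratio]
  field_simp

def flow (k p : ℝ) (hk : 0 < k) (hp : 0 < p) : LadderFlow ℕ where
  toLadderSite := natSite (2 * k) 1 (by positivity) zero_le_one
  u := 1
  v := 1 / p
  C t := Real.cosh (t / √p)
  s t := √p * Real.sinh (t / √p)
  vac t x := ((Real.cosh (t / √p) ^ (-(2 * k)) * ratio p t ^ x : ℝ) : ℂ)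
  C_zero := by simp
  s_zero := by simp
  hasDerivAt_C t := by
    refine (((hasDerivAt_id t).div_const √p).cosh).congr_deriv ?_
    have hs := Real.sqrt_pos.2 hp
    simp only [natSite, id]
    nth_rewrite 3 [← Real.sq_sqrt hp.le]
    field_simp
  hasDerivAt_s t := by
    refine ((((hasDerivAt_id t).div_const √p).sinh).const_mul √p).congr_deriv ?_
    have hs := Real.sqrt_pos.2 hp
    simp only [id]
    field_simp
  C_sq_sub t := by
    simp only [natSite]
    rw [mul_pow, Real.sq_sqrt hp.le, Real.cosh_sq]
    field_simp
    ring
  vac_zero x := by cases x <;> simp [natSite, ratio]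
  hasDerivAt_vac t x := by
    refine ((hasDerivAt_cosh_rpow p (-(2 * k)) t hp).mul
      ((hasDerivAt_ratio hp t).pow x)).ofReal_comp.congr_deriv ?_
    simp only [natSite, Pi.pow_apply]
    rcases x with _ | x
    · push_cast
      simp
      ring
    · push_cast [Nat.add_sub_cancel]
      ring
  vac_up t x := by
    rw [← Complex.ofReal_mul (1 / p), ← cosh_mul_ratio hp]
    push_cast
    ring
  vac_down t x := by
    rw [← Complex.ofReal_mul (1 / p), ← cosh_mul_ratio hp]
    simp only [natSite]
    rcases x with _ | x
    · simp
    · push_cast [Nat.add_sub_cancel]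
      ring

section

variable {k p : ℝ}

theorem A_eq (hk : 0 < k) (hp : 0 < p) : A k p = (flow k p hk hp).A := by
  refine LinearMap.ext fun f => funext fun x => ?_
  rw [LadderFlow.A_apply]
  simp [A, Kplus, Kminus, shiftUp, shiftDown, flow, LadderSite.up, natSite, mul_assoc]

theorem Kzero_eq (hk : 0 < k) (hp : 0 < p) :
    Kzero k = multBy fun x => ((flow k p hk hp).idx x : ℝ) + k := rfl

theorem w_pos (hk : 0 < k) (hp : 0 < p) (hp1 : p < 1) (x : ℕ) : 0 < w k p x := by
  unfold w
  have : 0 < 1 - p := by linarith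
  have h1 : 0 < Real.Gamma (2 * k) := Real.Gamma_pos_of_pos (by positivity)
  have h2 : 0 < Real.Gamma (2 * k + x) := Real.Gamma_pos_of_pos (by positivity)
  positivity

theorem isAdmissible (hk : 0 < k) (hp : 0 < p) (hp1 : p < 1) :
    (flow k p hk hp).IsAdmissible (w k p) p := by
  refine LadderFlow.isAdmissible_nat (fun x => rfl) (by simp [flow, natSite, hk])
    (by simp [flow, natSite]) ⟨w_pos hk hp hp1, fun x _ => ?_⟩ hp
    (by simp [flow, hp.ne']) fun R => ?_
  · have h1 : 0 < Real.Gamma (2 * k) := Real.Gamma_pos_of_pos (by positivity)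
    have h2 : (2 * k + x : ℝ) ≠ 0 := by positivity
    simp only [flow, LadderSite.up, natSite, w, Nat.factorial_succ]
    push_cast
    rw [← add_assoc, Real.Gamma_add_one h2]
    field_simp
    ring
  · have hs := Real.sqrt_pos.2 hp
    -- Since p times the squared ratio is 1 - 1/cosh², an upper bound r for cosh on |t| ≤ R keeps it
    -- at most 1 - 1/r² < 1. The summand 1 ensures r > 1, so that ρ is positive.
    set r : ℝ := Real.cosh ((|R| + 1) / √p)
    have hr : 1 < r := Real.one_lt_cosh.2 (by positivity)
    have hr1 : 1 / r ^ 2 < 1 := by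
      rw [div_lt_one (by positivity)]
      exact one_lt_pow₀ hr two_ne_zero
    have hρ : 0 < (1 - 1 / r ^ 2) / p := div_pos (by linarith) hp
    refine ⟨√((1 - 1 / r ^ 2) / p), 1, 0, Real.sqrt_pos.2 hρ, ?_, zero_le_one, fun t ht x => ?_⟩
    · rw [Real.sq_sqrt hρ.le]
      simp only [flow, natSite, mul_one]
      rw [mul_div_cancel₀ _ hp.ne', sub_lt_self_iff]
      positivity
    · have hc := Real.cosh_pos (t / √p)
      have hle : Real.cosh (t / √p) ≤ r := by
        rw [Real.cosh_le_cosh, abs_div, abs_div, abs_of_pos hs]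
        rw [abs_of_pos (by positivity : 0 < |R| + 1)]
        exact div_le_div_of_nonneg_right (by linarith [le_abs_self R]) hs.le
      have hz : |ratio p t| ≤ √((1 - 1 / r ^ 2) / p) := by
        refine Real.abs_le_sqrt ?_
        rw [le_div_iff₀ hp, mul_comm, sqrt_mul_ratio_sq hp]
        gcongr
      simp only [flow, Complex.norm_real, norm_mul, Real.norm_eq_abs, pow_zero, abs_pow]
      rw [one_mul]
      gcongr
      rw [abs_of_nonneg (by positivity)]
      exact Real.rpow_le_one_of_one_le_of_nonpos (Real.one_le_cosh _) (by linarith)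

theorem cheap_eq : cheap k p = fun x y : ℕ => if x = y then
    (x.factorial : ℝ) * Real.Gamma (2 * k) / Real.Gamma (2 * k + x) * (p ^ x)⁻¹ else 0 := by
  funext x y
  unfold cheap
  split_ifs with h
  · rw [h]
  · rfl

theorem rate_eq (hk : 0 < k) (hp : 0 < p) : rate k = (flow k p hk hp).rate := by
  funext x y
  simp [rate, LadderSite.rate, LadderSite.up, flow, natSite]

theorem S_eq (hk : 0 < k) (hp : 0 < p) (hp1 : p < 1) (α β : ℝ) (f : ℕ → ℂ) (hf : f.support.Finite) :
    S k p α β f = fun x => ∑ᶠ y, (flow k p hk hp).kernel α k β x y * f y := by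
  rw [← (isAdmissible hk hp hp1).expOp_expOp α k β hf, S, A_eq hk hp, Kzero_eq hk hp]

theorem cheap_mul_w (hk : 0 < k) (hp : 0 < p) (x : ℕ) :
    (x.factorial : ℝ) * Real.Gamma (2 * k) / Real.Gamma (2 * k + x) * (p ^ x)⁻¹ * w k p x =
      w k p 0 := by
  have h1 : 0 < Real.Gamma (2 * k) := Real.Gamma_pos_of_pos (by positivity)
  have h2 : 0 < Real.Gamma (2 * k + x) := Real.Gamma_pos_of_pos (by positivity)
  simp only [w, Nat.factorial_zero, Nat.cast_zero, Nat.cast_one, add_zero, pow_zero]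
  field_simp

/-- The chosen time solves tanh(t/√p) = √p, which is C = v s. At this time `ratio` equals 1, so the
vacuum orbit at -t is alternating with constant modulus (1 - p)^k. -/
theorem applyTo_S_meixner (hk : 0 < k) (hp : 0 < p) (hp1 : p < 1) (x y : ℕ) :
    applyTo (S k p Real.pi (√p * Real.artanh √p)) (cheap k p) x y =
      ((p : ℂ) - 1) ^ (k : ℂ) * (meixner k p x y : ℂ) := by
  have hs := Real.sqrt_pos.2 hp
  have hs1 : √p < 1 := by rw [Real.sqrt_lt' one_pos]; simpa using hp1
  have hmem : √p ∈ Set.Ioo (-1 : ℝ) 1 := ⟨by linarith, hs1⟩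
  have hq : 0 < 1 - p := by linarith
  have hqs := Real.sqrt_pos.2 hq
  have harg : √p * Real.artanh √p / √p = Real.artanh √p := by field_simp
  have hcosh : Real.cosh (Real.artanh √p) = 1 / √(1 - p) := by
    rw [Real.cosh_artanh hmem, Real.sq_sqrt hp.le]
  have hsinh : Real.sinh (Real.artanh √p) = √p / √(1 - p) := by
    rw [Real.sinh_artanh hmem, Real.sq_sqrt hp.le]
  have hpow : (1 / √(1 - p)) ^ (-(2 * k)) = (1 - p) ^ k := by
    rw [one_div, Real.inv_rpow hqs.le, Real.rpow_neg hqs.le, inv_inv, Real.rpow_mul hqs.le]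
    norm_num [Real.sq_sqrt hq.le]
  rw [cheap_eq, (isAdmissible hk hp hp1).applyTo_eq k (t := √p * Real.artanh √p)
    (c := (1 - p) ^ k) (o := 0) (b := [2 * k])
    (z := 1 - 1 / p) ?_ ?_ one_ne_zero (fun x => ?_) (S_eq hk hp hp1 Real.pi _) rfl
    (cheap_mul_w hk hp) (fun m j _ => ?_) (by simp)]
  -- The principal power of the negative number p - 1 supplies the phase exp(iπk).
  · have h := Complex.ofReal_cpow_of_nonpos (show p - 1 ≤ 0 by linarith) (k : ℂ)
    push_cast at h
    rw [h, neg_sub, mul_comm Complex.I, mul_comm (Complex.exp _), meixner,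
      Complex.ofReal_cpow hq.le]
    simp [flow, natSite]
  · simp only [flow]
    rw [harg, hcosh, hsinh]
    nth_rewrite 2 [← Real.sq_sqrt hp.le]
    field_simp
  · exact (Real.cosh_pos _).ne'
  · simp only [flow, natSite, ratio]
    rw [neg_div, harg, Real.cosh_neg, Real.sinh_neg, hcosh, hsinh, hpow]
    have : -(√p / √(1 - p)) / (√p * (1 / √(1 - p))) = -1 := by field_simp
    rw [this]
    push_cast
    ring
  · simp only [flow, natSite, ascPochhammer_succ_eval, List.map_cons, List.map_nil,
      List.prod_cons, List.prod_nil, mul_one, pow_succ]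
    have h1 : (2 * k + j : ℝ) ≠ 0 := by positivity
    have h2 := (ascPochhammer_pos j (2 * k) (by positivity)).ne'
    field_simp
    ring

end
end SIP

/-! ### The exclusion process -/

/-! ### Matrix exponentials as solutions of linear systems -/

section MatrixExponential

variable {ι : Type*} [Fintype ι] [DecidableEq ι]

theorem hasDerivAt_matrix_exp_entry (M : Matrix ι ι ℂ) (i j : ι) (t : ℝ) :
    HasDerivAt (fun t : ℝ => NormedSpace.exp (t • M) i j)
      ((NormedSpace.exp (t • M) * M) i j) t := by
  let _ : NormedRing (Matrix ι ι ℂ) := Matrix.linftyOpNormedRing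
  let _ : NormedAlgebra ℝ (Matrix ι ι ℂ) := Matrix.linftyOpNormedAlgebra
  have h : HasDerivAt (fun t : ℝ => NormedSpace.exp (t • M)) (NormedSpace.exp (t • M) * M) t :=
    hasDerivAt_exp_smul_const M t
  exact (LinearMap.toContinuousLinearMap
    (Matrix.entryLinearMap ℝ ℂ i j)).hasFDerivAt.comp_hasDerivAt t h

/-- Solutions of the linear system `f' = M f` are given by the matrix exponential. -/
theorem matrix_exp_mulVec_of_hasDerivAt (M : Matrix ι ι ℂ) (f : ℝ → ι → ℂ)
    (hf : ∀ t i, HasDerivAt (fun r => f r i) (M.mulVec (f t) i) t) (t : ℝ) :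
    f t = (NormedSpace.exp (t • M)).mulVec (f 0) := by
  have hconst : (NormedSpace.exp (t • -M)).mulVec (f t) = f 0 := by
    funext i
    have hd : ∀ r : ℝ, HasDerivAt (fun r => (NormedSpace.exp (r • -M)).mulVec (f r) i) 0 r := by
      intro r
      have h := HasDerivAt.fun_sum (u := Finset.univ) fun j _ =>
        (hasDerivAt_matrix_exp_entry (-M) i j r).mul (hf r j)
      refine h.congr_deriv ?_
      rw [Finset.sum_add_distrib]
      change ((NormedSpace.exp (r • -M) * -M).mulVec (f r) i) +
        (NormedSpace.exp (r • -M)).mulVec (M.mulVec (f r)) i = 0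
      rw [Matrix.mulVec_mulVec, mul_neg, Matrix.neg_mulVec, Pi.neg_apply, neg_add_cancel]
    have h := is_const_of_deriv_eq_zero (fun r => (hd r).differentiableAt)
      (fun r => (hd r).deriv) t 0
    simpa using h
  rw [← hconst, Matrix.mulVec_mulVec, smul_neg, ← Matrix.exp_add_of_commute]
  · simp
  · exact (Commute.refl _).neg_right

end MatrixExponential

namespace SEP

theorem val_sub_one {n : ℕ} {x : Fin (n + 1)} (hx : (x : ℕ) ≠ 0) :
    ((x - 1 : Fin (n + 1)) : ℕ) + 1 = x := by
  have : x ≠ 0 := fun h => hx (by simp [h])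
  have := Fin.val_sub_one_of_ne_zero this
  omega

theorem val_add_one {n : ℕ} {x : Fin (n + 1)} (hx : (x : ℕ) ≠ n) :
    ((x + 1 : Fin (n + 1)) : ℕ) = x + 1 :=
  Fin.val_add_one_of_lt (Fin.lt_def.2 (by simp [Fin.val_last]; omega))

/-- The coefficient n - x vanishes precisely at the site value where x + 1 wraps around. -/
def site (n : ℕ) : LadderSite (Fin (n + 1)) where
  idx x := x
  κ := n
  σ := -1
  idx_injective := Fin.val_injective
  pred x hx := by
    refine ⟨val_sub_one hx, sub_add_cancel x 1, ?_⟩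
    have h1 := val_sub_one hx
    have h2 : ((x - 1 : Fin (n + 1)) : ℕ) < n := by omega
    have h3 : (((x - 1 : Fin (n + 1)) : ℕ) : ℝ) < n := by exact_mod_cast h2
    intro h
    linarith
  succ x hx := by
    refine ⟨val_add_one fun h => hx ?_, add_sub_cancel_right x 1⟩
    rw [h]
    ring

/-- the bihomogeneous monomials of degree `n` -/
def monomial (n : ℕ) (c z : ℝ) (x : Fin (n + 1)) : ℂ :=
  ((c ^ (n - x : ℕ) * z ^ (x : ℕ) : ℝ) : ℂ)

theorem mul_monomial_add_one (n : ℕ) (c z : ℝ) (x : Fin (n + 1)) :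
    (((n : ℝ) : ℂ) + ((-1 : ℝ) : ℂ) * (x : ℕ)) * monomial n c z (x + 1) =
      (n - x : ℕ) * (c : ℂ) ^ (n - x - 1 : ℕ) * (z : ℂ) ^ (x + 1 : ℕ) := by
  have hle : (x : ℕ) ≤ n := by omega
  rcases eq_or_ne (x : ℕ) n with h | h
  · simp [h]
  · rw [monomial, val_add_one h, Nat.cast_sub hle, Nat.sub_sub]
    push_cast
    ring

theorem mul_monomial_sub_one (n : ℕ) (c z : ℝ) (x : Fin (n + 1)) :
    ((x : ℕ) : ℂ) * monomial n c z (x - 1) =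
      (x : ℕ) * (c : ℂ) ^ (n - x + 1 : ℕ) * (z : ℂ) ^ (x - 1 : ℕ) := by
  rcases eq_or_ne (x : ℕ) 0 with h | h
  · simp [h]
  · have h1 := val_sub_one h
    have h2 : n - ((x - 1 : Fin (n + 1)) : ℕ) = n - x + 1 := by omega
    have h3 : ((x - 1 : Fin (n + 1)) : ℕ) = x - 1 := by omega
    rw [monomial, h2, h3]
    push_cast
    ring

theorem mul_sin_div_sqrt {v : ℝ} (hv : 0 < v) (t : ℝ) :
    v * (Real.sin (√v * t) / √v) = √v * Real.sin (√v * t) := by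
  have hs := Real.sqrt_pos.2 hv
  field_simp
  rw [Real.sq_sqrt hv.le, mul_comm]

/-- Here ω² = -v is negative, so the hyperbolic functions become trigonometric. -/
def flow (n : ℕ) (v : ℝ) (hv : 0 < v) : LadderFlow (Fin (n + 1)) where
  toLadderSite := site n
  u := 1
  v := v
  C t := Real.cos (√v * t)
  s t := Real.sin (√v * t) / √v
  vac t := monomial n (Real.cos (√v * t)) (√v * Real.sin (√v * t))
  C_zero := by simp
  s_zero := by simp
  hasDerivAt_C t := by
    refine (((hasDerivAt_id t).const_mul √v).cos).congr_deriv ?_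
    have hs := Real.sqrt_pos.2 hv
    simp only [site, id]
    field_simp
    rw [Real.sq_sqrt hv.le]
    ring
  hasDerivAt_s t := by
    refine ((((hasDerivAt_id t).const_mul √v).sin).div_const √v).congr_deriv ?_
    have hs := Real.sqrt_pos.2 hv
    simp only [id]
    field_simp
  C_sq_sub t := by
    simp only [site]
    rw [div_pow, Real.sq_sqrt hv.le, Real.cos_sq']
    field_simp
    ring
  vac_zero x := by
    rcases eq_or_ne (x : ℕ) 0 with h | h <;> simp [site, h, monomial]
  hasDerivAt_vac t x := by
    have hs := Real.sqrt_pos.2 hv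
    have hC : HasDerivAt (fun t => Real.cos (√v * t)) (-(√v * Real.sin (√v * t))) t :=
      (((hasDerivAt_id t).const_mul √v).cos).congr_deriv (by simp [mul_comm])
    have hS : HasDerivAt (fun t => √v * Real.sin (√v * t)) (v * Real.cos (√v * t)) t :=
      ((((hasDerivAt_id t).const_mul √v).sin).const_mul √v).congr_deriv (by
        simp only [id]
        linear_combination Real.cos (√v * t) * Real.sq_sqrt hv.le)
    refine ((hC.pow (n - x : ℕ)).mul (hS.pow (x : ℕ))).ofReal_comp.congr_deriv ?_
    have h1 := mul_monomial_add_one n (Real.cos (√v * t)) (√v * Real.sin (√v * t)) x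
    have h2 := mul_monomial_sub_one n (Real.cos (√v * t)) (√v * Real.sin (√v * t)) x
    simp only [site, Pi.pow_apply]
    rw [Complex.ofReal_one, one_mul, mul_assoc (v : ℂ), h1, h2]
    push_cast
    ring
  vac_up t x := by
    have h1 := mul_monomial_add_one n (Real.cos (√v * t)) (√v * Real.sin (√v * t)) x
    have hs := mul_sin_div_sqrt hv t
    simp only [site]
    rw [h1, ← Complex.ofReal_mul v, hs, monomial]
    have hle : (x : ℕ) ≤ n := by omega
    have h2 : ((n : ℝ) : ℂ) + ((-1 : ℝ) : ℂ) * (x : ℕ) = (n - x : ℕ) := by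
      push_cast [Nat.cast_sub hle]
      ring
    rw [mul_assoc, h2]
    rcases n - (x : ℕ) with _ | a
    · simp
    · push_cast [Nat.add_sub_cancel]
      ring
  vac_down t x := by
    have h1 := mul_monomial_sub_one n (Real.cos (√v * t)) (√v * Real.sin (√v * t)) x
    have hs := mul_sin_div_sqrt hv t
    simp only [site]
    rw [h1, ← Complex.ofReal_mul v, hs, monomial]
    rcases (x : ℕ) with _ | a
    · simp
    · push_cast [Nat.add_sub_cancel]
      ring

end SEP

theorem toMatrix'_multBy {X : Type*} [Fintype X] [DecidableEq X] (c : X → ℝ) :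
    LinearMap.toMatrix' (multBy c) = Matrix.diagonal fun x => (c x : ℂ) := by
  ext x y
  rw [LinearMap.toMatrix'_apply, Matrix.diagonal_apply]
  rcases eq_or_ne x y with rfl | h <;> simp [multBy, *]

/-- Each state solves the linear system with matrix A and starts at a unit vector, so it is a column
of the matrix exponential. -/
theorem LadderFlow.matrix_exp_A {X : Type*} [Add X] [Sub X] [One X] [Fintype X] [DecidableEq X]
    (L : LadderFlow X) (t : ℝ) (x y : X) :
    NormedSpace.exp (LinearMap.toMatrix' ((t : ℂ) • L.A)) x y = L.state (L.idx y) t x := by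
  have h1 : LinearMap.toMatrix' ((t : ℂ) • L.A) = t • LinearMap.toMatrix' L.A := by
    ext i j
    simp [LinearMap.toMatrix'_apply]
  have h2 : L.state (L.idx y) 0 = Pi.single y 1 := by
    funext x
    rw [Pi.single_apply, L.state_at_zero]
    simp only [L.idx_injective.eq_iff]
  rw [matrix_exp_mulVec_of_hasDerivAt (LinearMap.toMatrix' L.A) (L.state (L.idx y)) (fun t i => ?_)
    t, h1, h2, Matrix.mulVec_single_one, Matrix.col_apply]
  rw [LinearMap.toMatrix'_mulVec]
  exact L.hasDerivAt_state _ t i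

namespace SEP

variable {n : ℕ} {p : ℝ}

theorem odds_pos (hp : 0 < p) (hp1 : p < 1) : 0 < (1 - p) / p := div_pos (by linarith) hp

theorem A_eq {v : ℝ} (hv : 0 < v) (h : v = (1 - p) / p) : A n p = (flow n v hv).A := by
  refine LinearMap.ext fun f => funext fun x => ?_
  rw [LadderFlow.A_apply]
  simp [A, Jplus, Jminus, shiftUp, shiftDown, flow, LadderSite.up, site, mul_assoc, h]
  exact Or.inl (by ring)

theorem w_pos (hp : 0 < p) (hp1 : p < 1) (x : Fin (n + 1)) : 0 < w n p x := by
  unfold w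
  have h1 : 0 < 1 - p := by linarith
  have h2 : 0 < n.choose (x : ℕ) := Nat.choose_pos (by omega)
  positivity

theorem isAdmissible (hp : 0 < p) (hp1 : p < 1) {v : ℝ} (hv : 0 < v) (hvp : v = (1 - p) / p) :
    (flow n v hv).IsAdmissible (w n p) (p / (1 - p)) := by
  have h1 : 0 < 1 - p := by linarith
  refine LadderFlow.isAdmissible_of_finite ⟨w_pos hp hp1, fun x hx => ?_⟩ (by positivity) ?_
  · have hx1 : (x : ℕ) ≠ n := fun h => hx (by simp [flow, site, LadderSite.up, h])
    have hle : (x : ℕ) ≤ n := by omega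
    simp only [flow, site, LadderSite.up, w, val_add_one hx1]
    have h2 : (n.choose ((x : ℕ) + 1) : ℝ) * ((x : ℕ) + 1) = n.choose (x : ℕ) * (n - (x : ℕ)) := by
      have := Nat.choose_succ_right_eq n x
      rw [← Nat.cast_sub hle]
      exact_mod_cast this
    push_cast
    rw [pow_succ]
    linear_combination (p / (1 - p)) ^ (x : ℕ) * (p / (1 - p)) * (1 - p) ^ n * h2
  · simp only [flow, hvp]
    field_simp

theorem cheap_eq : cheap n p = fun x y : Fin (n + 1) => if x = y then
    ((n - (x : ℕ)).factorial : ℝ) * ((x : ℕ).factorial : ℝ) / (n.factorial : ℝ) *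
      ((1 - p) / p) ^ (x : ℕ) else 0 := by
  funext x y
  unfold cheap
  split_ifs with h
  · rw [h]
  · rfl

theorem rate_eq {v : ℝ} (hv : 0 < v) : rate n = (flow n v hv).rate := by
  funext x y
  simp [rate, LadderSite.rate, LadderSite.up, flow, site, sub_eq_add_neg]

theorem S_eq {v : ℝ} (hv : 0 < v) (hvp : v = (1 - p) / p) (α β : ℝ) (f : Fin (n + 1) → ℂ) :
    S n p α β f = fun x => ∑ᶠ y, (flow n v hv).kernel α (-(n / 2)) β x y * f y := by
  have h1 : LinearMap.toMatrix' ((Complex.I * α) • Jzero n) =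
      Matrix.diagonal fun x : Fin (n + 1) =>
        Complex.I * α * (((x : ℕ) : ℂ) + ((-((n : ℝ) / 2) : ℝ) : ℂ)) := by
    rw [map_smul, Jzero, toMatrix'_multBy, ← Matrix.diagonal_smul]
    congr 1
    funext x
    simp
    exact Or.inl (by ring)
  funext x
  rw [S, A_eq hv hvp, h1, Matrix.exp_diagonal, Pi.exp_def, finsum_eq_sum_of_fintype, Matrix.mulVec,
    dotProduct]
  refine Finset.sum_congr rfl fun y _ => ?_
  rw [Matrix.mul_diagonal, LadderFlow.matrix_exp_A, LadderFlow.kernel, ← Complex.exp_eq_exp_ℂ,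
    mul_comm (LadderFlow.state _ _ _ _)]
  rfl

theorem cheap_mul_w (hp : 0 < p) (hp1 : p < 1) (x : Fin (n + 1)) :
    ((n - (x : ℕ)).factorial : ℝ) * ((x : ℕ).factorial : ℝ) / (n.factorial : ℝ) *
      ((1 - p) / p) ^ (x : ℕ) * w n p x = w n p 0 := by
  have h1 : 0 < 1 - p := by linarith
  have h2 : (n.choose (x : ℕ) : ℝ) * (x : ℕ).factorial * (n - (x : ℕ)).factorial = n.factorial := by
    exact_mod_cast Nat.choose_mul_factorial_mul_factorial (by omega : (x : ℕ) ≤ n)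
  have h3 : ((1 - p) / p) ^ (x : ℕ) * (p / (1 - p)) ^ (x : ℕ) = 1 := by
    rw [← mul_pow]
    field_simp
    simp
  have h4 : (n.factorial : ℝ) ≠ 0 := by positivity
  simp only [w, Fin.val_zero, Nat.choose_zero_right, Nat.cast_one, pow_zero, one_mul]
  calc _ = ((n.choose (x : ℕ) : ℝ) * (x : ℕ).factorial * (n - (x : ℕ)).factorial) / n.factorial *
        (((1 - p) / p) ^ (x : ℕ) * (p / (1 - p)) ^ (x : ℕ)) * (1 - p) ^ n := by ring
    _ = _ := by rw [h2, h3, div_self h4, one_mul, one_mul]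

/-- The time solves tan(√v t) = 1/√v, that is, C = v s. Then cos(√v t) and √v sin(√v t) both equal
√(1 - p), so the vacuum monomial at -t has constant modulus (1 - p)^(n/2). -/
theorem applyTo_S_krawtchouk (hp : 0 < p) (hp1 : p < 1) (x y : Fin (n + 1)) :
    applyTo (S n p Real.pi (√(p / (1 - p)) * Real.arctan √(p / (1 - p)))) (cheap n p) x y =
      Complex.exp (-(Complex.I * Real.pi * ((n : ℂ) / 2))) *
        (((1 - p) ^ ((n : ℝ) / 2) : ℝ) : ℂ) * (krawtchouk n p x y : ℂ) := by
  have hq : 0 < 1 - p := by linarith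
  have hqs := Real.sqrt_pos.2 hq
  obtain ⟨v, hvp⟩ : ∃ v, v = (1 - p) / p := ⟨_, rfl⟩
  have hv : 0 < v := hvp ▸ odds_pos hp hp1
  obtain ⟨r, hr⟩ : ∃ r, r = √(p / (1 - p)) := ⟨_, rfl⟩
  have hvr : √v * r = 1 := by
    rw [hvp, hr, ← Real.sqrt_mul (odds_pos hp hp1).le]
    have : (1 - p) / p * (p / (1 - p)) = 1 := by field_simp
    rw [this, Real.sqrt_one]
  have hr2 : 1 + r ^ 2 = (1 - p)⁻¹ := by
    rw [hr, Real.sq_sqrt (by positivity)]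
    field_simp
    ring
  have harg : √v * (r * Real.arctan r) = Real.arctan r := by rw [← mul_assoc, hvr, one_mul]
  have hcos : Real.cos (Real.arctan r) = √(1 - p) := by
    rw [Real.cos_arctan, hr2, Real.sqrt_inv, one_div, inv_inv]
  have hsin : √v * Real.sin (Real.arctan r) = √(1 - p) := by
    rw [Real.sin_arctan, hr2, Real.sqrt_inv, div_inv_eq_mul, ← mul_assoc, hvr, one_mul]
  have hpow : (1 - p) ^ ((n : ℝ) / 2) = √(1 - p) ^ n := by
    rw [Real.sqrt_eq_rpow, ← Real.rpow_natCast, ← Real.rpow_mul hq.le]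
    ring_nf
  rw [← hr, cheap_eq, (isAdmissible hp hp1 hv hvp).applyTo_eq (-(n / 2)) (t := r * Real.arctan r)
    (c := (1 - p) ^ ((n : ℝ) / 2)) (o := 0) (b := [-(n : ℝ)])
    (z := 1 / p) ?_ ?_ one_ne_zero (fun x => ?_) (fun f _ => S_eq hv hvp Real.pi _ f) rfl
    (cheap_mul_w hp hp1) (fun m j hj => ?_) (by simp)]
  · simp [krawtchouk, flow, site]
  · simp only [flow]
    rw [mul_sin_div_sqrt hv, harg, hcos, hsin]
  · simp only [flow]
    rw [harg, hcos]
    exact hqs.ne'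
  · have hle : (x : ℕ) ≤ n := by omega
    simp only [flow, site, monomial]
    rw [mul_neg, harg, Real.cos_neg, Real.sin_neg, mul_neg, hcos, hsin, hpow, neg_pow √(1 - p),
      mul_left_comm, ← pow_add, Nat.sub_add_cancel hle]
    push_cast
    rfl
  · simp only [flow, site, ascPochhammer_succ_eval, List.map_cons, List.map_nil,
      List.prod_cons, List.prod_nil, mul_one, pow_succ, hvp] at hj ⊢
    have h1 : (-(n : ℝ) + j) ≠ 0 := fun h => hj (by linarith)
    -- The recursion is also required for j > n, where the denominators vanish; both sides are then
    -- 0 because division by 0 gives 0.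
    rcases eq_or_ne ((ascPochhammer ℝ j).eval (-(n : ℝ))) 0 with h2 | h2
    · simp [h2]
    · field_simp
      ring

end SEP

end

end OrthDuality

open OrthDuality in
theorem theorem3p1 {V : Type*} [Fintype V] [LinearOrder V] (G : SimpleGraph V)
    [DecidableRel G.Adj] :
    -- the inclusion process SIP(2k)
    (∀ k p : ℝ, 0 < k → 0 < p → p < 1 →
      ExpWellDefined (SIP.μ k p) (SIP.A k p) ∧
      ExpWellDefined (SIP.μ k p) (Complex.I • SIP.Kzero k) ∧
      (∀ α β : ℝ,
        IsSymmetry (gen G (SIP.rate k)) (SIP.S k p α β) ∧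
        ExtendsToUnitary (SIP.μ k p) (SIP.S k p α β) ∧
        ExtendsToUnitary (weightMeasure (prodWeight (V := V) (SIP.w k p)))
          (tensorOp (SIP.S k p α β)) ∧
        IsSelfDuality (gen G (SIP.rate k)) (prodFun (applyTo (SIP.S k p α β) (SIP.cheap k p))) ∧
        OrthogonalWithNormOf (SIP.μ k p)
          (applyTo (SIP.S k p α β) (SIP.cheap k p)) (SIP.cheap k p) ∧
        OrthogonalWithNormOf (weightMeasure (prodWeight (V := V) (SIP.w k p)))
          (prodFun (applyTo (SIP.S k p α β) (SIP.cheap k p))) (prodFun (SIP.cheap k p))) ∧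
      (∀ x y : ℕ,
        applyTo (SIP.S k p Real.pi (√p * Real.artanh √p)) (SIP.cheap k p) x y =
          ((p : ℂ) - 1) ^ (k : ℂ) * (meixner k p x y : ℂ))) ∧
    -- the exclusion process SEP(n), n = 2j
    (∀ (n : ℕ) (p : ℝ), 0 < n → 0 < p → p < 1 →
      (∀ α β : ℝ,
        IsSymmetry (gen G (SEP.rate n)) (SEP.S n p α β) ∧
        ExtendsToUnitary (SEP.μ n p) (SEP.S n p α β) ∧
        ExtendsToUnitary (weightMeasure (prodWeight (V := V) (SEP.w n p)))
          (tensorOp (SEP.S n p α β)) ∧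
        IsSelfDuality (gen G (SEP.rate n)) (prodFun (applyTo (SEP.S n p α β) (SEP.cheap n p))) ∧
        OrthogonalWithNormOf (SEP.μ n p)
          (applyTo (SEP.S n p α β) (SEP.cheap n p)) (SEP.cheap n p) ∧
        OrthogonalWithNormOf (weightMeasure (prodWeight (V := V) (SEP.w n p)))
          (prodFun (applyTo (SEP.S n p α β) (SEP.cheap n p))) (prodFun (SEP.cheap n p))) ∧
      (∀ x y : Fin (n + 1),
        applyTo (SEP.S n p Real.pi (√(p / (1 - p)) * Real.arctan √(p / (1 - p))))
            (SEP.cheap n p) x y =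
          Complex.exp (-(Complex.I * Real.pi * ((n : ℂ) / 2))) *
            (((1 - p) ^ ((n : ℝ) / 2) : ℝ) : ℂ) * (krawtchouk n p x y : ℂ))) ∧
    -- independent random walkers
    (∀ p : ℝ, 0 < p →
      ExpWellDefined (IRW.μ p) (IRW.A p) ∧
      ExpWellDefined (IRW.μ p) (Complex.I • (IRW.a ∘ₗ IRW.adag)) ∧
      (∀ α β : ℝ,
        IsSymmetry (gen G IRW.rate) (IRW.S p α β) ∧
        ExtendsToUnitary (IRW.μ p) (IRW.S p α β) ∧
        ExtendsToUnitary (weightMeasure (prodWeight (V := V) (IRW.w p)))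
          (tensorOp (IRW.S p α β)) ∧
        IsSelfDuality (gen G IRW.rate) (prodFun (applyTo (IRW.S p α β) (IRW.cheap p))) ∧
        OrthogonalWithNormOf (IRW.μ p)
          (applyTo (IRW.S p α β) (IRW.cheap p)) (IRW.cheap p) ∧
        OrthogonalWithNormOf (weightMeasure (prodWeight (V := V) (IRW.w p)))
          (prodFun (applyTo (IRW.S p α β) (IRW.cheap p))) (prodFun (IRW.cheap p))) ∧
      (∀ x y : ℕ,
        applyTo (IRW.S p Real.pi 1) (IRW.cheap p) x y =
          (Real.exp (-p / 2) : ℂ) * (charlier p x y : ℂ))) := by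
  refine ⟨fun k p hk hp hp1 => ⟨?_, ?_, fun α β => ?_, fun x y => ?_⟩,
    fun n p _ hp hp1 => ⟨fun α β => ?_, fun x y => ?_⟩,
    fun p hp => ⟨?_, ?_, fun α β => ?_, fun x y => ?_⟩⟩
  · rw [SIP.A_eq hk hp]
    exact (SIP.isAdmissible hk hp hp1).expWellDefined
  · exact expWellDefined_of_single (SIP.w_pos hk hp hp1)
      (isMaximallySkew_multBy (SIP.w_pos hk hp hp1) _)
      (isExpOrbit_multBy (SIP.w_pos hk hp hp1) _)
  · rw [SIP.rate_eq hk hp, SIP.cheap_eq]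
    exact (SIP.isAdmissible hk hp hp1).dualities G α k β (SIP.S_eq hk hp hp1 α β)
      (SIP.cheap_mul_w hk hp)
  · exact SIP.applyTo_S_meixner hk hp hp1 x y
  · rw [SEP.rate_eq (SEP.odds_pos hp hp1), SEP.cheap_eq]
    exact (SEP.isAdmissible hp hp1 (SEP.odds_pos hp hp1) rfl).dualities G α (-(n / 2)) β
      (fun f _ => SEP.S_eq (SEP.odds_pos hp hp1) rfl α β f) (SEP.cheap_mul_w hp hp1)
  · exact SEP.applyTo_S_krawtchouk hp hp1 x y
  · rw [IRW.A_eq]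
    exact (IRW.isAdmissible hp).expWellDefined
  · rw [IRW.a_comp_adag (p := p)]
    exact expWellDefined_of_single (IRW.w_pos hp) (isMaximallySkew_multBy (IRW.w_pos hp) _)
      (isExpOrbit_multBy (IRW.w_pos hp) _)
  · rw [IRW.rate_eq p, IRW.cheap_eq]
    exact (IRW.isAdmissible hp).dualities G α 0 β (IRW.S_eq hp α β) (IRW.cheap_mul_w hp)
  · exact IRW.applyTo_S_charlier hp x y
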